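/- **Setting.** Fix the number $K$ of arms. A single index bandit with Gaussian design in dimension $d$ over $T$ rounds is given by a continuously differentiable link $f:\mathbb R\to\mathbb R$, a vector $\theta_*\in\mathbb R^d$, a mean $\mu_X\in\mathbb R^d$ and a positive definite covariance matrix $\Sigma_X$, with $\|\Sigma_X^{1/2}\theta_*\|_1=1$ and $\mu_*:=\mathbb E f'(X^\top\theta_*)>0$ for $X\sim N(\mu_X,\Sigma_X)$. In round $t\in\{1,\dots,T\}$ the arms $x_{t,1},\dots,x_{t,K}$ are drawn i.i.d. from $N(\mu_X,\Sigma_X)$, independently of the past; the agent plays one of them, $x_t$, and observes $y_t=f(x_t^\top\theta_*)+\eta_t$, where, given the past, the arms of round $t$ and the arm played, $\eta_t$ has mean $0$ and variance at most $\sigma^2$. The regret is $$R_T=\sum_{t=1}^T\Big(\max_{1\le k\le K}f(x_{t,k}^\top\theta_*)-f(x_t^\top\theta_*)\Big).$$ **Algorithm (GSTOR) with parameters $T_1,\tau,W,h$ and $\lambda=0$.** Let $S=-\nabla\log p$, with $p$ the density of $N(\mu_X,\Sigma_X)$, and let $\phi_\tau(v)=(\operatorname{sign}(v_j)\min(|v_j|,\tau))_j$.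 (1) In rounds $t\le 2T_1$ (and $t \le T$), play an arm uniformly at random, independently of everything so far. (2) Let $\hat\theta$ minimize $\|\theta\|_2^2-\frac{2}{T_1}\sum_{i=1}^{T_1}\phi_\tau(y_iS(x_i))^\top\theta$ over $\theta\in\mathbb R^d$, and set $\hat\theta_0=\hat\theta/\|\Sigma_X^{1/2}\hat\theta\|_1$ (with $\hat\theta_0=0$ if $\hat\theta=0$). (3) With $K_h(v)=h^{-1}\mathbf 1_{\{|v|\le h\}}$ and $0/0=0$, let $$\hat f(z)=\frac{\sum_{i=T_1+1}^{2T_1}y_iK_h(z-x_i^\top\hat\theta_0)}{\sum_{i=T_1+1}^{2T_1}K_h(z-x_i^\top\hat\theta_0)}\ \text{ if } |z-\mu_X^\top\hat\theta_0|\le W,\qquad \hat f(z)=0\ \text{ otherwise.}$$ (4) In rounds $2T_1<t\le T$ play an arm that maximizes $\hat f(x_{t,k}^\top\hat\theta_0)$ over $k$, breaking ties arbitrarily. **Theorem.** Let $K$, $L_f,L_{f'},\sigma,c,p\in\mathbb R$ and $m,c_{\min},c_{\max},\delta_0>0$ be given. There is a constant $C$, depending only on these, such that the following holds for all $d$, $T$,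 all $\delta\in(0,1)$ with $\delta\ge\delta_0T^{-p}$ (for instance a fixed $\delta=\delta_0$, with $p=0$), and every bandit as above with $|f|\le L_f$, $|f'|\le L_{f'}$ on $\mathbb R$, $\mu_*\ge m$, all eigenvalues of $\Sigma_X$ in $[c_{\min},c_{\max}]$, and $d^{15}\le cT^2$. If GSTOR is run with $$T_1=\lceil d^{3/8}T^{3/4}\rceil,\quad \tau=\sqrt{3T_1/\log(2d/\delta)},\quad W=2\log T_1,\quad h=T_1^{-1/3},\quad\lambda=0,$$ then $R_T$ is integrable and $\mathbb E(R_T)\le C\,d^{3/8}T^{3/4}$. -/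

import Mathlib

open MeasureTheory ProbabilityTheory
open scoped MatrixOrder

noncomputable section

namespace SingleIndexBandit

/-- `ℝ^d` with the Euclidean inner product. -/
abbrev Vec (d : ℕ) : Type := EuclideanSpace ℝ (Fin d)

/-- The `ℓ¹` norm of a vector. -/
def l1Norm {d : ℕ} (v : Vec d) : ℝ := ∑ j, |v j|

/-- `Σ^{1/2} v`, with the positive semidefinite square root of `Σ`. -/
def sqrtMul {d : ℕ} (S : Matrix (Fin d) (Fin d) ℝ) (v : Vec d) : Vec d :=
  Matrix.toEuclideanCLM (𝕜 := ℝ) (CFC.sqrt S) v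

/-- The Lebesgue density of `N(μ, Σ)` for positive definite `Σ`. -/
def gaussianDensity {d : ℕ} (μ : Vec d) (S : Matrix (Fin d) (Fin d) ℝ) (x : Vec d) : ℝ :=
  (Real.sqrt ((2 * Real.pi) ^ d * S.det))⁻¹ *
    Real.exp (-(inner ℝ (x - μ) (Matrix.toEuclideanCLM (𝕜 := ℝ) S⁻¹ (x - μ))) / 2)

/-- The score function `-∇ log p` of a density `p`. -/
def score {d : ℕ} (p : Vec d → ℝ) (x : Vec d) : Vec d :=
  -gradient (fun z => Real.log (p z)) x

/-- Elementwise truncation `φ_τ`. -/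
def truncate {d : ℕ} (τ : ℝ) (v : Vec d) : Vec d :=
  WithLp.toLp 2 fun j => Real.sign (v j) * min |v j| τ

/-- The (regularized) objective of the Stein estimator, for the score function `S` and the
samples `(xs i, ys i)`. -/
def steinObjective {d n : ℕ} (S : Vec d → Vec d) (τ lam : ℝ) (xs : Fin n → Vec d)
    (ys : Fin n → ℝ) (θ : Vec d) : ℝ :=
  ‖θ‖ ^ 2 - 2 / (n : ℝ) * ∑ i, inner ℝ (truncate τ (ys i • S (xs i))) θ + lam * l1Norm θ

/-- The uniform kernel `K_h(v) = h⁻¹ 1_{|v| ≤ h}`. -/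
def uniformKernel (h v : ℝ) : ℝ := Set.indicator {u : ℝ | |u| ≤ h} (fun _ => 1 / h) v

/-- The truncated uniform-kernel regression estimate of the link function along the
direction `θ₀`. The convention `0 / 0 = 0` is in force. -/
def kernelRegression {d n : ℕ} (μ : Vec d) (W h : ℝ) (θ₀ : Vec d) (xs : Fin n → Vec d)
    (ys : Fin n → ℝ) (z : ℝ) : ℝ :=
  open Classical in
  if |z - inner ℝ μ θ₀| ≤ W then
    (∑ i, ys i * uniformKernel h (z - inner ℝ (xs i) θ₀)) /
      ∑ i, uniformKernel h (z - inner ℝ (xs i) θ₀)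
  else 0

/-- The unknown parameters of a single index bandit with Gaussian design. -/
structure Problem (d : ℕ) where
  /-- the link (reward) function -/
  f : ℝ → ℝ
  /-- the index vector `θ_*` -/
  θ : Vec d
  /-- the mean of a feature vector -/
  μX : Vec d
  /-- the covariance matrix of a feature vector -/
  SX : Matrix (Fin d) (Fin d) ℝ

namespace Problem

variable {d : ℕ} (I : Problem d)

/-- The law `N(μ_X, Σ_X)` of a feature vector. -/
def law : Measure (Vec d) := multivariateGaussian I.μX I.SX

/-- `μ_* = E f'(Xᵀ θ_*)` for `X ∼ N(μ_X, Σ_X)`. -/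
def meanSlope : ℝ := ∫ x, deriv I.f (inner ℝ x I.θ) ∂I.law

/-- The assumptions on the problem, with the constants on which a bound may depend: bounds
`Lf`, `Lf'` for `|f|`, `|f'|`, a lower bound `m` for `μ_*`, and bounds `cmin`, `cmax` for the
eigenvalues of `Σ_X` (stated through its quadratic form). -/
structure Admissible (Lf Lf' m cmin cmax : ℝ) : Prop where
  smooth : ContDiff ℝ 1 I.f
  f_bdd : ∀ z, |I.f z| ≤ Lf
  deriv_bdd : ∀ z, |deriv I.f z| ≤ Lf'
  posDef : I.SX.PosDef
  eig_lower : ∀ v : Fin d → ℝ, cmin * (v ⬝ᵥ v) ≤ v ⬝ᵥ I.SX.mulVec v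
  eig_upper : ∀ v : Fin d → ℝ, v ⬝ᵥ I.SX.mulVec v ≤ cmax * (v ⬝ᵥ v)
  normalized : l1Norm (sqrtMul I.SX I.θ) = 1
  slope : m ≤ I.meanSlope

end Problem

section Interaction

/- Rounds are numbered `0, …, T - 1`. In round `t` the arms are `x t k`, `k : Fin K`; the agent
plays the arm with index `a t`, and `η t` is the noise of the observed reward. -/
variable {Ω : Type*} {d K : ℕ}

/-- The feature vector of the arm played in round `t`. -/
def played (x : ℕ → Fin K → Ω → Vec d) (a : ℕ → Ω → Fin K) (t : ℕ) (ω : Ω) : Vec d :=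
  x t (a t ω) ω

/-- The reward `f(x_tᵀ θ_*) + η_t` observed in round `t`. -/
def reward (I : Problem d) (x : ℕ → Fin K → Ω → Vec d) (a : ℕ → Ω → Fin K) (η : ℕ → Ω → ℝ)
    (t : ℕ) (ω : Ω) : ℝ :=
  I.f (inner ℝ (played x a t ω) I.θ) + η t ω

/-- The arm set of round `t`. -/
def arms (x : ℕ → Fin K → Ω → Vec d) (t : ℕ) (ω : Ω) : Fin K → Vec d := fun k => x t k ω

/-- All that happened before round `t`: arm sets, played arms, noises. -/
def history (x : ℕ → Fin K → Ω → Vec d) (a : ℕ → Ω → Fin K) (η : ℕ → Ω → ℝ) (t : ℕ) (ω : Ω) :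
    Fin t → (Fin K → Vec d) × Fin K × ℝ :=
  fun s => (arms x s ω, a s ω, η s ω)

/-- The information available just before the reward of round `t` is drawn: the history, the
arm set of round `t` and the arm that is played. -/
abbrev preReward (x : ℕ → Fin K → Ω → Vec d) (a : ℕ → Ω → Fin K) (η : ℕ → Ω → ℝ) (t : ℕ) :
    MeasurableSpace Ω :=
  MeasurableSpace.comap (fun ω => (history x a η t ω, arms x t ω, a t ω)) inferInstance

/-- The cumulative regret over `T` rounds, against the arm of largest expected reward. -/
def regret (I : Problem d) (x : ℕ → Fin K → Ω → Vec d) (a : ℕ → Ω → Fin K) (T : ℕ) (ω : Ω) : ℝ :=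
  ∑ t ∈ Finset.range T,
    ((⨆ k, I.f (inner ℝ (x t k ω) I.θ)) - I.f (inner ℝ (played x a t ω) I.θ))

variable [MeasurableSpace Ω]

/-- The stochastic environment over `T` rounds: in each round the `K` arms are i.i.d. from
`N(μ_X, Σ_X)` and independent of the past, and the noise has, given the past and the present
arms, mean zero and variance at most `σ²`. -/
structure IsEnvironment (I : Problem d) (σ : ℝ) (T : ℕ) (P : Measure Ω)
    (x : ℕ → Fin K → Ω → Vec d) (a : ℕ → Ω → Fin K) (η : ℕ → Ω → ℝ) : Prop where
  measurable_arm : ∀ t < T, ∀ k, Measurable (x t k)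
  measurable_action : ∀ t < T, Measurable (a t)
  measurable_noise : ∀ t < T, Measurable (η t)
  arms_law : ∀ t < T, P.map (arms x t) = Measure.pi fun _ : Fin K => I.law
  arms_indep : ∀ t < T, IndepFun (arms x t) (history x a η t) P
  noise_memLp : ∀ t < T, MemLp (η t) 2 P
  noise_mean : ∀ t < T, P[η t | preReward x a η t] =ᵐ[P] 0
  noise_var : ∀ t < T, ∀ᵐ ω ∂P, (P[fun ω' => η t ω' ^ 2 | preReward x a η t]) ω ≤ σ ^ 2

/-- The normalized estimator `θ̂₀ = θ̂ / ‖Σ_X^{1/2} θ̂‖₁`. -/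
def normalizedEstimator (I : Problem d) (θhat : Vec d) : Vec d :=
  (l1Norm (sqrtMul I.SX θhat))⁻¹ • θhat

/-- The link function estimated from the samples of the second exploration phase. -/
def linkEstimate (I : Problem d) (T₁ : ℕ) (W h : ℝ) (x : ℕ → Fin K → Ω → Vec d)
    (a : ℕ → Ω → Fin K) (η : ℕ → Ω → ℝ) (θhat : Ω → Vec d) (ω : Ω) : ℝ → ℝ :=
  kernelRegression (n := T₁) I.μX W h (normalizedEstimator I (θhat ω))
    (fun i => played x a (T₁ + i) ω) (fun i => reward I x a η (T₁ + i) ω)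

/-- The actions `a` are those of GSTOR with horizon `T` and parameters `T₁, lam, τ, W, h`:
in the rounds `t < 2 T₁` an arm is played uniformly at random; `θ̂` minimizes the Stein objective
on the first `T₁` samples; the link is estimated from the next `T₁` samples; afterwards an arm
that maximizes the estimated reward is played, with arbitrary tie-breaking. -/
structure IsGSTOR (I : Problem d) (T T₁ : ℕ) (lam τ W h : ℝ) (P : Measure Ω)
    (x : ℕ → Fin K → Ω → Vec d) (a : ℕ → Ω → Fin K) (η : ℕ → Ω → ℝ)
    (θhat : Ω → Vec d) : Prop where
  explore_uniform : ∀ t < T, t < 2 * T₁ → ∀ k, P {ω | a t ω = k} = (K : ENNReal)⁻¹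
  explore_indep : ∀ t < T, t < 2 * T₁ →
    IndepFun (a t) (fun ω => (history x a η t ω, arms x t ω)) P
  estimator : ∀ ω, IsMinOn
    (steinObjective (n := T₁) (score (gaussianDensity I.μX I.SX)) τ lam
      (fun i => played x a i ω) (fun i => reward I x a η i ω)) Set.univ (θhat ω)
  greedy : ∀ t < T, 2 * T₁ ≤ t → ∀ ω k,
    linkEstimate I T₁ W h x a η θhat ω (inner ℝ (x t k ω) (normalizedEstimator I (θhat ω))) ≤
      linkEstimate I T₁ W h x a η θhat ω
        (inner ℝ (played x a t ω) (normalizedEstimator I (θhat ω)))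

end Interaction

end SingleIndexBandit

end

/-!
Stein's identity turns the score-weighted average of the rewards into `μ_* θ_*`, so the truncated
average over the first `T₁` samples has the direction of `θ_*` up to an error of order
`d √(log (2 d / δ) / T₁)` after `ℓ¹` normalization. Along the estimated direction, window regression
has bias of order `h` plus this error, and variance of order `1 / (T₁ ν)`, where `ν` is the mass of
the window; averaging `1 / ν` over the law of a fresh arm costs only a factor `1 / h`, which leaves
`h + 1 / (T₁ h²)`. A greedy round loses at most twice the sum over the arms of the errors of the
estimated rewards. Exploration costs `O(T₁)` and exploitation `O(T √d h)`; with `h = T₁ ^ (-1 / 3)`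
the choice `T₁ = d ^ (3 / 8) T ^ (3 / 4)` balances the two.
-/

namespace SingleIndexBandit

section ConditionalExpectation

variable {Ω : Type*} {m m₁ m₂ mΩ : MeasurableSpace Ω} {P : Measure Ω}

lemma generateFrom_inter_eq_sup :
    MeasurableSpace.generateFrom
      (Set.image2 (· ∩ ·) {A | MeasurableSet[m₁] A} {B | MeasurableSet[m₂] B}) = m₁ ⊔ m₂ := by
  refine le_antisymm (MeasurableSpace.generateFrom_le ?_) (sup_le (fun A hA => ?_) fun B hB => ?_)
  · rintro _ ⟨A, hA, B, hB, rfl⟩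
    exact (le_sup_left (b := m₂) A hA).inter (le_sup_right (a := m₁) B hB)
  · exact MeasurableSpace.measurableSet_generateFrom
      ⟨A, hA, Set.univ, MeasurableSet.univ, Set.inter_univ A⟩
  · exact MeasurableSpace.measurableSet_generateFrom
      ⟨Set.univ, MeasurableSet.univ, B, hB, Set.univ_inter B⟩

lemma isPiSystem_inter :
    IsPiSystem (Set.image2 (· ∩ ·) {A | MeasurableSet[m₁] A} {B | MeasurableSet[m₂] B}) := by
  rintro _ ⟨A, hA, B, hB, rfl⟩ _ ⟨A', hA', B', hB', rfl⟩ -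
  exact ⟨A ∩ A', hA.inter hA', B ∩ B', hB.inter hB', Set.inter_inter_inter_comm A A' B B'⟩

lemma setIntegral_inter_of_indep (hm₁ : m₁ ≤ mΩ) (hm₂ : m₂ ≤ mΩ) (hind : Indep m₁ m₂ P)
    {f : Ω → ℝ} (hf : StronglyMeasurable[m₁] f) {A B : Set Ω} (hA : MeasurableSet[m₁] A)
    (hB : MeasurableSet[m₂] B) :
    ∫ ω in A ∩ B, f ω ∂P = (∫ ω in A, f ω ∂P) * P.real B := by
  have hB' : Measurable[m₂] (B.indicator (1 : Ω → ℝ)) :=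
    (@measurable_const ℝ Ω _ m₂ 1).indicator hB
  have hAB : IndepFun (A.indicator f) (B.indicator (1 : Ω → ℝ)) P :=
    indep_of_indep_of_le_left
      (indep_of_indep_of_le_right hind hB'.comap_le)
      (hf.measurable.indicator hA).comap_le
  rw [← integral_indicator ((hm₁ A hA).inter (hm₂ B hB)), ← integral_indicator (hm₁ A hA),
    ← integral_indicator_one (hm₂ B hB), ← hAB.integral_fun_mul_eq_mul_integral
      ((hf.mono hm₁).indicator (hm₁ A hA)).aestronglyMeasurable
      (hB'.mono hm₂ le_rfl).aestronglyMeasurable]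
  refine integral_congr_ae (ae_of_all _ fun ω => ?_)
  by_cases h₁ : ω ∈ A <;> by_cases h₂ : ω ∈ B <;> simp [h₁, h₂]

variable [IsProbabilityMeasure P]

lemma condExp_sup_eq_of_indep (hm : m ≤ m₁) (hm₁ : m₁ ≤ mΩ) (hm₂ : m₂ ≤ mΩ)
    (hind : Indep m₁ m₂ P) {f : Ω → ℝ} (hf : StronglyMeasurable[m₁] f) (hint : Integrable f P) :
    P[f | m ⊔ m₂] =ᵐ[P] P[f | m] := by
  have hle : m ⊔ m₂ ≤ mΩ := sup_le (hm.trans hm₁) hm₂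
  have hmeas : StronglyMeasurable[m ⊔ m₂] (P[f | m]) := stronglyMeasurable_condExp.mono le_sup_left
  refine (ae_eq_condExp_of_forall_setIntegral_eq hle hint
    (fun _ _ _ => integrable_condExp.integrableOn) (fun C hC _ => ?_)
    hmeas.aestronglyMeasurable).symm
  induction C, hC using MeasurableSpace.induction_on_inter
    generateFrom_inter_eq_sup.symm isPiSystem_inter with
  | empty => simp
  | basic C hC =>
    obtain ⟨A, hA, B, hB, rfl⟩ := hC
    have hA₁ : MeasurableSet[m₁] A := hm A hA
    rw [setIntegral_inter_of_indep hm₁ hm₂ hind (stronglyMeasurable_condExp.mono hm) hA₁ hB,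
      setIntegral_inter_of_indep hm₁ hm₂ hind hf hA₁ hB, setIntegral_condExp (hm.trans hm₁) hint hA]
  | compl C hC ih =>
    rw [setIntegral_compl (hle C hC) integrable_condExp, setIntegral_compl (hle C hC) hint,
      ih (measure_lt_top _ _), integral_condExp (hm.trans hm₁)]
  | iUnion s hd hs ih =>
    rw [integral_iUnion (fun i => hle _ (hs i)) hd integrable_condExp.integrableOn,
      integral_iUnion (fun i => hle _ (hs i)) hd hint.integrableOn]
    exact tsum_congr fun i => ih i (measure_lt_top _ _)

lemma integral_mul_eq_zero_of_condExp_eq_zero (hm : m ≤ mΩ) {D G : Ω → ℝ} (hD : Integrable D P)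
    (hzero : P[D | m] =ᵐ[P] 0) (hG : Measurable[m] G) (hint : Integrable (D * G) P) :
    ∫ ω, D ω * G ω ∂P = 0 := by
  change ∫ ω, (D * G) ω ∂P = 0
  rw [← integral_condExp hm, integral_eq_zero_of_ae]
  filter_upwards [condExp_mul_of_stronglyMeasurable_right hG.stronglyMeasurable hint hD, hzero]
    with ω hpull hω
  rw [hpull, Pi.mul_apply, hω, Pi.zero_apply, zero_mul]

lemma integral_sq_sum_of_condExp_eq_zero {n : ℕ} {D : ℕ → Ω → ℝ} {𝓗 : ℕ → MeasurableSpace Ω}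
    (h𝓗 : ∀ i < n, 𝓗 i ≤ mΩ) (hmeas : ∀ i < n, ∀ j < i, Measurable[𝓗 i] (D j))
    (hL2 : ∀ i < n, MemLp (D i) 2 P) (hzero : ∀ i < n, P[D i | 𝓗 i] =ᵐ[P] 0) :
    ∫ ω, (∑ i ∈ Finset.range n, D i ω) ^ 2 ∂P = ∑ i ∈ Finset.range n, ∫ ω, D i ω ^ 2 ∂P := by
  induction n with
  | zero => simp
  | succ n ih =>
    have hS : MemLp (fun ω => ∑ i ∈ Finset.range n, D i ω) 2 P :=
      memLp_finsetSum _ fun i hi => hL2 i ((Finset.mem_range.1 hi).trans n.lt_succ_self)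
    have hDn : MemLp (D n) 2 P := hL2 n n.lt_succ_self
    have hcross : ∫ ω, D n ω * ∑ i ∈ Finset.range n, D i ω ∂P = 0 :=
      integral_mul_eq_zero_of_condExp_eq_zero (h𝓗 n n.lt_succ_self)
        (hDn.integrable one_le_two) (hzero n n.lt_succ_self)
        (Finset.measurable_fun_sum _ fun i hi =>
          hmeas n n.lt_succ_self i (Finset.mem_range.1 hi)) (hDn.integrable_mul hS)
    have hexpand : ∀ ω, (∑ i ∈ Finset.range (n + 1), D i ω) ^ 2 =
        (∑ i ∈ Finset.range n, D i ω) ^ 2 + 2 * (D n ω * ∑ i ∈ Finset.range n, D i ω) +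
          D n ω ^ 2 := fun ω => by rw [Finset.sum_range_succ]; ring
    rw [Finset.sum_range_succ, ← ih (fun i hi => h𝓗 i (by omega)) (fun i hi => hmeas i (by omega))
      (fun i hi => hL2 i (by omega)) fun i hi => hzero i (by omega)]
    simp_rw [hexpand]
    have hint := (hDn.integrable_mul hS).const_mul 2
    simp only [Pi.mul_apply] at hint
    rw [integral_add (hS.integrable_sq.fun_add hint) hDn.integrable_sq,
      integral_add hS.integrable_sq hint, integral_const_mul, hcross, mul_zero, add_zero]

lemma setLIntegral_sq_le_of_condExp_sq_le (hm : m ≤ mΩ) {Y : Ω → ℝ} {v : ℝ} (hv : 0 ≤ v)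
    (hY : MemLp Y 2 P) (hvar : ∀ᵐ ω ∂P, (P[fun ω' => Y ω' ^ 2 | m]) ω ≤ v) {A : Set Ω}
    (hA : MeasurableSet[m] A) :
    ∫⁻ ω in A, ENNReal.ofReal (Y ω ^ 2) ∂P ≤ ENNReal.ofReal v * P A := by
  rw [← ofReal_integral_eq_lintegral_ofReal hY.integrable_sq.integrableOn
    (ae_of_all _ fun ω => sq_nonneg _), ← setIntegral_condExp hm hY.integrable_sq hA]
  have hcond : Integrable (P[fun ω' => Y ω' ^ 2 | m]) P := integrable_condExp
  calc ENNReal.ofReal (∫ ω in A, (P[fun ω' => Y ω' ^ 2 | m]) ω ∂P)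
      ≤ ENNReal.ofReal (∫ _ω in A, v ∂P) :=
        ENNReal.ofReal_le_ofReal (integral_mono_ae hcond.integrableOn
          (integrable_const _) (ae_restrict_of_ae hvar))
    _ = ENNReal.ofReal v * P A := by
        rw [setIntegral_const, smul_eq_mul, mul_comm, ENNReal.ofReal_mul hv, ofReal_measureReal]

lemma lintegral_sq_mul_le_of_condExp_sq_le (hm : m ≤ mΩ) {Y : Ω → ℝ} {v : ℝ} (hv : 0 ≤ v)
    (hmeas : Measurable Y) (hY : MemLp Y 2 P)
    (hvar : ∀ᵐ ω ∂P, (P[fun ω' => Y ω' ^ 2 | m]) ω ≤ v) {k : Ω → ENNReal} (hk : Measurable[m] k) :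
    ∫⁻ ω, ENNReal.ofReal (Y ω ^ 2) * k ω ∂P ≤ ENNReal.ofReal v * ∫⁻ ω, k ω ∂P := by
  have hle : (P.withDensity fun ω => ENNReal.ofReal (Y ω ^ 2)).trim hm ≤
      (ENNReal.ofReal v • P).trim hm := by
    refine Measure.le_iff.2 fun A hA => ?_
    rw [trim_measurableSet_eq hm hA, trim_measurableSet_eq hm hA, withDensity_apply _ (hm A hA)]
    exact setLIntegral_sq_le_of_condExp_sq_le hm hv hY hvar hA
  have := lintegral_mono' hle (le_refl k)
  rwa [lintegral_trim hm hk, lintegral_trim hm hk, lintegral_withDensity_eq_lintegral_mul _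
    (by fun_prop) (hk.mono hm le_rfl), lintegral_smul_measure] at this

lemma lintegral_comp_of_indep {E E' : Type*} [MeasurableSpace E] [MeasurableSpace E']
    (hm : m ≤ mΩ) {X : Ω → E} {Z : Ω → E'} (hX : Measurable X)
    (hind : Indep (MeasurableSpace.comap X inferInstance) m P) (hZ : Measurable[m] Z)
    {Φ : E' × E → ENNReal} (hΦ : Measurable Φ) :
    ∫⁻ ω, Φ (Z ω, X ω) ∂P = ∫⁻ ω, ∫⁻ x, Φ (Z ω, x) ∂(P.map X) ∂P := by
  have hZ' : Measurable Z := hZ.mono hm le_rfl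
  have hZX : IndepFun Z X P := indep_of_indep_of_le_left hind.symm hZ.comap_le
  have : IsProbabilityMeasure (P.map X) := Measure.isProbabilityMeasure_map hX.aemeasurable
  rw [← lintegral_map hΦ (hZ'.prodMk hX),
    (indepFun_iff_map_prod_eq_prod_map_map hZ'.aemeasurable hX.aemeasurable).1 hZX,
    lintegral_prod _ hΦ.aemeasurable, lintegral_map hΦ.lintegral_prod_right' hZ']

end ConditionalExpectation

section Sampling

variable {Ω E : Type*} {mΩ : MeasurableSpace Ω} [MeasurableSpace E]

/-- A stream of regression samples: the designs `X i` are drawn from `ν` independently of the past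
`F i`, and the noise `η i` is, given the past and `X i`, centered with variance at most `σ²`. -/
structure IsSampling (P : Measure Ω) (ν : Measure E) (σ : ℝ) (F : ℕ → MeasurableSpace Ω) (N : ℕ)
    (X : ℕ → Ω → E) (η : ℕ → Ω → ℝ) : Prop where
  le : ∀ i ≤ N, F i ≤ mΩ
  le_succ : ∀ i < N, F i ≤ F (i + 1)
  measurable_design_succ : ∀ i < N, Measurable[F (i + 1)] (X i)
  measurable_noise_succ : ∀ i < N, Measurable[F (i + 1)] (η i)
  law : ∀ i < N, P.map (X i) = ν
  indep : ∀ i < N, Indep (MeasurableSpace.comap (X i) inferInstance) (F i) P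
  noise_memLp : ∀ i < N, MemLp (η i) 2 P
  noise_mean : ∀ i < N, P[η i | F i ⊔ MeasurableSpace.comap (X i) inferInstance] =ᵐ[P] 0
  noise_var : ∀ i < N, ∀ᵐ ω ∂P,
    (P[fun ω' => η i ω' ^ 2 | F i ⊔ MeasurableSpace.comap (X i) inferInstance]) ω ≤ σ ^ 2

/-- The designs of the `n` samples that start with sample `n₀`. -/
def batch (X : ℕ → Ω → E) (n₀ n : ℕ) (ω : Ω) : Fin n → E := fun i => X (n₀ + i) ω

/-- What is known just before the noise of sample `n₀ + i` is drawn, enlarged by the later designs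
of the batch of `n` samples that starts with sample `n₀`. -/
abbrev batchInfo (F : ℕ → MeasurableSpace Ω) (X : ℕ → Ω → E) (n₀ n i : ℕ) : MeasurableSpace Ω :=
  F (n₀ + i) ⊔ MeasurableSpace.comap (X (n₀ + i)) inferInstance ⊔
    MeasurableSpace.comap (batch X (n₀ + i + 1) (n - (i + 1))) inferInstance

namespace IsSampling

variable {P : Measure Ω} {ν : Measure E} {σ : ℝ} {F : ℕ → MeasurableSpace Ω} {N : ℕ}
  {X : ℕ → Ω → E} {η : ℕ → Ω → ℝ} {n₀ n : ℕ}

lemma le_of_le (hs : IsSampling P ν σ F N X η) {i j : ℕ} (hij : i ≤ j) (hj : j ≤ N) :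
    F i ≤ F j := by
  induction j, hij using Nat.le_induction with
  | base => exact le_rfl
  | succ k _ ih => exact (ih (by omega)).trans (hs.le_succ k (by omega))

lemma measurable_design_of_lt (hs : IsSampling P ν σ F N X η) {i j : ℕ} (hij : i < j)
    (hj : j ≤ N) : Measurable[F j] (X i) :=
  (hs.measurable_design_succ i (by omega)).mono (hs.le_of_le hij hj) le_rfl

lemma measurable_noise_of_lt (hs : IsSampling P ν σ F N X η) {i j : ℕ} (hij : i < j)
    (hj : j ≤ N) : Measurable[F j] (η i) :=
  (hs.measurable_noise_succ i (by omega)).mono (hs.le_of_le hij hj) le_rfl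

lemma measurable_design (hs : IsSampling P ν σ F N X η) {i : ℕ} (hi : i < N) : Measurable (X i) :=
  (hs.measurable_design_succ i hi).mono (hs.le (i + 1) hi) le_rfl

lemma measurable_noise (hs : IsSampling P ν σ F N X η) {i : ℕ} (hi : i < N) : Measurable (η i) :=
  (hs.measurable_noise_succ i hi).mono (hs.le (i + 1) hi) le_rfl

lemma sup_comap_le_succ (hs : IsSampling P ν σ F N X η) {i : ℕ} (hi : i < N) :
    F i ⊔ MeasurableSpace.comap (X i) inferInstance ≤ F (i + 1) :=
  sup_le (hs.le_succ i hi) (hs.measurable_design_succ i hi).comap_le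

lemma measurable_batch_of_le (hs : IsSampling P ν σ F N X η) {j : ℕ} (hj : n₀ + n ≤ j)
    (hjN : j ≤ N) : Measurable[F j] (batch X n₀ n) :=
  @measurable_pi_lambda _ _ _ (F j) _ _ fun i => hs.measurable_design_of_lt (by omega) hjN

lemma measurable_batch (hs : IsSampling P ν σ F N X η) (hn : n₀ + n ≤ N) :
    Measurable (batch X n₀ n) :=
  (hs.measurable_batch_of_le le_rfl hn).mono (hs.le _ hn) le_rfl

lemma measurable_batch_batchInfo (hs : IsSampling P ν σ F N X η) (hn : n₀ + n ≤ N) {i : ℕ}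
    (hi : i < n) : Measurable[batchInfo F X n₀ n i] (batch X n₀ n) := by
  refine @measurable_pi_lambda _ _ _ (batchInfo F X n₀ n i) _ _ fun k => ?_
  rcases lt_trichotomy (k : ℕ) i with hk | rfl | hk
  · exact (hs.measurable_design_of_lt (by omega) (by omega : n₀ + i ≤ N)).mono
      (le_sup_left.trans le_sup_left) le_rfl
  · exact (comap_measurable _).mono (le_sup_right.trans le_sup_left) le_rfl
  · have hk' := (measurable_pi_apply (⟨k - (i + 1), by omega⟩ : Fin (n - (i + 1)))).comp
      ((comap_measurable (batch X (n₀ + i + 1) (n - (i + 1)))).mono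
        (le_sup_right : _ ≤ batchInfo F X n₀ n i) le_rfl)
    convert hk' using 2
    simp only [batch, Function.comp_apply]
    congr 1
    omega

lemma measure_inter_batch_preimage_pi (hs : IsSampling P ν σ F N X η) (hn : n₀ + n ≤ N)
    {A : Set Ω} (hA : MeasurableSet[F n₀] A) {C : Fin n → Set E} (hC : ∀ i, MeasurableSet (C i)) :
    P (A ∩ batch X n₀ n ⁻¹' Set.univ.pi C) = P A * ∏ i, ν (C i) := by
  induction n with
  | zero =>
    have huniv : batch X n₀ 0 ⁻¹' Set.univ.pi C = Set.univ :=
      Set.eq_univ_of_forall fun ω i => i.elim0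
    rw [huniv, Set.inter_univ, Finset.univ_eq_empty, Finset.prod_empty, mul_one]
  | succ n ih =>
    set B := A ∩ batch X n₀ n ⁻¹' Set.univ.pi fun i => C i.castSucc
    have hB : MeasurableSet[F (n₀ + n)] B :=
      (hs.le_of_le (by omega) (by omega) A hA).inter (hs.measurable_batch_of_le le_rfl (by omega)
        (MeasurableSet.univ_pi fun i => hC i.castSucc))
    have hsplit : A ∩ batch X n₀ (n + 1) ⁻¹' Set.univ.pi C =
        X (n₀ + n) ⁻¹' C (Fin.last n) ∩ B := by
      ext ω
      simp only [B, batch, Set.mem_inter_iff, Set.mem_preimage, Set.mem_univ_pi,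
        Fin.forall_fin_succ', Fin.val_castSucc, Fin.val_last]
      tauto
    rw [hsplit, (Indep_iff _ _ _).1 (hs.indep (n₀ + n) (by omega)) _ _ ⟨_, hC _, rfl⟩ hB,
      ih (by omega) fun i => hC i.castSucc, ← Measure.map_apply
        (hs.measurable_design (by omega)) (hC _), hs.law _ (by omega), Fin.prod_univ_castSucc]
    ring

lemma batchInfo_le (hs : IsSampling P ν σ F N X η) (hn : n₀ + n ≤ N) {i : ℕ} (hi : i < n) :
    batchInfo F X n₀ n i ≤ mΩ :=
  sup_le ((hs.sup_comap_le_succ (by omega)).trans (hs.le _ (by omega)))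
    (hs.measurable_batch (by omega)).comap_le

lemma sup_comap_batch_le_batchInfo (hs : IsSampling P ν σ F N X η) (hn : n₀ + n ≤ N) {i : ℕ}
    (hi : i < n) :
    F n₀ ⊔ MeasurableSpace.comap (batch X n₀ n) inferInstance ≤ batchInfo F X n₀ n i :=
  sup_le ((hs.le_of_le (by omega) (by omega)).trans (le_sup_left.trans le_sup_left))
    (hs.measurable_batch_batchInfo hn hi).comap_le

lemma memLp_weighted_noise (hs : IsSampling P ν σ F N X η) (hn : n₀ + n ≤ N)
    {c : ℕ → Ω → ℝ} {B : ℝ}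
    (hc : ∀ i < n, Measurable[F n₀ ⊔ MeasurableSpace.comap (batch X n₀ n) inferInstance] (c i))
    (hB : ∀ i < n, ∀ ω, |c i ω| ≤ B) {i : ℕ} (hi : i < n) :
    MemLp (fun ω => c i ω * η (n₀ + i) ω) 2 P := by
  have hcΩ : Measurable (c i) := (hc i hi).mono
    ((hs.sup_comap_batch_le_batchInfo hn hi).trans (hs.batchInfo_le hn hi)) le_rfl
  refine ((hs.noise_memLp (n₀ + i) (by omega)).const_mul B).of_le
    (hcΩ.mul (hs.measurable_noise (by omega))).aestronglyMeasurable (ae_of_all _ fun ω => ?_)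
  rw [norm_mul, norm_mul]
  exact mul_le_mul_of_nonneg_right ((hB i hi ω).trans (le_abs_self B)) (norm_nonneg _)

variable [IsProbabilityMeasure P] [IsProbabilityMeasure ν]

lemma map_batch (hs : IsSampling P ν σ F N X η) (hn : n₀ + n ≤ N) :
    P.map (batch X n₀ n) = Measure.pi fun _ => ν := by
  refine (Measure.pi_eq fun C hC => ?_).symm
  rw [Measure.map_apply (hs.measurable_batch hn) (MeasurableSet.univ_pi hC), ← Set.univ_inter
    (batch X n₀ n ⁻¹' _), hs.measure_inter_batch_preimage_pi hn MeasurableSet.univ hC,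
    measure_univ, one_mul]

lemma indep_batch (hs : IsSampling P ν σ F N X η) (hn : n₀ + n ≤ N) :
    Indep (MeasurableSpace.comap (batch X n₀ n) inferInstance) (F n₀) P := by
  refine IndepSets.indep (hs.measurable_batch hn).comap_le (hs.le n₀ (by omega))
    (isPiSystem_pi.comap (batch X n₀ n)) (@MeasurableSpace.isPiSystem_measurableSet Ω (F n₀))
    (by rw [← generateFrom_pi, MeasurableSpace.comap_generateFrom]; rfl)
    (@MeasurableSpace.generateFrom_measurableSet Ω (F n₀)).symm ((IndepSets_iff _ _ _).2 ?_)
  rintro _ A ⟨_, ⟨C, hC, rfl⟩, rfl⟩ hA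
  have hC' : ∀ i, MeasurableSet (C i) := fun i => hC i (Set.mem_univ i)
  rw [Set.inter_comm, hs.measure_inter_batch_preimage_pi hn hA hC', mul_comm,
    ← Measure.pi_pi (fun _ => ν) C, ← hs.map_batch hn,
    Measure.map_apply (hs.measurable_batch hn) (MeasurableSet.univ_pi hC')]

lemma lintegral_batch (hs : IsSampling P ν σ F N X η) (hn : n₀ + n ≤ N) {E' : Type*}
    [MeasurableSpace E'] {Z : Ω → E'} (hZ : Measurable[F n₀] Z) {Φ : E' × (Fin n → E) → ENNReal}
    (hΦ : Measurable Φ) :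
    ∫⁻ ω, Φ (Z ω, batch X n₀ n ω) ∂P =
      ∫⁻ ω, ∫⁻ xs, Φ (Z ω, xs) ∂(Measure.pi fun _ => ν) ∂P := by
  rw [lintegral_comp_of_indep (hs.le n₀ (by omega)) (hs.measurable_batch hn) (hs.indep_batch hn)
    hZ hΦ, hs.map_batch hn]

lemma condExp_batchInfo (hs : IsSampling P ν σ F N X η) (hn : n₀ + n ≤ N) {i : ℕ} (hi : i < n)
    {f : Ω → ℝ} (hf : Measurable[F (n₀ + i + 1)] f) (hint : Integrable f P) :
    P[f | batchInfo F X n₀ n i] =ᵐ[P]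
      P[f | F (n₀ + i) ⊔ MeasurableSpace.comap (X (n₀ + i)) inferInstance] :=
  condExp_sup_eq_of_indep (hs.sup_comap_le_succ (by omega)) (hs.le _ (by omega))
    (hs.measurable_batch (by omega)).comap_le (hs.indep_batch (by omega)).symm
    hf.stronglyMeasurable hint

section WeightedNoise

variable {c : ℕ → Ω → ℝ} {B : ℝ}

/-- Given all the designs of a batch, its noises remain martingale differences. -/
lemma condExp_weighted_noise (hs : IsSampling P ν σ F N X η) (hn : n₀ + n ≤ N)
    (hc : ∀ i < n, Measurable[F n₀ ⊔ MeasurableSpace.comap (batch X n₀ n) inferInstance] (c i))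
    (hB : ∀ i < n, ∀ ω, |c i ω| ≤ B) {i : ℕ} (hi : i < n) :
    P[fun ω => c i ω * η (n₀ + i) ω | batchInfo F X n₀ n i] =ᵐ[P] 0 := by
  have hint := (hs.noise_memLp (n₀ + i) (by omega)).integrable one_le_two
  have hci : Measurable[batchInfo F X n₀ n i] (c i) :=
    (hc i hi).mono (hs.sup_comap_batch_le_batchInfo hn hi) le_rfl
  filter_upwards [condExp_mul_of_stronglyMeasurable_left hci.stronglyMeasurable
    ((hs.memLp_weighted_noise hn hc hB hi).integrable one_le_two) hint,
    hs.condExp_batchInfo hn hi (hs.measurable_noise_succ _ (by omega)) hint,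
    hs.noise_mean (n₀ + i) (by omega)] with ω hpull h₁ h₂
  exact hpull.trans (by rw [Pi.mul_apply, h₁, h₂, Pi.zero_apply, mul_zero])

lemma lintegral_weighted_noise_sq_le (hs : IsSampling P ν σ F N X η) (hn : n₀ + n ≤ N)
    (hc : ∀ i < n, Measurable[F n₀ ⊔ MeasurableSpace.comap (batch X n₀ n) inferInstance] (c i))
    {i : ℕ} (hi : i < n) :
    ∫⁻ ω, ENNReal.ofReal ((c i ω * η (n₀ + i) ω) ^ 2) ∂P ≤
      ENNReal.ofReal (σ ^ 2) * ∫⁻ ω, ENNReal.ofReal (c i ω ^ 2) ∂P := by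
  simp_rw [mul_pow, mul_comm (c i _ ^ 2), ENNReal.ofReal_mul (sq_nonneg (η _ _))]
  have hci : Measurable[batchInfo F X n₀ n i] (c i) :=
    (hc i hi).mono (hs.sup_comap_batch_le_batchInfo hn hi) le_rfl
  refine lintegral_sq_mul_le_of_condExp_sq_le (hs.batchInfo_le hn hi) (sq_nonneg σ)
    (hs.measurable_noise (by omega)) (hs.noise_memLp _ (by omega)) ?_
    (hci.pow_const 2).ennreal_ofReal
  filter_upwards [hs.condExp_batchInfo hn hi ((hs.measurable_noise_succ _ (by omega)).pow_const 2)
    (hs.noise_memLp _ (by omega)).integrable_sq, hs.noise_var (n₀ + i) (by omega)] with ω h₁ h₂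
  exact h₁.trans_le h₂

lemma lintegral_sq_weighted_noise_le (hs : IsSampling P ν σ F N X η) (hn : n₀ + n ≤ N)
    (hc : ∀ i < n, Measurable[F n₀ ⊔ MeasurableSpace.comap (batch X n₀ n) inferInstance] (c i))
    (hB : ∀ i < n, ∀ ω, |c i ω| ≤ B) :
    ∫⁻ ω, ENNReal.ofReal ((∑ i ∈ Finset.range n, c i ω * η (n₀ + i) ω) ^ 2) ∂P ≤
      ENNReal.ofReal (σ ^ 2) *
        ∑ i ∈ Finset.range n, ∫⁻ ω, ENNReal.ofReal (c i ω ^ 2) ∂P := by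
  have hc' : ∀ i < n, ∀ j < i, Measurable[batchInfo F X n₀ n i]
      fun ω => c j ω * η (n₀ + j) ω := fun i hi j hj =>
    ((hc j (hj.trans hi)).mono (hs.sup_comap_batch_le_batchInfo hn hi) le_rfl).mul
      ((hs.measurable_noise_of_lt (by omega) (by omega : n₀ + i ≤ N)).mono
        (le_sup_left.trans le_sup_left) le_rfl)
  have hL2 : ∀ i < n, MemLp (fun ω => c i ω * η (n₀ + i) ω) 2 P := fun i hi =>
    hs.memLp_weighted_noise hn hc hB hi
  have horth := integral_sq_sum_of_condExp_eq_zero (D := fun i ω => c i ω * η (n₀ + i) ω)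
    (fun i hi => hs.batchInfo_le hn hi) hc' hL2 fun i hi => hs.condExp_weighted_noise hn hc hB hi
  rw [← ofReal_integral_eq_lintegral_ofReal
    (memLp_finsetSum _ fun i hi => hL2 i (Finset.mem_range.1 hi)).integrable_sq
    (ae_of_all _ fun ω => sq_nonneg _), horth, ENNReal.ofReal_sum_of_nonneg fun i _ =>
    integral_nonneg fun ω => sq_nonneg _, Finset.mul_sum]
  refine Finset.sum_le_sum fun i hi => ?_
  rw [ofReal_integral_eq_lintegral_ofReal (hL2 i (Finset.mem_range.1 hi)).integrable_sq
    (ae_of_all _ fun ω => sq_nonneg _)]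
  exact hs.lintegral_weighted_noise_sq_le hn hc (Finset.mem_range.1 hi)

end WeightedNoise

end IsSampling

end Sampling

section SteinIdentity

lemma hasDerivAt_gaussianPDFReal (μ : ℝ) (v : NNReal) (z : ℝ) :
    HasDerivAt (gaussianPDFReal μ v) (-((z - μ) / v) * gaussianPDFReal μ v z) z := by
  have hexponent : HasDerivAt (fun x : ℝ => -(x - μ) ^ 2 / (2 * v)) (-((z - μ) / v)) z := by
    refine ((((hasDerivAt_id z).sub_const μ).pow 2).neg.div_const (2 * (v : ℝ))).congr_deriv ?_
    rw [neg_div, show (2 : ℕ) * (id z - μ) ^ (2 - 1) * 1 = 2 * (z - μ) by simp,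
      mul_div_mul_left _ _ two_ne_zero]
  exact (hexponent.exp.const_mul _).congr_deriv (by rw [gaussianPDFReal]; ring)

lemma integrable_gaussianPDFReal_mul_sub (μ : ℝ) {v : NNReal} (hv : v ≠ 0) :
    Integrable fun z => gaussianPDFReal μ v z * (z - μ) := by
  have hid : Integrable (fun z : ℝ => z - μ) (gaussianReal μ v) :=
    ((memLp_id_gaussianReal 1).integrable le_rfl).sub (integrable_const μ)
  rw [gaussianReal_of_var_ne_zero _ hv, integrable_withDensity_iff_integrable_smul'
    (measurable_gaussianPDF μ v) (ae_of_all _ fun _ => gaussianPDF_lt_top)] at hid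
  simpa only [toReal_gaussianPDF, smul_eq_mul] using hid

variable {f : ℝ → ℝ} {M M' : ℝ}

theorem integral_mul_sub_gaussianReal (hf : Differentiable ℝ f) (hM : ∀ z, |f z| ≤ M)
    (hM' : ∀ z, |deriv f z| ≤ M') (μ : ℝ) (v : NNReal) :
    ∫ z, f z * (z - μ) ∂(gaussianReal μ v) = v * ∫ z, deriv f z ∂(gaussianReal μ v) := by
  rcases eq_or_ne v 0 with rfl | hv
  · simp
  have hf_meas : AEStronglyMeasurable f := hf.continuous.aestronglyMeasurable
  have hpdf := integrable_gaussianPDFReal μ v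
  have hpdf' : ∀ z, -((z - μ) / v) * gaussianPDFReal μ v z =
      -(v : ℝ)⁻¹ * (gaussianPDFReal μ v z * (z - μ)) := fun z => by ring
  have hparts := integral_mul_deriv_eq_deriv_mul_of_integrable
    (fun z _ => (hf z).hasDerivAt) (fun z _ => hasDerivAt_gaussianPDFReal μ v z)
    (((integrable_gaussianPDFReal_mul_sub μ hv).const_mul (-(v : ℝ)⁻¹)).bdd_mul hf_meas
      (ae_of_all _ hM) |>.congr (ae_of_all _ fun z => by rw [Pi.mul_apply, hpdf']))
    (hpdf.bdd_mul (measurable_deriv f).aestronglyMeasurable (ae_of_all _ hM'))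
    (hpdf.bdd_mul hf_meas (ae_of_all _ hM))
  simp_rw [hpdf', mul_left_comm (f _), integral_const_mul, neg_mul, neg_inj] at hparts
  simp_rw [integral_gaussianReal_eq_integral_smul hv, smul_eq_mul,
    mul_comm (gaussianPDFReal μ v _) (deriv f _), ← hparts]
  rw [mul_inv_cancel_left₀ (NNReal.coe_ne_zero.2 hv)]

variable {Ω : Type*} {mΩ : MeasurableSpace Ω} {P : Measure Ω} {U V : Ω → ℝ}

lemma integral_mul_sub_eq_variance_mul_of_hasGaussianLaw (hU : HasGaussianLaw U P)
    (hf : Differentiable ℝ f) (hM : ∀ z, |f z| ≤ M) (hM' : ∀ z, |deriv f z| ≤ M') :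
    ∫ ω, f (U ω) * (U ω - P[U]) ∂P = Var[U; P] * ∫ ω, deriv f (U ω) ∂P := by
  have h := integral_mul_sub_gaussianReal hf hM hM' P[U] Var[U; P].toNNReal
  have hmeas : Measurable f := hf.continuous.measurable
  rwa [← hU.map_eq_gaussianReal, integral_map hU.aemeasurable (by fun_prop),
    integral_map hU.aemeasurable (by fun_prop), Real.coe_toNNReal _ (variance_nonneg _ _)] at h

lemma integral_mul_sub_eq_zero_of_covariance_eq_zero
    (hUV : HasGaussianLaw (fun ω => (U ω, V ω)) P) (hcov : cov[U, V; P] = 0) (hf : Measurable f) :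
    ∫ ω, f (U ω) * (V ω - P[V]) ∂P = 0 := by
  have := hUV.isProbabilityMeasure
  have hprod := ((hUV.indepFun_of_covariance_eq_zero hcov).comp hf
    (measurable_sub_const P[V])).integral_fun_mul_eq_mul_integral
      (hf.comp_aemeasurable hUV.fst.aemeasurable).aestronglyMeasurable
      (hUV.snd.aemeasurable.sub_const _).aestronglyMeasurable
  simp only [Function.comp_apply] at hprod
  rw [hprod, integral_sub hUV.snd.integrable (integrable_const _), integral_const,
    probReal_univ, one_smul, sub_self, mul_zero]

/-- The residual of the linear regression of `V` on `U` is uncorrelated with `U`, hence independent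
of it, which reduces the identity to one variable. -/
theorem integral_mul_sub_eq_covariance_mul_of_hasGaussianLaw
    (hUV : HasGaussianLaw (fun ω => (U ω, V ω)) P) (hU : Var[U; P] ≠ 0)
    (hf : Differentiable ℝ f) (hM : ∀ z, |f z| ≤ M) (hM' : ∀ z, |deriv f z| ≤ M') :
    ∫ ω, f (U ω) * (V ω - P[V]) ∂P = cov[U, V; P] * ∫ ω, deriv f (U ω) ∂P := by
  have := hUV.isProbabilityMeasure
  set β := cov[U, V; P] / Var[U; P]
  have hUR : HasGaussianLaw (fun ω => (U ω, V ω - β * U ω)) P := hUV.map_fun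
    ((ContinuousLinearMap.fst ℝ ℝ ℝ).prod
      (ContinuousLinearMap.snd ℝ ℝ ℝ - β • ContinuousLinearMap.fst ℝ ℝ ℝ))
  have hU2 := hUV.fst.memLp_two
  have hV2 := hUV.snd.memLp_two
  have hcov : cov[U, fun ω => V ω - β * U ω; P] = 0 := by
    rw [covariance_fun_sub_right hU2 hV2 (hU2.const_mul β), covariance_const_mul_right,
      covariance_self hUV.fst.aemeasurable, div_mul_cancel₀ _ hU, sub_self]
  have hmean : P[fun ω => V ω - β * U ω] = P[V] - β * P[U] := by
    rw [integral_sub hUV.snd.integrable (hUV.fst.integrable.const_mul β), integral_const_mul]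
  have hfU : AEStronglyMeasurable (fun ω => f (U ω)) P :=
    hf.continuous.comp_aestronglyMeasurable hUV.fst.aemeasurable.aestronglyMeasurable
  have hsplit : ∀ ω, f (U ω) * (V ω - P[V]) =
      f (U ω) * (V ω - β * U ω - P[fun ω => V ω - β * U ω]) +
        β * (f (U ω) * (U ω - P[U])) := fun ω => by rw [hmean]; ring
  simp_rw [hsplit]
  rw [integral_add, integral_mul_sub_eq_zero_of_covariance_eq_zero hUR hcov
      hf.continuous.measurable, integral_const_mul,
    integral_mul_sub_eq_variance_mul_of_hasGaussianLaw hUV.fst hf hM hM', zero_add, ← mul_assoc,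
    div_mul_cancel₀ _ hU]
  · exact (hUR.snd.integrable.sub (integrable_const _)).bdd_mul hfU (ae_of_all _ fun ω => hM _)
  · exact ((hUV.fst.integrable.sub (integrable_const _)).bdd_mul hfU
      (ae_of_all _ fun ω => hM _)).const_mul β

end SteinIdentity

section GaussianVector

variable {d : ℕ} {S : Matrix (Fin d) (Fin d) ℝ}

lemma norm_sqrtMul_sq (hS : S.PosSemidef) (v : Vec d) :
    ‖sqrtMul S v‖ ^ 2 = v.ofLp ⬝ᵥ S.mulVec v.ofLp := by
  have hsa : IsSelfAdjoint (Matrix.toEuclideanCLM (𝕜 := ℝ) (n := Fin d) (CFC.sqrt S)) :=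
    (CFC.sqrt_nonneg S).isSelfAdjoint.map _
  rw [← real_inner_self_eq_norm_sq, sqrtMul, ← ContinuousLinearMap.adjoint_inner_right,
    hsa.adjoint_eq, ← ContinuousLinearMap.comp_apply, ← ContinuousLinearMap.mul_def, ← map_mul,
    CFC.sqrt_mul_sqrt_self _ hS.nonneg, Matrix.inner_toEuclideanCLM]

lemma hasGaussianLaw_inner_prodMk (μ u w : Vec d) :
    HasGaussianLaw (fun x => (inner ℝ x u, inner ℝ x w)) (multivariateGaussian μ S) := by
  simpa only [ContinuousLinearMap.prod_apply, innerSL_apply_apply, real_inner_comm _ u,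
    real_inner_comm _ w, id] using IsGaussian.hasGaussianLaw_id.map_fun
      (P := multivariateGaussian μ S) ((innerSL ℝ u).prod (innerSL ℝ w))

lemma integral_inner_multivariateGaussian (μ v : Vec d) :
    ∫ x, inner ℝ x v ∂(multivariateGaussian μ S) = inner ℝ μ v := by
  simp_rw [real_inner_comm v]
  rw [integral_inner (f := fun x => x) IsGaussian.integrable_id, integral_id_multivariateGaussian]

lemma covariance_inner_multivariateGaussian (hS : S.PosSemidef) (μ u w : Vec d) :
    cov[fun x => inner ℝ x u, fun x => inner ℝ x w; multivariateGaussian μ S] =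
      u.ofLp ⬝ᵥ S.mulVec w.ofLp := by
  simp_rw [real_inner_comm u, real_inner_comm w]
  rw [← covarianceBilin_apply_eq_cov IsGaussian.memLp_two_id,
    covarianceBilin_multivariateGaussian hS]

lemma variance_inner_multivariateGaussian (hS : S.PosSemidef) (μ v : Vec d) :
    Var[fun x => inner ℝ x v; multivariateGaussian μ S] = ‖sqrtMul S v‖ ^ 2 := by
  rw [← covariance_self (by fun_prop), covariance_inner_multivariateGaussian hS,
    norm_sqrtMul_sq hS]

lemma map_inner_sub_multivariateGaussian (hS : S.PosSemidef) (μ v : Vec d) :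
    (multivariateGaussian μ S).map (fun x => inner ℝ (x - μ) v) =
      gaussianReal 0 (‖sqrtMul S v‖ ^ 2).toNNReal := by
  have hcomp : (fun x => inner ℝ (x - μ) v) =
      (fun z => z - inner ℝ μ v) ∘ fun x : Vec d => inner ℝ x v := by
    ext x
    rw [inner_sub_left, Function.comp_apply]
  rw [hcomp, ← Measure.map_map (by fun_prop) (by fun_prop),
    (hasGaussianLaw_inner_prodMk μ v v).fst.map_eq_gaussianReal,
    integral_inner_multivariateGaussian, variance_inner_multivariateGaussian hS,
    gaussianReal_map_sub_const, sub_self]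

end GaussianVector

section GaussianScore

lemma hasGradientAt_half_inner_map {E : Type*} [NormedAddCommGroup E] [InnerProductSpace ℝ E]
    [CompleteSpace E] {A : E →L[ℝ] E} (hA : IsSelfAdjoint A) (μ x : E) :
    HasGradientAt (fun z => inner ℝ (z - μ) (A (z - μ)) / 2) (A (x - μ)) x := by
  have hsub : HasFDerivAt (fun z : E => z - μ) (ContinuousLinearMap.id ℝ E) x :=
    (hasFDerivAt_id x).sub_const μ
  have hderiv := (hsub.inner ℝ (A.hasFDerivAt.comp x hsub)).mul_const (1 / 2 : ℝ)
  simp only [Function.comp_apply, mul_one_div] at hderiv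
  refine hasGradientAt_iff_hasFDerivAt.2 (hderiv.congr_fderiv ?_)
  ext w
  have hsymm : inner ℝ (x - μ) (A w) = inner ℝ (A (x - μ)) w := by
    rw [← ContinuousLinearMap.adjoint_inner_left, hA.adjoint_eq]
  simp only [smul_apply, ContinuousLinearMap.comp_apply,
    ContinuousLinearMap.prod_apply, ContinuousLinearMap.id_apply, fderivInnerCLM_apply, hsymm,
    real_inner_comm (A (x - μ)) w, InnerProductSpace.toDual_apply_apply, smul_eq_mul]
  ring

variable {d : ℕ} {S : Matrix (Fin d) (Fin d) ℝ}

lemma score_gaussianDensity (hS : S.PosDef) (μ x : Vec d) :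
    score (gaussianDensity μ S) x = Matrix.toEuclideanCLM (𝕜 := ℝ) S⁻¹ (x - μ) := by
  have hc : (Real.sqrt ((2 * Real.pi) ^ d * S.det))⁻¹ ≠ 0 := by
    have := hS.det_pos
    positivity
  have hlog : (fun z => Real.log (gaussianDensity μ S z)) = fun z =>
      Real.log (Real.sqrt ((2 * Real.pi) ^ d * S.det))⁻¹ -
        inner ℝ (z - μ) (Matrix.toEuclideanCLM (𝕜 := ℝ) S⁻¹ (z - μ)) / 2 := by
    ext z
    rw [gaussianDensity, Real.log_mul hc (Real.exp_pos _).ne', Real.log_exp, neg_div,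
      ← sub_eq_add_neg]
  have hsa : IsSelfAdjoint S⁻¹ := hS.inv.isHermitian
  have hgrad := hasGradientAt_half_inner_map (hsa.map (Matrix.toEuclideanCLM (𝕜 := ℝ))) μ x
  rw [hasGradientAt_iff_hasFDerivAt] at hgrad
  rw [score, hlog, HasGradientAt.gradient (f' := -Matrix.toEuclideanCLM (𝕜 := ℝ) S⁻¹ (x - μ)),
    neg_neg]
  rw [hasGradientAt_iff_hasFDerivAt, map_neg]
  exact hgrad.const_sub _

/-- `Σ⁻¹ e_j`, along which the `j`-th coordinate of the score of `N(μ, Σ)` is read off `x - μ`. -/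
noncomputable def scoreDirection (S : Matrix (Fin d) (Fin d) ℝ) (j : Fin d) : Vec d :=
  Matrix.toEuclideanCLM (𝕜 := ℝ) S⁻¹ (EuclideanSpace.single j 1)

lemma score_gaussianDensity_apply (hS : S.PosDef) (μ x : Vec d) (j : Fin d) :
    score (gaussianDensity μ S) x j = inner ℝ (x - μ) (scoreDirection S j) := by
  have hsa : IsSelfAdjoint S⁻¹ := hS.inv.isHermitian
  rw [score_gaussianDensity hS, scoreDirection, ← ContinuousLinearMap.adjoint_inner_left,
    (hsa.map (Matrix.toEuclideanCLM (𝕜 := ℝ))).adjoint_eq, EuclideanSpace.inner_single_right,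
    one_mul, RCLike.conj_to_real]

lemma mulVec_scoreDirection (hS : S.PosDef) (j : Fin d) :
    S.mulVec (scoreDirection S j).ofLp = Pi.single j 1 := by
  rw [scoreDirection, Matrix.ofLp_toEuclideanCLM, Matrix.mulVec_mulVec,
    Matrix.mul_nonsing_inv _ hS.det_pos.ne'.isUnit, Matrix.one_mulVec]
  rfl

lemma norm_sqrtMul_scoreDirection_sq_le (hS : S.PosDef) {cmin : ℝ} (hc : 0 < cmin)
    (hlow : ∀ v : Fin d → ℝ, cmin * (v ⬝ᵥ v) ≤ v ⬝ᵥ S.mulVec v) (j : Fin d) :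
    ‖sqrtMul S (scoreDirection S j)‖ ^ 2 ≤ cmin⁻¹ := by
  set w := (scoreDirection S j).ofLp
  have hform : w ⬝ᵥ S.mulVec w = w j := by
    rw [mulVec_scoreDirection hS, dotProduct_single_one]
  have hsq : cmin * w j ^ 2 ≤ w j := by
    calc cmin * w j ^ 2 ≤ cmin * (w ⬝ᵥ w) := by
          rw [sq]
          exact mul_le_mul_of_nonneg_left (Finset.single_le_sum
            (f := fun i => w i * w i) (fun i _ => mul_self_nonneg _) (Finset.mem_univ j)) hc.le
      _ ≤ w j := (hlow w).trans_eq hform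
  rw [norm_sqrtMul_sq hS.posSemidef, hform, ← one_div, le_div_iff₀ hc]
  nlinarith

theorem integral_mul_score_gaussianDensity {f : ℝ → ℝ} {M M' : ℝ} (hf : Differentiable ℝ f)
    (hM : ∀ z, |f z| ≤ M) (hM' : ∀ z, |deriv f z| ≤ M') (hS : S.PosDef) (μ : Vec d) {θ : Vec d}
    (hθ : sqrtMul S θ ≠ 0) (j : Fin d) :
    ∫ x, f (inner ℝ x θ) * score (gaussianDensity μ S) x j ∂(multivariateGaussian μ S) =
      θ j * ∫ x, deriv f (inner ℝ x θ) ∂(multivariateGaussian μ S) := by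
  have hvar : Var[fun x => inner ℝ x θ; multivariateGaussian μ S] ≠ 0 := by
    rw [variance_inner_multivariateGaussian hS.posSemidef]
    exact pow_ne_zero 2 (norm_ne_zero_iff.2 hθ)
  have h := integral_mul_sub_eq_covariance_mul_of_hasGaussianLaw
    (hasGaussianLaw_inner_prodMk μ θ (scoreDirection S j)) hvar hf hM hM'
  simp_rw [score_gaussianDensity_apply hS, inner_sub_left]
  rwa [integral_inner_multivariateGaussian, covariance_inner_multivariateGaussian hS.posSemidef,
    mulVec_scoreDirection hS, dotProduct_single_one] at h

end GaussianScore

section GaussianTail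

lemma gaussianReal_lt_abs_le (s : NNReal) (W : ℝ) :
    (gaussianReal 0 s).real {z | W < |z|} ≤ 2 * Real.exp (s / 2 - W) := by
  have hsub : {z : ℝ | W < |z|} ⊆ {z | W ≤ z} ∪ {z | z ≤ -W} := fun z hz => by
    rcases lt_abs.1 (show W < |z| from hz) with h | h
    · exact Or.inl h.le
    · exact Or.inr (by linarith : z ≤ -W)
  have hupper := measure_ge_le_exp_mul_mgf (μ := gaussianReal 0 s) (X := fun z => z) W
    zero_le_one (integrable_exp_mul_gaussianReal 1)
  have hlower := measure_le_le_exp_mul_mgf (μ := gaussianReal 0 s) (X := fun z => z) (-W)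
    (by norm_num : (-1 : ℝ) ≤ 0) (integrable_exp_mul_gaussianReal (-1))
  rw [mgf_fun_id_gaussianReal, ← Real.exp_add] at hupper hlower
  calc (gaussianReal 0 s).real {z | W < |z|}
      ≤ (gaussianReal 0 s).real {z | W ≤ z} + (gaussianReal 0 s).real {z | z ≤ -W} :=
        (measureReal_mono hsub).trans (measureReal_union_le _ _)
    _ ≤ 2 * Real.exp (s / 2 - W) := by
        rw [two_mul]
        refine add_le_add (hupper.trans_eq ?_) (hlower.trans_eq ?_) <;> ring_nf

variable {d : ℕ} {S : Matrix (Fin d) (Fin d) ℝ}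

lemma memLp_inner_sub_multivariateGaussian (μ v : Vec d) :
    MemLp (fun x => inner ℝ (x - μ) v) 2 (multivariateGaussian μ S) := by
  simp_rw [inner_sub_left]
  exact (hasGaussianLaw_inner_prodMk μ v v).fst.memLp_two.sub (memLp_const _)

lemma integral_inner_sub_sq_multivariateGaussian (hS : S.PosSemidef) (μ v : Vec d) :
    ∫ x, inner ℝ (x - μ) v ^ 2 ∂(multivariateGaussian μ S) = ‖sqrtMul S v‖ ^ 2 := by
  rw [← variance_inner_multivariateGaussian hS μ v, variance_eq_integral (by fun_prop),
    integral_inner_multivariateGaussian]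
  simp_rw [inner_sub_left]

lemma lintegral_inner_sub_sq_multivariateGaussian (hS : S.PosSemidef) (μ v : Vec d) :
    ∫⁻ x, ENNReal.ofReal (inner ℝ (x - μ) v ^ 2) ∂(multivariateGaussian μ S) =
      ENNReal.ofReal (‖sqrtMul S v‖ ^ 2) := by
  rw [← ofReal_integral_eq_lintegral_ofReal
    (memLp_inner_sub_multivariateGaussian μ v).integrable_sq (ae_of_all _ fun x => sq_nonneg _),
    integral_inner_sub_sq_multivariateGaussian hS]

lemma lintegral_abs_inner_sub_multivariateGaussian_le (hS : S.PosSemidef) (μ v : Vec d) :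
    ∫⁻ x, ENNReal.ofReal |inner ℝ (x - μ) v| ∂(multivariateGaussian μ S) ≤
      ENNReal.ofReal ‖sqrtMul S v‖ := by
  have hL2 : MemLp (fun x => |inner ℝ (x - μ) v|) 2 (multivariateGaussian μ S) :=
    (memLp_inner_sub_multivariateGaussian μ v).abs
  rw [← ofReal_integral_eq_lintegral_ofReal (hL2.integrable one_le_two)
    (ae_of_all _ fun x => abs_nonneg _)]
  refine ENNReal.ofReal_le_ofReal (le_of_sq_le_sq ?_ (norm_nonneg _))
  have hvar := variance_nonneg (fun x => |inner ℝ (x - μ) v|) (multivariateGaussian μ S)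
  rw [variance_eq_sub hL2] at hvar
  simp only [Pi.pow_apply, sq_abs, integral_inner_sub_sq_multivariateGaussian hS] at hvar
  linarith

lemma multivariateGaussian_lt_abs_inner_sub_le (hS : S.PosSemidef) (μ : Vec d) {v : Vec d}
    (hv : ‖sqrtMul S v‖ ≤ 1) (W : ℝ) :
    multivariateGaussian μ S {x | W < |inner ℝ (x - μ) v|} ≤
      ENNReal.ofReal (4 * Real.exp (-W)) := by
  have hsq : ‖sqrtMul S v‖ ^ 2 ≤ 1 := pow_le_one₀ (norm_nonneg _) hv
  have hmap : multivariateGaussian μ S {x | W < |inner ℝ (x - μ) v|} =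
      gaussianReal 0 (‖sqrtMul S v‖ ^ 2).toNNReal {z | W < |z|} := by
    rw [← map_inner_sub_multivariateGaussian hS μ,
      Measure.map_apply (by fun_prop) (measurableSet_lt measurable_const (by fun_prop))]
    rfl
  rw [hmap, ← ofReal_measureReal]
  refine ENNReal.ofReal_le_ofReal ((gaussianReal_lt_abs_le _ W).trans ?_)
  have hexp : Real.exp (1 / 2 : ℝ) ≤ 2 := by
    have h := Real.exp_bound_div_one_sub_of_interval (x := 1 / 2) (by norm_num) (by norm_num)
    norm_num at h ⊢
    exact h
  calc 2 * Real.exp ((‖sqrtMul S v‖ ^ 2).toNNReal / 2 - W)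
      ≤ 2 * (Real.exp (1 / 2) * Real.exp (-W)) := by
        rw [← Real.exp_add, Real.coe_toNNReal _ (sq_nonneg _)]
        gcongr
        linarith
    _ ≤ 4 * Real.exp (-W) := by nlinarith [Real.exp_pos (-W)]

end GaussianTail

section Clip

/-- Truncation of a real number to `[-τ, τ]`; `truncate` does this to each coordinate. -/
noncomputable def clip (τ y : ℝ) : ℝ := Real.sign y * min |y| τ

variable {τ : ℝ}

lemma measurable_clip (τ : ℝ) : Measurable (clip τ) := by
  have hsign : Measurable Real.sign := Measurable.ite measurableSet_Iio measurable_const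
    (Measurable.ite measurableSet_Ioi measurable_const measurable_const)
  exact hsign.mul (by fun_prop)

lemma abs_clip (hτ : 0 ≤ τ) (y : ℝ) : |clip τ y| = min |y| τ := by
  rw [clip, abs_mul, abs_of_nonneg (le_min (abs_nonneg y) hτ)]
  rcases eq_or_ne y 0 with rfl | hy
  · simp [hτ]
  · rcases Real.sign_apply_eq_of_ne_zero y hy with h | h <;> simp [h]

lemma abs_clip_sub_self_le (hτ : 0 < τ) (y : ℝ) : |clip τ y - y| ≤ y ^ 2 / τ := by
  have hexact : |clip τ y - y| = |y| - min |y| τ := by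
    have hle := min_le_left |y| τ
    rcases lt_trichotomy y 0 with hy | rfl | hy
    · rw [clip, Real.sign_of_neg hy, abs_of_neg hy] at *
      rw [abs_of_nonneg (by linarith)]
      ring
    · simp [clip, hτ.le]
    · rw [clip, Real.sign_of_pos hy, abs_of_pos hy] at *
      rw [abs_of_nonpos (by linarith)]
      ring
  rw [hexact, le_div_iff₀ hτ, ← sq_abs]
  rcases le_total |y| τ with h | h
  · rw [min_eq_left h]
    nlinarith [sq_nonneg |y|]
  · rw [min_eq_right h]
    nlinarith [abs_nonneg y]

variable {Ω : Type*} {mΩ : MeasurableSpace Ω} {P : Measure Ω} {m : MeasurableSpace Ω}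
  {ξ : Ω → ℝ} {b C : ℝ}

lemma memLp_clip (hτ : 0 ≤ τ) (hξ : MemLp ξ 2 P) : MemLp (fun ω => clip τ (ξ ω)) 2 P :=
  hξ.mono ((measurable_clip τ).comp_aemeasurable hξ.aemeasurable).aestronglyMeasurable
    (ae_of_all _ fun ω => by
      rw [Real.norm_eq_abs, abs_clip hτ, Real.norm_eq_abs]
      exact min_le_left _ _)

lemma memLp_clip_sub_condExp (hτ : 0 ≤ τ) (hξ : MemLp ξ 2 P) :
    MemLp (fun ω => clip τ (ξ ω) - (P[fun ω' => clip τ (ξ ω') | m]) ω) 2 P :=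
  (memLp_clip hτ hξ).sub ((memLp_clip hτ hξ).condExp one_le_two)

variable [IsProbabilityMeasure P]

lemma integral_sq_sub_condExp_le (hm : m ≤ mΩ) (hξ : MemLp ξ 2 P) :
    ∫ ω, (ξ ω - P[ξ | m] ω) ^ 2 ∂P ≤ ∫ ω, ξ ω ^ 2 ∂P := by
  have h := integral_mono_ae integrable_condVar integrable_condExp (condVar_ae_le_condExp_sq hm hξ)
  rwa [condVar, integral_condExp hm, integral_condExp hm] at h

lemma integral_sq_clip_sub_condExp_le (hm : m ≤ mΩ) (hτ : 0 ≤ τ) (hξ : MemLp ξ 2 P)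
    (hC : ∀ᵐ ω ∂P, (P[fun ω' => ξ ω' ^ 2 | m]) ω ≤ C) :
    ∫ ω, (clip τ (ξ ω) - (P[fun ω' => clip τ (ξ ω') | m]) ω) ^ 2 ∂P ≤ C := by
  calc ∫ ω, (clip τ (ξ ω) - (P[fun ω' => clip τ (ξ ω') | m]) ω) ^ 2 ∂P
      ≤ ∫ ω, clip τ (ξ ω) ^ 2 ∂P := integral_sq_sub_condExp_le hm (memLp_clip hτ hξ)
    _ ≤ ∫ ω, ξ ω ^ 2 ∂P :=
        integral_mono (memLp_clip hτ hξ).integrable_sq hξ.integrable_sq fun ω =>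
          sq_le_sq.2 ((abs_clip hτ _).trans_le (min_le_left _ _))
    _ = ∫ ω, (P[fun ω' => ξ ω' ^ 2 | m]) ω ∂P := (integral_condExp hm).symm
    _ ≤ C := (integral_mono_ae integrable_condExp (integrable_const C) hC).trans_eq (by simp)

lemma abs_condExp_clip_sub_le (hτ : 0 < τ) (hξ : MemLp ξ 2 P)
    (hb : P[ξ | m] =ᵐ[P] fun _ => b) (hC : ∀ᵐ ω ∂P, (P[fun ω' => ξ ω' ^ 2 | m]) ω ≤ C) :
    ∀ᵐ ω ∂P, |(P[fun ω' => clip τ (ξ ω') | m]) ω - b| ≤ C / τ := by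
  have hclip := (memLp_clip hτ.le hξ).integrable one_le_two
  have hint := hξ.integrable one_le_two
  have hsq := hξ.integrable_sq.div_const τ
  filter_upwards [condExp_mono (m := m) (hclip.sub hint) hsq
      (ae_of_all _ fun ω => (abs_le.1 (abs_clip_sub_self_le hτ (ξ ω))).2),
    condExp_mono (m := m) hsq.neg (hclip.sub hint)
      (ae_of_all _ fun ω => (abs_le.1 (abs_clip_sub_self_le hτ (ξ ω))).1),
    condExp_sub hclip hint m, condExp_neg (fun ω => ξ ω ^ 2 / τ) m, hb, hC,
    condExp_smul (μ := P) (τ⁻¹) (fun ω => ξ ω ^ 2) m] with ω hupper hlower hsub hneg hb hC hdiv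
  have hdiv' : (P[fun ω' => ξ ω' ^ 2 / τ | m]) ω ≤ C / τ := by
    have hfun : (fun ω' => ξ ω' ^ 2 / τ) = τ⁻¹ • fun ω' => ξ ω' ^ 2 := by
      ext ω'
      rw [Pi.smul_apply, smul_eq_mul, div_eq_inv_mul]
    rw [hfun, hdiv, Pi.smul_apply, smul_eq_mul, div_eq_inv_mul]
    gcongr
  rw [hneg, Pi.neg_apply] at hlower
  rw [hsub, Pi.sub_apply, hb] at hlower hupper
  rw [abs_le]
  constructor <;> linarith

section Sum

variable {n : ℕ} {ξ : ℕ → Ω → ℝ} {F : ℕ → MeasurableSpace Ω}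

lemma integral_sq_sum_clip_sub_condExp_le (hF : ∀ i < n, F i ≤ mΩ) (hτ : 0 ≤ τ)
    (hmono : ∀ i < n, ∀ j < i, F j ≤ F i) (hmeas : ∀ i < n, ∀ j < i, Measurable[F i] (ξ j))
    (hξ : ∀ i < n, MemLp (ξ i) 2 P)
    (hC : ∀ i < n, ∀ᵐ ω ∂P, (P[fun ω' => ξ i ω' ^ 2 | F i]) ω ≤ C) :
    ∫ ω, (∑ i ∈ Finset.range n,
      (clip τ (ξ i ω) - (P[fun ω' => clip τ (ξ i ω') | F i]) ω)) ^ 2 ∂P ≤ n * C := by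
  rw [integral_sq_sum_of_condExp_eq_zero hF (fun i hi j hj => ?_)
    (fun i hi => memLp_clip_sub_condExp hτ (hξ i hi)) fun i hi => ?_]
  · refine (Finset.sum_le_card_nsmul _ _ C fun i hi => ?_).trans_eq (by simp)
    have hi := Finset.mem_range.1 hi
    exact integral_sq_clip_sub_condExp_le (hF i hi) hτ (hξ i hi) (hC i hi)
  · exact ((measurable_clip τ).comp (hmeas i hi j hj)).sub
      (stronglyMeasurable_condExp.measurable.mono (hmono i hi j hj) le_rfl)
  · filter_upwards [condExp_sub ((memLp_clip hτ (hξ i hi)).integrable one_le_two)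
      (integrable_condExp (m := F i) (f := fun ω => clip τ (ξ i ω))) (F i)] with ω hω
    refine hω.trans ?_
    rw [Pi.sub_apply, condExp_of_stronglyMeasurable (hF i hi) stronglyMeasurable_condExp
      integrable_condExp, sub_self, Pi.zero_apply]

lemma abs_sum_condExp_clip_sub_le (hτ : 0 < τ) (hξ : ∀ i < n, MemLp (ξ i) 2 P)
    (hb : ∀ i < n, P[ξ i | F i] =ᵐ[P] fun _ => b)
    (hC : ∀ i < n, ∀ᵐ ω ∂P, (P[fun ω' => ξ i ω' ^ 2 | F i]) ω ≤ C) :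
    ∀ᵐ ω ∂P, |∑ i ∈ Finset.range n, ((P[fun ω' => clip τ (ξ i ω') | F i]) ω - b)| ≤
      n * (C / τ) := by
  have hall : ∀ᵐ ω ∂P, ∀ i ∈ Finset.range n,
      |(P[fun ω' => clip τ (ξ i ω') | F i]) ω - b| ≤ C / τ :=
    (Filter.eventually_all_finset _).2 fun i hi =>
      have hi := Finset.mem_range.1 hi
      abs_condExp_clip_sub_le hτ (hξ i hi) (hb i hi) (hC i hi)
  filter_upwards [hall] with ω hω
  exact (Finset.abs_sum_le_sum_abs _ _).trans
    ((Finset.sum_le_card_nsmul _ _ (C / τ) hω).trans_eq (by simp))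

/-- The fluctuations of the clipped variables add up in mean square, their biases in absolute
value. -/
theorem integral_sq_sum_clip_sub_le (hF : ∀ i < n, F i ≤ mΩ) (hτ : 0 < τ)
    (hmono : ∀ i < n, ∀ j < i, F j ≤ F i) (hmeas : ∀ i < n, ∀ j < i, Measurable[F i] (ξ j))
    (hξ : ∀ i < n, MemLp (ξ i) 2 P) (hb : ∀ i < n, P[ξ i | F i] =ᵐ[P] fun _ => b)
    (hC : ∀ i < n, ∀ᵐ ω ∂P, (P[fun ω' => ξ i ω' ^ 2 | F i]) ω ≤ C) :
    ∫ ω, (∑ i ∈ Finset.range n, (clip τ (ξ i ω) - b)) ^ 2 ∂P ≤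
      2 * (n * C) + 2 * (n * (C / τ)) ^ 2 := by
  set D : Ω → ℝ := fun ω =>
    ∑ i ∈ Finset.range n, (clip τ (ξ i ω) - (P[fun ω' => clip τ (ξ i ω') | F i]) ω) with hD
  have hDsq : Integrable (fun ω => D ω ^ 2) P := (memLp_finsetSum _ fun i hi =>
    memLp_clip_sub_condExp hτ.le (hξ i (Finset.mem_range.1 hi))).integrable_sq
  calc ∫ ω, (∑ i ∈ Finset.range n, (clip τ (ξ i ω) - b)) ^ 2 ∂P
      ≤ ∫ ω, (2 * D ω ^ 2 + 2 * (n * (C / τ)) ^ 2) ∂P := by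
        refine integral_mono_of_nonneg (ae_of_all _ fun ω => sq_nonneg _)
          ((hDsq.const_mul 2).add (integrable_const _)) ?_
        filter_upwards [abs_sum_condExp_clip_sub_le hτ hξ hb hC] with ω hω
        set B := ∑ i ∈ Finset.range n, ((P[fun ω' => clip τ (ξ i ω') | F i]) ω - b)
        have hsplit : ∑ i ∈ Finset.range n, (clip τ (ξ i ω) - b) = D ω + B := by
          rw [hD, ← Finset.sum_add_distrib]
          exact Finset.sum_congr rfl fun i _ => (sub_add_sub_cancel _ _ _).symm
        have hsq := sq_le_sq' (abs_le.1 hω).1 (abs_le.1 hω).2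
        simp only [hsplit]
        nlinarith [sq_nonneg (D ω - B)]
    _ ≤ 2 * (n * C) + 2 * (n * (C / τ)) ^ 2 := by
        rw [integral_add (hDsq.const_mul 2) (integrable_const _), integral_const_mul,
          integral_const, probReal_univ, one_smul]
        gcongr
        exact integral_sq_sum_clip_sub_condExp_le hF hτ.le hmono hmeas hξ hC

end Sum

end Clip

section StreamResponse

variable {Ω E : Type*} {mΩ : MeasurableSpace Ω} [MeasurableSpace E] {P : Measure Ω}
  {ν : Measure E} {σ : ℝ} {F : ℕ → MeasurableSpace Ω} {N : ℕ} {X : ℕ → Ω → E} {η : ℕ → Ω → ℝ}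
  {g s : E → ℝ} {L V τ : ℝ} {i : ℕ}

lemma measurable_comp_sup_comap (m : MeasurableSpace Ω) {Y : Ω → E} (hg : Measurable g) :
    Measurable[m ⊔ MeasurableSpace.comap Y inferInstance] fun ω => g (Y ω) :=
  hg.comp ((comap_measurable Y).mono le_sup_right le_rfl)

namespace IsSampling

lemma memLp_comp_design (hs : IsSampling P ν σ F N X η) (hi : i < N) (hsL2 : MemLp s 2 ν) :
    MemLp (fun ω => s (X i ω)) 2 P :=
  (hs.law i hi ▸ hsL2).comp_of_map (hs.measurable_design hi).aemeasurable

lemma memLp_bounded_mul (hs : IsSampling P ν σ F N X η) (hi : i < N) (hg : Measurable g)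
    (hL : ∀ x, |g x| ≤ L) (hsL2 : MemLp s 2 ν) :
    MemLp (fun ω => g (X i ω) * s (X i ω)) 2 P :=
  (hs.memLp_comp_design hi hsL2).of_le_mul (c := L)
    ((hg.comp (hs.measurable_design hi)).aestronglyMeasurable.mul
      (hs.memLp_comp_design hi hsL2).1) (ae_of_all _ fun ω => by
    rw [norm_mul]
    exact mul_le_mul_of_nonneg_right (hL _) (norm_nonneg _))

variable [IsProbabilityMeasure P]

lemma condExp_comp_design (hs : IsSampling P ν σ F N X η) (hi : i < N) (hg : Measurable g) :
    P[fun ω => g (X i ω) | F i] =ᵐ[P] fun _ => ∫ x, g x ∂ν := by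
  have hgX : Measurable[MeasurableSpace.comap (X i) inferInstance] fun ω => g (X i ω) :=
    hg.comp (comap_measurable (X i))
  rw [← hs.law i hi, integral_map (hs.measurable_design hi).aemeasurable
    hg.aestronglyMeasurable]
  exact condExp_indep_eq (hs.measurable_design hi).comap_le (hs.le i hi.le) hgX.stronglyMeasurable
    (hs.indep i hi)

lemma lintegral_sq_noise_mul_le (hs : IsSampling P ν σ F N X η) (hi : i < N)
    (hsm : Measurable s) :
    ∫⁻ ω, ENNReal.ofReal ((η i ω * s (X i ω)) ^ 2) ∂P ≤
      ENNReal.ofReal (σ ^ 2) * ∫⁻ ω, ENNReal.ofReal (s (X i ω) ^ 2) ∂P := by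
  simp_rw [mul_pow, ENNReal.ofReal_mul (sq_nonneg (η i _))]
  exact lintegral_sq_mul_le_of_condExp_sq_le
    ((hs.sup_comap_le_succ hi).trans (hs.le _ hi)) (sq_nonneg σ) (hs.measurable_noise hi)
    (hs.noise_memLp i hi) (hs.noise_var i hi)
    (measurable_comp_sup_comap (F i) (hsm.pow_const 2)).ennreal_ofReal

lemma memLp_noise_mul (hs : IsSampling P ν σ F N X η) (hi : i < N) (hsm : Measurable s)
    (hsL2 : MemLp s 2 ν) : MemLp (fun ω => η i ω * s (X i ω)) 2 P := by
  have hmeas : Measurable fun ω => η i ω * s (X i ω) :=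
    (hs.measurable_noise hi).mul (hsm.comp (hs.measurable_design hi))
  refine (memLp_two_iff_integrable_sq hmeas.aestronglyMeasurable).2
    ⟨(hmeas.pow_const 2).aestronglyMeasurable,
      (hasFiniteIntegral_iff_ofReal (ae_of_all _ fun ω => sq_nonneg _)).2
        ((hs.lintegral_sq_noise_mul_le hi hsm).trans_lt
          (ENNReal.mul_lt_top ENNReal.ofReal_lt_top ?_))⟩
  exact (hasFiniteIntegral_iff_ofReal (ae_of_all _ fun ω => sq_nonneg _)).1
    (hs.memLp_comp_design hi hsL2).integrable_sq.2

lemma memLp_response_mul (hs : IsSampling P ν σ F N X η) (hi : i < N) (hg : Measurable g)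
    (hL : ∀ x, |g x| ≤ L) (hsm : Measurable s) (hsL2 : MemLp s 2 ν) :
    MemLp (fun ω => (g (X i ω) + η i ω) * s (X i ω)) 2 P := by
  simp_rw [add_mul]
  exact (hs.memLp_bounded_mul hi hg hL hsL2).add (hs.memLp_noise_mul hi hsm hsL2)

lemma condExp_noise_mul (hs : IsSampling P ν σ F N X η) (hi : i < N) (hsm : Measurable s)
    (hsL2 : MemLp s 2 ν) : P[fun ω => η i ω * s (X i ω) | F i] =ᵐ[P] 0 := by
  have hle := (hs.sup_comap_le_succ hi).trans (hs.le _ hi)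
  have hinner : P[fun ω => η i ω * s (X i ω) |
      F i ⊔ MeasurableSpace.comap (X i) inferInstance] =ᵐ[P] 0 := by
    filter_upwards [condExp_mul_of_stronglyMeasurable_right
      (measurable_comp_sup_comap (F i) hsm).stronglyMeasurable
      ((hs.memLp_noise_mul hi hsm hsL2).integrable one_le_two)
      ((hs.noise_memLp i hi).integrable one_le_two), hs.noise_mean i hi] with ω hpull hzero
    exact hpull.trans (by rw [Pi.mul_apply, hzero, Pi.zero_apply, zero_mul])
  exact (condExp_condExp_of_le le_sup_left hle).symm.trans
    ((condExp_congr_ae hinner).trans (by rw [condExp_zero]))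

lemma condExp_response_mul (hs : IsSampling P ν σ F N X η) (hi : i < N) (hg : Measurable g)
    (hL : ∀ x, |g x| ≤ L) (hsm : Measurable s) (hsL2 : MemLp s 2 ν) :
    P[fun ω => (g (X i ω) + η i ω) * s (X i ω) | F i] =ᵐ[P] fun _ => ∫ x, g x * s x ∂ν := by
  have hsum : (fun ω => (g (X i ω) + η i ω) * s (X i ω)) =
      (fun ω => g (X i ω) * s (X i ω)) + fun ω => η i ω * s (X i ω) :=
    funext fun ω => add_mul _ _ _
  rw [hsum]
  filter_upwards [condExp_add ((hs.memLp_bounded_mul hi hg hL hsL2).integrable one_le_two)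
    ((hs.memLp_noise_mul hi hsm hsL2).integrable one_le_two) (F i),
    hs.condExp_comp_design hi (hg.mul hsm), hs.condExp_noise_mul hi hsm hsL2] with ω hadd h₁ h₂
  rw [hadd, Pi.add_apply, h₂, Pi.zero_apply, add_zero]
  exact h₁

lemma condExp_noise_mul_sq_le (hs : IsSampling P ν σ F N X η) (hi : i < N) (hsm : Measurable s)
    (hsL2 : MemLp s 2 ν) :
    ∀ᵐ ω ∂P, (P[fun ω' => (η i ω' * s (X i ω')) ^ 2 | F i]) ω ≤ σ ^ 2 * ∫ x, s x ^ 2 ∂ν := by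
  have hle := (hs.sup_comap_le_succ hi).trans (hs.le _ hi)
  have hint := (hs.memLp_noise_mul hi hsm hsL2).integrable_sq
  have hsXint := (hs.memLp_comp_design hi hsL2).integrable_sq
  simp_rw [mul_pow] at hint ⊢
  have hinner : P[fun ω => η i ω ^ 2 * s (X i ω) ^ 2 |
      F i ⊔ MeasurableSpace.comap (X i) inferInstance] ≤ᵐ[P] fun ω => σ ^ 2 * s (X i ω) ^ 2 := by
    filter_upwards [condExp_mul_of_stronglyMeasurable_right
      (measurable_comp_sup_comap (F i) (hsm.pow_const 2)).stronglyMeasurable hint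
      (hs.noise_memLp i hi).integrable_sq, hs.noise_var i hi] with ω hpull hvar
    exact hpull.trans_le (mul_le_mul_of_nonneg_right hvar (sq_nonneg _))
  filter_upwards [condExp_condExp_of_le (μ := P) (f := fun ω => η i ω ^ 2 * s (X i ω) ^ 2)
      (m₁ := F i) le_sup_left hle,
    condExp_mono (m := F i) integrable_condExp (hsXint.const_mul (σ ^ 2)) hinner,
    hs.condExp_comp_design hi ((hsm.pow_const 2).const_mul (σ ^ 2))] with ω htower hmono hdesign
  rw [← htower]
  exact hmono.trans_eq (hdesign.trans (integral_const_mul _ _))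

lemma condExp_response_mul_sq_le (hs : IsSampling P ν σ F N X η) (hi : i < N)
    (hg : Measurable g) (hL : ∀ x, |g x| ≤ L) (hsm : Measurable s) (hsL2 : MemLp s 2 ν) :
    ∀ᵐ ω ∂P, (P[fun ω' => ((g (X i ω') + η i ω') * s (X i ω')) ^ 2 | F i]) ω ≤
      2 * (L ^ 2 + σ ^ 2) * ∫ x, s x ^ 2 ∂ν := by
  have hdesign := (hs.memLp_comp_design hi hsL2).integrable_sq.const_mul (2 * L ^ 2)
  have hnoise := (hs.memLp_noise_mul hi hsm hsL2).integrable_sq.const_mul 2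
  have hpoint : ∀ ω, ((g (X i ω) + η i ω) * s (X i ω)) ^ 2 ≤
      2 * L ^ 2 * s (X i ω) ^ 2 + 2 * (η i ω * s (X i ω)) ^ 2 := fun ω => by
    have hgL : g (X i ω) ^ 2 ≤ L ^ 2 := sq_le_sq' (abs_le.1 (hL _)).1 (abs_le.1 (hL _)).2
    nlinarith [mul_le_mul_of_nonneg_right hgL (sq_nonneg (s (X i ω))),
      sq_nonneg (g (X i ω) * s (X i ω) - η i ω * s (X i ω))]
  filter_upwards [condExp_mono (m := F i) (hs.memLp_response_mul hi hg hL hsm hsL2).integrable_sq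
      (hdesign.add hnoise) (ae_of_all _ hpoint),
    condExp_add hdesign hnoise (F i),
    hs.condExp_comp_design hi ((hsm.pow_const 2).const_mul (2 * L ^ 2)),
    condExp_smul (μ := P) (2 : ℝ) (fun ω => (η i ω * s (X i ω)) ^ 2) (F i),
    hs.condExp_noise_mul_sq_le hi hsm hsL2] with ω hmono hadd h₁ hsmul h₂
  have hsmul' : P[fun ω => 2 * (η i ω * s (X i ω)) ^ 2 | F i] ω =
    2 * P[fun ω => (η i ω * s (X i ω)) ^ 2 | F i] ω := hsmul
  refine hmono.trans ?_
  rw [hadd, Pi.add_apply, hsmul', h₁, integral_const_mul]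
  linarith

/-- Up to logarithmic factors this is the error of the empirical mean of responses with bounded
variance, although the responses may have heavy tails. -/
theorem integral_sq_mean_clip_sub_le (hs : IsSampling P ν σ F N X η) {n : ℕ} (hn : n ≤ N)
    (hn0 : 0 < n) (hg : Measurable g) (hL : ∀ x, |g x| ≤ L) (hsm : Measurable s)
    (hsL2 : MemLp s 2 ν) (hV : ∫ x, s x ^ 2 ∂ν ≤ V) (hτ : 0 < τ) :
    ∫ ω, ((1 / n : ℝ) * ∑ i ∈ Finset.range n, clip τ ((g (X i ω) + η i ω) * s (X i ω)) -
        ∫ x, g x * s x ∂ν) ^ 2 ∂P ≤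
      2 * (2 * (L ^ 2 + σ ^ 2) * V) / n + 2 * (2 * (L ^ 2 + σ ^ 2) * V / τ) ^ 2 := by
  have hn' : (n : ℝ) ≠ 0 := by positivity
  have hsum := integral_sq_sum_clip_sub_le (P := P) (τ := τ) (n := n)
    (ξ := fun i ω => (g (X i ω) + η i ω) * s (X i ω)) (F := F) (b := ∫ x, g x * s x ∂ν)
    (C := 2 * (L ^ 2 + σ ^ 2) * V) (fun i hi => hs.le i (by omega)) hτ
    (fun i hi j hj => hs.le_of_le hj.le (by omega))
    (fun i hi j hj => by
      have hX := hs.measurable_design_of_lt hj (by omega)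
      exact ((hg.comp hX).add (hs.measurable_noise_of_lt hj (by omega))).mul (hsm.comp hX))
    (fun i hi => hs.memLp_response_mul (by omega) hg hL hsm hsL2)
    (fun i hi => hs.condExp_response_mul (by omega) hg hL hsm hsL2)
    (fun i hi => by
      filter_upwards [hs.condExp_response_mul_sq_le (by omega : i < N) hg hL hsm hsL2] with ω hω
      exact hω.trans (by gcongr))
  have hscale : ∀ ω, (1 / n : ℝ) * ∑ i ∈ Finset.range n,
      clip τ ((g (X i ω) + η i ω) * s (X i ω)) - ∫ x, g x * s x ∂ν =
        (1 / n : ℝ) * ∑ i ∈ Finset.range n,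
          (clip τ ((g (X i ω) + η i ω) * s (X i ω)) - ∫ x, g x * s x ∂ν) := fun ω => by
    rw [Finset.sum_sub_distrib, Finset.sum_const, Finset.card_range, nsmul_eq_mul, mul_sub]
    field_simp
  simp_rw [hscale, mul_pow]
  rw [integral_const_mul]
  refine (mul_le_mul_of_nonneg_left hsum (by positivity)).trans_eq ?_
  field_simp

end IsSampling

end StreamResponse

section Normalization

variable {d : ℕ}

lemma l1Norm_nonneg (v : Vec d) : 0 ≤ l1Norm v := Finset.sum_nonneg fun _ _ => abs_nonneg _

lemma norm_le_l1Norm (v : Vec d) : ‖v‖ ≤ l1Norm v := by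
  refine le_of_sq_le_sq ?_ (l1Norm_nonneg v)
  rw [EuclideanSpace.real_norm_sq_eq, l1Norm]
  simp_rw [← sq_abs (v _)]
  exact Finset.sum_sq_le_sq_sum_of_nonneg fun i _ => abs_nonneg _

lemma l1Norm_le_sqrt_mul_norm (v : Vec d) : l1Norm v ≤ √d * ‖v‖ := by
  refine le_of_sq_le_sq ?_ (by positivity)
  rw [mul_pow, Real.sq_sqrt (Nat.cast_nonneg d), EuclideanSpace.real_norm_sq_eq, l1Norm]
  simpa using sq_sum_le_card_mul_sum_sq (s := Finset.univ) (f := fun j => |v j|)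

lemma abs_l1Norm_sub_le (v w : Vec d) : |l1Norm v - l1Norm w| ≤ l1Norm (v - w) := by
  simp only [l1Norm, ← Finset.sum_sub_distrib]
  exact (Finset.abs_sum_le_sum_abs _ _).trans
    (Finset.sum_le_sum fun j _ => abs_abs_sub_abs_le_abs_sub _ _)

lemma l1Norm_smul (c : ℝ) (v : Vec d) : l1Norm (c • v) = |c| * l1Norm v := by
  simp [l1Norm, abs_mul, Finset.mul_sum]

lemma norm_inv_l1Norm_smul_le_one (u : Vec d) : ‖(l1Norm u)⁻¹ • u‖ ≤ 1 := by
  rw [norm_smul, Real.norm_of_nonneg (inv_nonneg.2 (l1Norm_nonneg u)), inv_mul_eq_div]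
  exact div_le_one_of_le₀ (norm_le_l1Norm u) (l1Norm_nonneg u)

lemma norm_inv_smul_sub_inv_l1Norm_smul_le {s : ℝ} (hs : 0 < s) (u : Vec d) :
    ‖s⁻¹ • u - (l1Norm u)⁻¹ • u‖ ≤ s⁻¹ * |l1Norm u - s| := by
  rcases (l1Norm_nonneg u).eq_or_lt with h0 | hpos
  · have hu : u = 0 := norm_le_zero_iff.1 ((norm_le_l1Norm u).trans h0.symm.le)
    rw [hu, smul_zero, smul_zero, sub_self, norm_zero]
    positivity
  · have hfactor : s⁻¹ • u - (l1Norm u)⁻¹ • u = (s⁻¹ * (l1Norm u - s)) • (l1Norm u)⁻¹ • u := by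
      rw [← sub_smul, smul_smul]
      congr 1
      field_simp
    rw [hfactor, norm_smul, Real.norm_eq_abs, abs_mul, abs_of_pos (inv_pos.2 hs)]
    exact mul_le_of_le_one_right (by positivity) (norm_inv_l1Norm_smul_le_one u)

lemma norm_sub_inv_l1Norm_smul_le {u w : Vec d} {s : ℝ} (hs : 0 < s) (hw : l1Norm w = 1) :
    ‖w - (l1Norm u)⁻¹ • u‖ ≤ 2 * √d / s * ‖u - s • w‖ := by
  have hd : 1 ≤ √(d : ℝ) := by
    rcases Nat.eq_zero_or_pos d with rfl | hd
    · simp [l1Norm] at hw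
    · exact Real.one_le_sqrt.2 (by exact_mod_cast hd)
  have hscale : ‖w - s⁻¹ • u‖ = s⁻¹ * ‖u - s • w‖ := by
    have hinv : s⁻¹ • (u - s • w) = s⁻¹ • u - w := by
      rw [smul_sub, smul_smul, inv_mul_cancel₀ hs.ne', one_smul]
    rw [norm_sub_rev, ← hinv, norm_smul, Real.norm_of_nonneg (inv_nonneg.2 hs.le)]
  have hlength : |l1Norm u - s| ≤ √d * ‖u - s • w‖ := by
    have h := abs_l1Norm_sub_le u (s • w)
    rw [l1Norm_smul, hw, abs_of_pos hs, mul_one] at h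
    exact h.trans (l1Norm_le_sqrt_mul_norm _)
  calc ‖w - (l1Norm u)⁻¹ • u‖
      ≤ ‖w - s⁻¹ • u‖ + ‖s⁻¹ • u - (l1Norm u)⁻¹ • u‖ := norm_sub_le_norm_sub_add_norm_sub _ _ _
    _ ≤ s⁻¹ * ‖u - s • w‖ + s⁻¹ * |l1Norm u - s| := by
        rw [hscale]
        gcongr
        exact norm_inv_smul_sub_inv_l1Norm_smul_le hs u
    _ ≤ s⁻¹ * (√d * ‖u - s • w‖) + s⁻¹ * (√d * ‖u - s • w‖) := by
        gcongr
        exact le_mul_of_one_le_left (norm_nonneg _) hd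
    _ = 2 * √d / s * ‖u - s • w‖ := by ring

end Normalization

section SteinEstimator

variable {d : ℕ}

lemma eq_smul_sum_of_isMinOn_steinObjective {n : ℕ} {Sc : Vec d → Vec d} {τ : ℝ}
    {xs : Fin n → Vec d} {ys : Fin n → ℝ} {θ : Vec d}
    (h : IsMinOn (steinObjective Sc τ 0 xs ys) Set.univ θ) :
    θ = (1 / (n : ℝ)) • ∑ i, truncate τ (ys i • Sc (xs i)) := by
  set w := (1 / (n : ℝ)) • ∑ i, truncate τ (ys i • Sc (xs i)) with hw
  have hobj : ∀ v, steinObjective Sc τ 0 xs ys v = ‖v - w‖ ^ 2 - ‖w‖ ^ 2 := fun v => by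
    have hlinear :
        2 / (n : ℝ) * ∑ i, inner ℝ (truncate τ (ys i • Sc (xs i))) v = 2 * inner ℝ v w := by
      simp_rw [hw, inner_smul_right, inner_sum, real_inner_comm v]
      ring
    rw [steinObjective, hlinear, norm_sub_sq_real]
    ring
  have hmin := isMinOn_iff.1 h w (Set.mem_univ _)
  rw [hobj, hobj, sub_self, norm_zero] at hmin
  exact sub_eq_zero.1 (norm_eq_zero.1 (pow_eq_zero_iff two_ne_zero |>.1
    (le_antisymm (by linarith) (sq_nonneg ‖θ - w‖))))

variable {I : Problem d} {Lf Lf' m cmin cmax : ℝ}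

namespace Problem.Admissible

lemma measurable_link (ha : I.Admissible Lf Lf' m cmin cmax) : Measurable I.f :=
  ha.smooth.continuous.measurable

lemma norm_sqrtMul_le (ha : I.Admissible Lf Lf' m cmin cmax) (v : Vec d) :
    ‖sqrtMul I.SX v‖ ≤ √cmax * ‖v‖ := by
  have hsq : ‖sqrtMul I.SX v‖ ^ 2 ≤ cmax * ‖v‖ ^ 2 := by
    rw [norm_sqrtMul_sq ha.posDef.posSemidef]
    refine (ha.eig_upper _).trans_eq ?_
    rw [EuclideanSpace.real_norm_sq_eq, dotProduct]
    simp only [sq]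
  refine (Real.le_sqrt_of_sq_le hsq).trans_eq ?_
  rw [Real.sqrt_mul' _ (sq_nonneg _), Real.sqrt_sq (norm_nonneg _)]

lemma sqrtMul_index_ne_zero (ha : I.Admissible Lf Lf' m cmin cmax) : sqrtMul I.SX I.θ ≠ 0 := by
  intro h
  simpa [h, l1Norm] using ha.normalized

lemma norm_sqrtMul_index_sub_normalizedEstimator_le (ha : I.Admissible Lf Lf' m cmin cmax)
    (hm : 0 < m) (v : Vec d) :
    ‖sqrtMul I.SX (I.θ - normalizedEstimator I v)‖ ≤
      2 * √d / m * √cmax * ‖v - I.meanSlope • I.θ‖ := by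
  have hs : 0 < I.meanSlope := hm.trans_le ha.slope
  have hnormalize := norm_sub_inv_l1Norm_smul_le (u := sqrtMul I.SX v) hs ha.normalized
  have hlin : sqrtMul I.SX v - I.meanSlope • sqrtMul I.SX I.θ =
      sqrtMul I.SX (v - I.meanSlope • I.θ) := by simp only [sqrtMul, map_sub, map_smul]
  calc ‖sqrtMul I.SX (I.θ - normalizedEstimator I v)‖
      = ‖sqrtMul I.SX I.θ - (l1Norm (sqrtMul I.SX v))⁻¹ • sqrtMul I.SX v‖ := by
        simp only [normalizedEstimator, sqrtMul, map_sub, map_smul]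
    _ ≤ 2 * √d / I.meanSlope * (√cmax * ‖v - I.meanSlope • I.θ‖) := by
        refine hnormalize.trans ?_
        rw [hlin]
        gcongr
        exact ha.norm_sqrtMul_le _
    _ ≤ 2 * √d / m * (√cmax * ‖v - I.meanSlope • I.θ‖) := by
        gcongr
        exact ha.slope
    _ = 2 * √d / m * √cmax * ‖v - I.meanSlope • I.θ‖ := by ring

end Problem.Admissible

lemma norm_sqrtMul_normalizedEstimator_le (I : Problem d) (v : Vec d) :
    ‖sqrtMul I.SX (normalizedEstimator I v)‖ ≤ 1 := by
  rw [normalizedEstimator, sqrtMul, map_smul]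
  exact norm_inv_l1Norm_smul_le_one _

lemma measurable_normalizedEstimator (I : Problem d) : Measurable (normalizedEstimator I) := by
  have h : Continuous fun v : Vec d => l1Norm (sqrtMul I.SX v) := by
    unfold l1Norm sqrtMul
    fun_prop
  exact h.measurable.inv.smul measurable_id

/-- The average of the first `n` truncated score responses of a stream of samples. -/
noncomputable def steinEstimate {Ω : Type*} (I : Problem d) (τ : ℝ) (n : ℕ) (X : ℕ → Ω → Vec d)
    (η : ℕ → Ω → ℝ) (ω : Ω) : Vec d :=
  (1 / (n : ℝ)) • ∑ i ∈ Finset.range n, truncate τ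
    ((I.f (inner ℝ (X i ω) I.θ) + η i ω) • score (gaussianDensity I.μX I.SX) (X i ω))

variable {Ω : Type*} {mΩ : MeasurableSpace Ω} {P : Measure Ω} {σ τ : ℝ}
  {F : ℕ → MeasurableSpace Ω} {N n : ℕ} {X : ℕ → Ω → Vec d} {η : ℕ → Ω → ℝ}

lemma steinEstimate_apply (hS : I.SX.PosDef) (ω : Ω) (j : Fin d) :
    steinEstimate I τ n X η ω j = 1 / (n : ℝ) * ∑ i ∈ Finset.range n,
      clip τ ((I.f (inner ℝ (X i ω) I.θ) + η i ω) *
        inner ℝ (X i ω - I.μX) (scoreDirection I.SX j)) := by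
  simp [steinEstimate, truncate, clip, score_gaussianDensity_apply hS]

namespace IsSampling

lemma measurable_steinEstimate (hs : IsSampling P I.law σ F N X η)
    (ha : I.Admissible Lf Lf' m cmin cmax) (hn : n ≤ N) :
    Measurable[F n] (steinEstimate I τ n X η) := by
  have hf := ha.measurable_link
  have hcoord : Measurable[F n] fun ω => (steinEstimate I τ n X η ω).ofLp := by
    refine @measurable_pi_lambda _ _ _ (F n) _ _ fun j => ?_
    simp_rw [steinEstimate_apply ha.posDef]
    refine (Finset.measurable_fun_sum _ fun i hi => ?_).const_mul _
    have hX := hs.measurable_design_of_lt (Finset.mem_range.1 hi) hn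
    have hη := hs.measurable_noise_of_lt (Finset.mem_range.1 hi) hn
    have hreward : Measurable fun z : Vec d => I.f (inner ℝ z I.θ) := by fun_prop
    have hscore : Measurable fun z : Vec d => inner ℝ (z - I.μX) (scoreDirection I.SX j) := by
      fun_prop
    exact (measurable_clip τ).comp (((hreward.comp hX).add hη).mul (hscore.comp hX))
  exact (WithLp.measurable_toLp 2 (Fin d → ℝ)).comp hcoord

lemma memLp_steinEstimate_apply (hs : IsSampling P I.law σ F N X η)
    [IsProbabilityMeasure P] (ha : I.Admissible Lf Lf' m cmin cmax) (hn : n ≤ N) (hτ : 0 < τ)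
    (j : Fin d) : MemLp (fun ω => steinEstimate I τ n X η ω j) 2 P := by
  simp_rw [steinEstimate_apply ha.posDef]
  have hf := ha.measurable_link
  refine (memLp_finsetSum _ fun i hi => memLp_clip hτ.le ?_).const_mul _
  exact hs.memLp_response_mul (g := fun z => I.f (inner ℝ z I.θ))
    ((Finset.mem_range.1 hi).trans_le hn) (by fun_prop) (fun z => ha.f_bdd _) (by fun_prop)
    (memLp_inner_sub_multivariateGaussian _ _)

lemma integral_sq_steinEstimate_apply_sub_le (hs : IsSampling P I.law σ F N X η)
    [IsProbabilityMeasure P] (ha : I.Admissible Lf Lf' m cmin cmax) (hcmin : 0 < cmin)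
    (hn : n ≤ N) (hn0 : 0 < n) (hτ : 0 < τ) (j : Fin d) :
    ∫ ω, (steinEstimate I τ n X η ω j - I.meanSlope * I.θ j) ^ 2 ∂P ≤
      2 * (2 * (Lf ^ 2 + σ ^ 2) * cmin⁻¹) / n +
        2 * (2 * (Lf ^ 2 + σ ^ 2) * cmin⁻¹ / τ) ^ 2 := by
  have hf := ha.measurable_link
  have hmean : ∫ z, I.f (inner ℝ z I.θ) * inner ℝ (z - I.μX) (scoreDirection I.SX j) ∂I.law =
      I.meanSlope * I.θ j := by
    simp_rw [← score_gaussianDensity_apply ha.posDef, mul_comm I.meanSlope]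
    exact integral_mul_score_gaussianDensity (ha.smooth.differentiable one_ne_zero) ha.f_bdd
      ha.deriv_bdd ha.posDef _ ha.sqrtMul_index_ne_zero j
  have hV : ∫ z, inner ℝ (z - I.μX) (scoreDirection I.SX j) ^ 2 ∂I.law ≤ cmin⁻¹ :=
    (integral_inner_sub_sq_multivariateGaussian ha.posDef.posSemidef _ _).trans_le
      (norm_sqrtMul_scoreDirection_sq_le ha.posDef hcmin ha.eig_lower j)
  simp_rw [steinEstimate_apply ha.posDef, ← hmean]
  exact hs.integral_sq_mean_clip_sub_le (g := fun z => I.f (inner ℝ z I.θ))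
    (s := fun z => inner ℝ (z - I.μX) (scoreDirection I.SX j)) hn hn0 (by fun_prop)
    (fun z => ha.f_bdd _) (by fun_prop) (memLp_inner_sub_multivariateGaussian _ _) hV hτ

lemma memLp_norm_steinEstimate_sub (hs : IsSampling P I.law σ F N X η)
    [IsProbabilityMeasure P] (ha : I.Admissible Lf Lf' m cmin cmax) (hn : n ≤ N) (hτ : 0 < τ) :
    MemLp (fun ω => ‖steinEstimate I τ n X η ω - I.meanSlope • I.θ‖) 2 P := by
  have hcoord : MemLp (fun ω => ∑ j, |steinEstimate I τ n X η ω j - I.meanSlope * I.θ j|) 2 P :=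
    memLp_finsetSum _ fun j _ =>
      ((hs.memLp_steinEstimate_apply ha hn hτ j).sub (memLp_const _)).abs
  have hmeas := (hs.measurable_steinEstimate (τ := τ) ha hn).mono (hs.le n hn) le_rfl
  refine hcoord.mono (hmeas.sub_const _).norm.aestronglyMeasurable (ae_of_all _ fun ω => ?_)
  rw [norm_norm]
  exact (norm_le_l1Norm _).trans (le_abs_self _)

lemma integral_norm_steinEstimate_sub_le (hs : IsSampling P I.law σ F N X η)
    [IsProbabilityMeasure P] (ha : I.Admissible Lf Lf' m cmin cmax) (hcmin : 0 < cmin)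
    (hn : n ≤ N) (hn0 : 0 < n) (hτ : 0 < τ) :
    ∫ ω, ‖steinEstimate I τ n X η ω - I.meanSlope • I.θ‖ ∂P ≤
      √d * √(2 * (2 * (Lf ^ 2 + σ ^ 2) * cmin⁻¹) / n +
        2 * (2 * (Lf ^ 2 + σ ^ 2) * cmin⁻¹ / τ) ^ 2) := by
  set R := 2 * (2 * (Lf ^ 2 + σ ^ 2) * cmin⁻¹) / n +
    2 * (2 * (Lf ^ 2 + σ ^ 2) * cmin⁻¹ / τ) ^ 2
  have hmem := hs.memLp_norm_steinEstimate_sub ha hn hτ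
  have hsq : ∫ ω, ‖steinEstimate I τ n X η ω - I.meanSlope • I.θ‖ ^ 2 ∂P ≤ d * R := by
    have hint : ∀ j, Integrable
        (fun ω => (steinEstimate I τ n X η ω j - I.meanSlope * I.θ j) ^ 2) P := fun j =>
      ((hs.memLp_steinEstimate_apply ha hn hτ j).sub (memLp_const _)).integrable_sq
    simp_rw [EuclideanSpace.real_norm_sq_eq, PiLp.sub_apply, PiLp.smul_apply, smul_eq_mul]
    rw [integral_finsetSum _ fun j _ => hint j]
    refine (Finset.sum_le_card_nsmul _ _ R fun j _ =>
      hs.integral_sq_steinEstimate_apply_sub_le ha hcmin hn hn0 hτ j).trans_eq ?_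
    simp
  rw [← Real.sqrt_mul (Nat.cast_nonneg d)]
  refine Real.le_sqrt_of_sq_le (le_trans ?_ hsq)
  exact ConvexOn.map_integral_le (convexOn_pow 2) (by fun_prop) isClosed_Ici
    (ae_of_all _ fun ω => norm_nonneg _) (hmem.integrable one_le_two) hmem.integrable_sq

theorem lintegral_norm_sqrtMul_normalizedEstimator_error_le (hs : IsSampling P I.law σ F N X η)
    [IsProbabilityMeasure P] (ha : I.Admissible Lf Lf' m cmin cmax) (hm : 0 < m)
    (hcmin : 0 < cmin) (hn : n ≤ N) (hn0 : 0 < n) (hτ : 0 < τ) :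
    ∫⁻ ω, ENNReal.ofReal ‖sqrtMul I.SX
        (I.θ - normalizedEstimator I (steinEstimate I τ n X η ω))‖ ∂P ≤
      ENNReal.ofReal (2 * √cmax / m * (d * √(2 * (2 * (Lf ^ 2 + σ ^ 2) * cmin⁻¹) / n +
        2 * (2 * (Lf ^ 2 + σ ^ 2) * cmin⁻¹ / τ) ^ 2))) := by
  set R := 2 * (2 * (Lf ^ 2 + σ ^ 2) * cmin⁻¹) / n +
    2 * (2 * (Lf ^ 2 + σ ^ 2) * cmin⁻¹ / τ) ^ 2
  have hint := (hs.memLp_norm_steinEstimate_sub ha hn hτ).integrable one_le_two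
  refine (lintegral_mono fun ω => ENNReal.ofReal_le_ofReal
    (ha.norm_sqrtMul_index_sub_normalizedEstimator_le hm _)).trans ?_
  rw [← ofReal_integral_eq_lintegral_ofReal (hint.const_mul _)
    (ae_of_all _ fun ω => by positivity), integral_const_mul]
  refine ENNReal.ofReal_le_ofReal ?_
  calc 2 * √d / m * √cmax * ∫ ω, ‖steinEstimate I τ n X η ω - I.meanSlope • I.θ‖ ∂P
      ≤ 2 * √d / m * √cmax * (√d * √R) := by
        gcongr
        exact hs.integral_norm_steinEstimate_sub_le ha hcmin hn hn0 hτ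
    _ = 2 * √cmax / m * (√d * √d * √R) := by ring
    _ = 2 * √cmax / m * (d * √R) := by rw [Real.mul_self_sqrt (Nat.cast_nonneg d)]

end IsSampling

end SteinEstimator

section HitCount

variable {E : Type*} {n : ℕ} {U : Set E}

/-- The number of entries of a sample that lie in `U`. -/
noncomputable def hitCount (U : Set E) (xs : Fin n → E) : ℕ := ∑ i, U.indicator (fun _ => 1) (xs i)

lemma hitCount_eq_one_add {xs : Fin (n + 1) → E} {i : Fin (n + 1)} (hi : xs i ∈ U) :
    hitCount U xs = 1 + hitCount U fun j => xs (i.succAbove j) := by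
  rw [hitCount, Fin.sum_univ_succAbove _ i, Set.indicator_of_mem hi, hitCount]

lemma sum_indicator_const {R : Type*} [Semiring R] (c : R) (xs : Fin n → E) :
    ∑ i, U.indicator (fun _ => c) (xs i) = hitCount U xs * c := by
  rw [hitCount, Nat.cast_sum, Finset.sum_mul]
  refine Finset.sum_congr rfl fun i _ => ?_
  by_cases hi : xs i ∈ U <;> simp [hi]

variable [MeasurableSpace E]

lemma measurable_hitCount (hU : MeasurableSet U) :
    Measurable (hitCount U : (Fin n → E) → ℕ) :=
  Finset.measurable_fun_sum _ fun i _ =>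
    (measurable_const.indicator hU).comp (measurable_pi_apply i)

variable {ν : Measure E} [IsProbabilityMeasure ν]

lemma lintegral_pi_mul_succAbove (i : Fin (n + 1)) {φ : E → ENNReal} {ψ : (Fin n → E) → ENNReal}
    (hφ : Measurable φ) (hψ : Measurable ψ) :
    ∫⁻ xs, φ (xs i) * ψ (fun j => xs (i.succAbove j)) ∂(Measure.pi fun _ : Fin (n + 1) => ν) =
      (∫⁻ x, φ x ∂ν) * ∫⁻ xs, ψ xs ∂(Measure.pi fun _ => ν) := by
  have hmp := measurePreserving_piFinSuccAbove (fun _ : Fin (n + 1) => ν) i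
  rw [← lintegral_prod_mul hφ.aemeasurable hψ.aemeasurable]
  exact hmp.lintegral_comp (f := fun z : E × (Fin n → E) => φ z.1 * ψ z.2) (by fun_prop)

lemma lintegral_sum_indicator_div_hitCount (hU : MeasurableSet U) {g : E → ENNReal}
    (hg : Measurable g) :
    ∫⁻ xs, (∑ i, U.indicator g (xs i)) / hitCount U xs
        ∂(Measure.pi fun _ : Fin (n + 1) => ν) =
      (n + 1) * ((∫⁻ x in U, g x ∂ν) *
        ∫⁻ xs, (1 + (hitCount U xs : ENNReal))⁻¹ ∂(Measure.pi fun _ : Fin n => ν)) := by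
  have hremove : ∀ xs : Fin (n + 1) → E, (∑ i, U.indicator g (xs i)) / hitCount U xs =
      ∑ i, U.indicator g (xs i) *
        (1 + (hitCount U (fun j => xs (Fin.succAbove i j)) : ENNReal))⁻¹ := fun xs => by
    rw [div_eq_mul_inv, Finset.sum_mul]
    refine Finset.sum_congr rfl fun i _ => ?_
    by_cases hi : xs i ∈ U
    · rw [hitCount_eq_one_add hi, Nat.cast_add, Nat.cast_one]
    · rw [Set.indicator_of_notMem hi, zero_mul, zero_mul]
  have hψ : Measurable fun xs : Fin n → E => (1 + (hitCount U xs : ENNReal))⁻¹ :=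
    (measurable_from_nat (f := fun k : ℕ => (1 + (k : ENNReal))⁻¹)).comp (measurable_hitCount hU)
  have hremoval : ∀ i : Fin (n + 1), Measurable fun (xs : Fin (n + 1) → E) j =>
      xs (i.succAbove j) := fun i => by fun_prop
  have hterm : ∀ i : Fin (n + 1), Measurable fun xs : Fin (n + 1) → E => U.indicator g (xs i) *
      (1 + (hitCount U (fun j => xs (i.succAbove j)) : ENNReal))⁻¹ := fun i =>
    ((hg.indicator hU).comp (measurable_pi_apply i)).mul (hψ.comp (hremoval i))
  simp_rw [hremove]
  rw [lintegral_finsetSum _ fun i _ => hterm i, ← lintegral_indicator hU]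
  simp_rw [lintegral_pi_mul_succAbove _ (hg.indicator hU) hψ]
  simp

lemma lintegral_inv_one_add_hitCount_le (hU : MeasurableSet U) :
    ∫⁻ xs, (1 + (hitCount U xs : ENNReal))⁻¹ ∂(Measure.pi fun _ : Fin n => ν) ≤
      ((n + 1) * ν U)⁻¹ := by
  have hone : ∫⁻ xs, (∑ i, U.indicator (fun _ => (1 : ENNReal)) (xs i)) / hitCount U xs
      ∂(Measure.pi fun _ : Fin (n + 1) => ν) ≤ 1 := by
    refine (lintegral_mono fun xs => ?_).trans_eq (lintegral_one.trans measure_univ)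
    rw [sum_indicator_const, mul_one]
    exact ENNReal.div_self_le_one
  rw [lintegral_sum_indicator_div_hitCount hU measurable_const, setLIntegral_one] at hone
  rw [ENNReal.le_inv_iff_mul_le]
  calc _ = _ := by ring
    _ ≤ 1 := hone

lemma lintegral_sum_indicator_div_hitCount_le (hU : MeasurableSet U) {g : E → ENNReal}
    (hg : Measurable g) :
    ∫⁻ xs, (∑ i, U.indicator g (xs i)) / hitCount U xs ∂(Measure.pi fun _ : Fin n => ν) ≤
      (∫⁻ x in U, g x ∂ν) / ν U := by
  rcases n with _ | k
  · simp
  have hk : ((k : ENNReal) + 1) ≠ 0 := by simp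
  have hk' : ((k : ENNReal) + 1) ≠ ⊤ := by simp
  rw [lintegral_sum_indicator_div_hitCount hU hg, mul_left_comm, div_eq_mul_inv]
  gcongr
  refine (mul_le_mul_right (lintegral_inv_one_add_hitCount_le hU) _).trans_eq ?_
  rw [ENNReal.mul_inv (Or.inl hk) (Or.inl hk'), ← mul_assoc, ENNReal.mul_inv_cancel hk hk', one_mul]

end HitCount

section LocalAverage

variable {E : Type*} {n : ℕ} {U : Set E}

/-- The average of the responses `ys i` over the entries `xs i` of a sample that lie in `U`,
equal to `0` if there is none. -/
noncomputable def localAverage (U : Set E) {n : ℕ} (xs : Fin n → E) (ys : Fin n → ℝ) : ℝ :=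
  (∑ i, U.indicator (fun _ => ys i) (xs i)) / hitCount U xs

lemma localAverage_of_hitCount_eq_zero {xs : Fin n → E} (h : hitCount U xs = 0) (ys : Fin n → ℝ) :
    localAverage U xs ys = 0 := by
  rw [localAverage, h, Nat.cast_zero, div_zero]

lemma localAverage_add (xs : Fin n → E) (ys ys' : Fin n → ℝ) :
    localAverage U xs (fun i => ys i + ys' i) = localAverage U xs ys + localAverage U xs ys' := by
  simp_rw [localAverage, Set.indicator_add, Finset.sum_add_distrib, add_div]

lemma localAverage_sub_const {xs : Fin n → E} (h : hitCount U xs ≠ 0) (ys : Fin n → ℝ) (c : ℝ) :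
    localAverage U xs (fun i => ys i - c) = localAverage U xs ys - c := by
  have h' : (hitCount U xs : ℝ) ≠ 0 := Nat.cast_ne_zero.2 h
  simp_rw [localAverage, Set.indicator_sub, Finset.sum_sub_distrib, sum_indicator_const]
  rw [sub_div, mul_div_cancel_left₀ c h']

lemma enorm_localAverage_le (xs : Fin n → E) (ys : Fin n → ℝ) :
    ‖localAverage U xs ys‖ₑ ≤ (∑ i, U.indicator (fun _ => ‖ys i‖ₑ) (xs i)) / hitCount U xs := by
  by_cases h : hitCount U xs = 0
  · rw [localAverage_of_hitCount_eq_zero h, enorm_zero]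
    exact zero_le
  rw [localAverage, div_eq_mul_inv, enorm_mul, enorm_inv (Nat.cast_ne_zero.2 h),
    Real.enorm_natCast, ← div_eq_mul_inv]
  gcongr
  refine (enorm_sum_le _ _).trans_eq (Finset.sum_congr rfl fun i _ => ?_)
  exact enorm_indicator_eq_indicator_enorm _ _

lemma enorm_localAverage_sub_le {xs : Fin n → E} {g : E → ℝ} {A : E → ENNReal} {a : ENNReal}
    {c : ℝ} (h : hitCount U xs ≠ 0) (hg : ∀ x ∈ U, ‖g x - c‖ₑ ≤ a + A x) :
    ‖localAverage U xs (fun i => g (xs i)) - c‖ₑ ≤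
      a + (∑ i, U.indicator A (xs i)) / hitCount U xs := by
  have h' : (hitCount U xs : ENNReal) ≠ 0 := Nat.cast_ne_zero.2 h
  have hterm : ∀ i, U.indicator (fun _ => ‖g (xs i) - c‖ₑ) (xs i) ≤
      U.indicator (fun _ => a) (xs i) + U.indicator A (xs i) := fun i => by
    by_cases hi : xs i ∈ U
    · simpa only [Set.indicator_of_mem hi] using hg _ hi
    · simp only [Set.indicator_of_notMem hi, add_zero, le_refl]
  rw [← localAverage_sub_const h]
  refine (enorm_localAverage_le _ _).trans ?_
  calc (∑ i, U.indicator (fun _ => ‖g (xs i) - c‖ₑ) (xs i)) / hitCount U xs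
      ≤ (hitCount U xs * a + ∑ i, U.indicator A (xs i)) / hitCount U xs := by
        rw [← sum_indicator_const, ← Finset.sum_add_distrib]
        gcongr
        exact hterm _
    _ = a + (∑ i, U.indicator A (xs i)) / hitCount U xs := by
        rw [ENNReal.add_div, mul_comm, ENNReal.mul_div_cancel_right h' (ENNReal.natCast_ne_top _)]

/-- The weight `r` trades the noise against the event that no design hits `U`. -/
lemma enorm_localAverage_add_sub_le {xs : Fin n → E} {g : E → ℝ} {A : E → ENNReal} {a : ENNReal}
    {c L r : ℝ} {e : Fin n → ℝ} (hg : ∀ x ∈ U, ‖g x - c‖ₑ ≤ a + A x) (hc : |c| ≤ L) (hr : 0 < r) :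
    ‖localAverage U xs (fun i => g (xs i) + e i) - c‖ₑ ≤
      a + (∑ i, U.indicator A (xs i)) / hitCount U xs +
        ENNReal.ofReal (L + 1) *
          (ENNReal.ofReal r⁻¹ + ENNReal.ofReal r * (1 + (hitCount U xs : ENNReal))⁻¹) +
        ENNReal.ofReal (r * localAverage U xs e ^ 2) := by
  have hL : 0 ≤ L := (abs_nonneg c).trans hc
  have hinv := inv_pos.2 hr
  by_cases h : hitCount U xs = 0
  · have hone : (1 : ℝ) ≤ r⁻¹ + r := by
      rw [← sub_nonneg, show r⁻¹ + r - 1 = ((r - 1) ^ 2 + r) / r by field_simp; ring]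
      positivity
    calc ‖localAverage U xs (fun i => g (xs i) + e i) - c‖ₑ = ENNReal.ofReal |c| := by
          rw [localAverage_of_hitCount_eq_zero h, zero_sub, enorm_neg, Real.enorm_eq_ofReal_abs]
      _ ≤ ENNReal.ofReal ((L + 1) * (r⁻¹ + r)) := ENNReal.ofReal_le_ofReal (by nlinarith)
      _ = ENNReal.ofReal (L + 1) *
          (ENNReal.ofReal r⁻¹ + ENNReal.ofReal r * (1 + (hitCount U xs : ENNReal))⁻¹) := by
          rw [h, Nat.cast_zero, add_zero, inv_one, mul_one, ← ENNReal.ofReal_add hinv.le hr.le,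
            ENNReal.ofReal_mul (by positivity)]
      _ ≤ _ := le_add_right le_add_self
  · set s := localAverage U xs e
    have hnoise : ‖s‖ₑ ≤ ENNReal.ofReal (L + 1) * ENNReal.ofReal r⁻¹ +
        ENNReal.ofReal (r * s ^ 2) := by
      have hs : |s| ≤ r⁻¹ + r * s ^ 2 := by
        rw [← sub_nonneg, ← sq_abs s, show r⁻¹ + r * |s| ^ 2 - |s| =
          ((r * |s| - 1) ^ 2 + r * |s|) / r by field_simp; ring]
        positivity
      rw [Real.enorm_eq_ofReal_abs, ← ENNReal.ofReal_mul (by positivity),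
        ← ENNReal.ofReal_add (by positivity) (by positivity)]
      exact ENNReal.ofReal_le_ofReal (by nlinarith)
    rw [localAverage_add, add_sub_right_comm]
    refine (enorm_add_le _ _).trans ?_
    rw [add_assoc (a + _), mul_add]
    refine add_le_add (enorm_localAverage_sub_le h hg) (hnoise.trans ?_)
    gcongr
    exact le_self_add

end LocalAverage

section LocalWeight

variable {E : Type*} {n : ℕ} {U : Set E}

/-- The weight of the `i`-th response in `localAverage U xs`. -/
noncomputable def localWeight (U : Set E) {n : ℕ} (xs : Fin n → E) (i : Fin n) : ℝ :=
  U.indicator (fun _ => (hitCount U xs : ℝ)⁻¹) (xs i)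

lemma localAverage_eq_sum_localWeight_mul (xs : Fin n → E) (ys : Fin n → ℝ) :
    localAverage U xs ys = ∑ i, localWeight U xs i * ys i := by
  rw [localAverage, div_eq_mul_inv, Finset.sum_mul]
  refine Finset.sum_congr rfl fun i _ => ?_
  by_cases hi : xs i ∈ U
  · simp only [localWeight, Set.indicator_of_mem hi, mul_comm]
  · simp only [localWeight, Set.indicator_of_notMem hi, zero_mul]

lemma abs_localWeight_le_one (xs : Fin n → E) (i : Fin n) : |localWeight U xs i| ≤ 1 := by
  by_cases hi : xs i ∈ U
  · rw [localWeight, Set.indicator_of_mem hi, abs_of_nonneg (by positivity)]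
    exact Nat.cast_inv_le_one _
  · rw [localWeight, Set.indicator_of_notMem hi, abs_zero]
    exact zero_le_one

lemma sum_sq_localWeight_le (xs : Fin n → E) :
    ∑ i, localWeight U xs i ^ 2 ≤ 2 * (1 + (hitCount U xs : ℝ))⁻¹ := by
  have hsq : ∀ i, localWeight U xs i ^ 2 =
      U.indicator (fun _ => ((hitCount U xs : ℝ)⁻¹) ^ 2) (xs i) := fun i => by
    by_cases hi : xs i ∈ U
    · simp only [localWeight, Set.indicator_of_mem hi]
    · simp only [localWeight, Set.indicator_of_notMem hi, ne_eq, two_ne_zero, not_false_eq_true,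
        zero_pow]
  simp_rw [hsq, sum_indicator_const]
  rcases Nat.eq_zero_or_pos (hitCount U xs) with h | h
  · rw [h]
    norm_num
  · have h1 : (1 : ℝ) ≤ hitCount U xs := by exact_mod_cast h
    have h0 : (0 : ℝ) < hitCount U xs := zero_lt_one.trans_le h1
    rw [← div_eq_mul_inv, le_div_iff₀ (by positivity)]
    field_simp
    linarith

lemma ofReal_sum_sq_localWeight_le (xs : Fin n → E) :
    ENNReal.ofReal (∑ i, localWeight U xs i ^ 2) ≤ 2 * (1 + (hitCount U xs : ENNReal))⁻¹ := by
  refine (ENNReal.ofReal_le_ofReal (sum_sq_localWeight_le xs)).trans_eq ?_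
  rw [ENNReal.ofReal_mul two_pos.le, ENNReal.ofReal_inv_of_pos (by positivity),
    ENNReal.ofReal_add zero_le_one (Nat.cast_nonneg _), ENNReal.ofReal_one,
    ENNReal.ofReal_natCast, ENNReal.ofReal_ofNat]

variable {α : Type*} [MeasurableSpace α] [MeasurableSpace E] {V : Set (α × E)}

lemma measurable_indicator_section {β : Type*} [MeasurableSpace β] [Zero β] (hV : MeasurableSet V)
    {f : α × (Fin n → E) → β} (hf : Measurable f) (i : Fin n) :
    Measurable fun p : α × (Fin n → E) => (Prod.mk p.1 ⁻¹' V).indicator (fun _ => f p) (p.2 i) :=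
  hf.indicator (hV.preimage (measurable_fst.prodMk
    ((measurable_pi_apply i).comp measurable_snd)))

lemma measurable_hitCount_section (hV : MeasurableSet V) :
    Measurable fun p : α × (Fin n → E) => hitCount (Prod.mk p.1 ⁻¹' V) p.2 :=
  Finset.measurable_fun_sum _ fun i _ => measurable_indicator_section hV measurable_const i

lemma measurable_localWeight_section (hV : MeasurableSet V) (i : Fin n) :
    Measurable fun p : α × (Fin n → E) => localWeight (Prod.mk p.1 ⁻¹' V) p.2 i :=
  measurable_indicator_section hV ((measurable_from_nat (f := fun k : ℕ => (k : ℝ)⁻¹)).comp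
    (measurable_hitCount_section hV)) i

lemma measurable_inv_one_add_hitCount_section (hV : MeasurableSet V) :
    Measurable fun p : α × (Fin n → E) =>
      (1 + (hitCount (Prod.mk p.1 ⁻¹' V) p.2 : ENNReal))⁻¹ :=
  (measurable_from_nat (f := fun k : ℕ => (1 + (k : ENNReal))⁻¹)).comp
    (measurable_hitCount_section hV)

lemma measurable_sum_indicator_div_hitCount_section (hV : MeasurableSet V)
    {A : α × E → ENNReal} (hA : Measurable A) :
    Measurable fun p : α × (Fin n → E) =>
      (∑ i, (Prod.mk p.1 ⁻¹' V).indicator (fun x => A (p.1, x)) (p.2 i)) /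
        hitCount (Prod.mk p.1 ⁻¹' V) p.2 :=
  (Finset.measurable_fun_sum _ fun i _ => measurable_indicator_section hV
    (hA.comp (measurable_fst.prodMk ((measurable_pi_apply i).comp measurable_snd))) i).div
    (measurable_from_nat.comp (measurable_hitCount_section hV))

end LocalWeight

section LocalRisk

variable {Ω E : Type*} {mΩ : MeasurableSpace Ω} [MeasurableSpace E] {P : Measure Ω}
  [IsProbabilityMeasure P] {ν : Measure E} [IsProbabilityMeasure ν] {σ : ℝ}
  {F : ℕ → MeasurableSpace Ω} {N n₀ n : ℕ} {X : ℕ → Ω → E} {η : ℕ → Ω → ℝ}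
  {α : Type*} [MeasurableSpace α] {Z : Ω → α} {U : Set (α × E)} {ρ : α → ℝ} {B : ℝ}

lemma lintegral_pi_hitCount_bound_le {S : Set E} (hS : MeasurableSet S) {A : E → ENNReal}
    (hA : Measurable A) (a C r r' : ENNReal) :
    ∫⁻ xs, (a + (∑ i, S.indicator A (xs i)) / hitCount S xs +
        C * (r' + r * (1 + (hitCount S xs : ENNReal))⁻¹)) ∂(Measure.pi fun _ : Fin n => ν) ≤
      a + (∫⁻ x in S, A x ∂ν) / ν S + C * (r' + r * (n * ν S)⁻¹) := by
  have hN : Measurable fun xs : Fin n → E => (1 + (hitCount S xs : ENNReal))⁻¹ :=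
    (measurable_from_nat (f := fun k : ℕ => (1 + (k : ENNReal))⁻¹)).comp (measurable_hitCount hS)
  rw [lintegral_add_right _ (by fun_prop), lintegral_add_left measurable_const,
    lintegral_const_mul _ (by fun_prop), lintegral_add_left measurable_const,
    lintegral_const_mul _ hN, lintegral_const, lintegral_const, measure_univ, mul_one, mul_one]
  gcongr
  · exact lintegral_sum_indicator_div_hitCount_le hS hA
  · refine (lintegral_inv_one_add_hitCount_le hS).trans ?_
    gcongr
    exact le_self_add

namespace IsSampling

lemma lintegral_sq_sum_mul_noise_le (hs : IsSampling P ν σ F N X η) (hn : n₀ + n ≤ N)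
    {c : Fin n → Ω → ℝ}
    (hc : ∀ i, Measurable[F n₀ ⊔ MeasurableSpace.comap (batch X n₀ n) inferInstance] (c i))
    (hB : ∀ i ω, |c i ω| ≤ B) :
    ∫⁻ ω, ENNReal.ofReal ((∑ i, c i ω * batch η n₀ n ω i) ^ 2) ∂P ≤
      ENNReal.ofReal (σ ^ 2) * ∑ i, ∫⁻ ω, ENNReal.ofReal (c i ω ^ 2) ∂P := by
  have hext : ∀ i (hi : i < n), (fun ω => if hi : i < n then c ⟨i, hi⟩ ω else 0) = c ⟨i, hi⟩ :=
    fun i hi => funext fun ω => dif_pos hi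
  have hle := hs.lintegral_sq_weighted_noise_le hn
    (c := fun i ω => if hi : i < n then c ⟨i, hi⟩ ω else 0) (B := B)
    (fun i hi => by rw [hext i hi]; exact hc _)
    (fun i hi ω => by rw [congrFun (hext i hi) ω]; exact hB _ ω)
  simpa only [Finset.sum_range, Fin.is_lt, dite_true, Fin.eta, batch] using hle

lemma lintegral_mul_sq_localAverage_noise_le (hs : IsSampling P ν σ F N X η) (hn : n₀ + n ≤ N)
    (hZ : Measurable[F n₀] Z) (hU : MeasurableSet U) (hρ : Measurable ρ) (hρ0 : ∀ z, 0 ≤ ρ z)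
    (hρB : ∀ z, ρ z ≤ B) :
    ∫⁻ ω, ENNReal.ofReal (ρ (Z ω) *
        localAverage (Prod.mk (Z ω) ⁻¹' U) (batch X n₀ n ω) (batch η n₀ n ω) ^ 2) ∂P ≤
      ∫⁻ ω, ENNReal.ofReal (2 * σ ^ 2) * (ENNReal.ofReal (ρ (Z ω)) *
        (1 + (hitCount (Prod.mk (Z ω) ⁻¹' U) (batch X n₀ n ω) : ENNReal))⁻¹) ∂P := by
  set w : Fin n → Ω → ℝ := fun i ω => localWeight (Prod.mk (Z ω) ⁻¹' U) (batch X n₀ n ω) i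
  have hc : ∀ i, Measurable[F n₀ ⊔ MeasurableSpace.comap (batch X n₀ n) inferInstance]
      fun ω => √(ρ (Z ω)) * w i ω := fun i =>
    Measurable.comp (g := fun p : α × (Fin n → E) =>
        √(ρ p.1) * localWeight (Prod.mk p.1 ⁻¹' U) p.2 i) (f := fun ω => (Z ω, batch X n₀ n ω))
      ((hρ.comp measurable_fst).sqrt.mul (measurable_localWeight_section hU i))
      ((hZ.mono le_sup_left le_rfl).prodMk ((comap_measurable _).mono le_sup_right le_rfl))
  have hB : ∀ i ω, |√(ρ (Z ω)) * w i ω| ≤ √B := fun i ω => by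
    rw [abs_mul, abs_of_nonneg (Real.sqrt_nonneg _), ← mul_one √B]
    gcongr
    · exact hρB _
    · exact abs_localWeight_le_one _ _
  have hfac : ∀ ω, ρ (Z ω) * localAverage (Prod.mk (Z ω) ⁻¹' U) (batch X n₀ n ω)
      (batch η n₀ n ω) ^ 2 = (∑ i, √(ρ (Z ω)) * w i ω * batch η n₀ n ω i) ^ 2 := fun ω => by
    simp_rw [localAverage_eq_sum_localWeight_mul, mul_assoc, ← Finset.mul_sum]
    rw [mul_pow, Real.sq_sqrt (hρ0 _)]
  have hcm : ∀ i, Measurable fun ω => ENNReal.ofReal ((√(ρ (Z ω)) * w i ω) ^ 2) := fun i =>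
    (((hc i).mono (sup_le (hs.le n₀ (by omega)) (hs.measurable_batch hn).comap_le)
      le_rfl).pow_const 2).ennreal_ofReal
  simp_rw [hfac]
  refine (hs.lintegral_sq_sum_mul_noise_le hn hc hB).trans ?_
  rw [← lintegral_finsetSum _ fun i _ => hcm i, ← lintegral_const_mul _
    (Finset.measurable_fun_sum _ fun i _ => hcm i)]
  refine lintegral_mono fun ω => ?_
  rw [← ENNReal.ofReal_sum_of_nonneg fun i _ => sq_nonneg _]
  simp_rw [mul_pow, Real.sq_sqrt (hρ0 _), ← Finset.mul_sum]
  rw [ENNReal.ofReal_mul (hρ0 _), mul_comm 2 (σ ^ 2), ENNReal.ofReal_mul (sq_nonneg σ), mul_assoc,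
    ENNReal.ofReal_ofNat, mul_left_comm 2]
  gcongr
  exact ofReal_sum_sq_localWeight_le _

lemma lintegral_enorm_localAverage_sub_le_lintegral_hitCount (hs : IsSampling P ν σ F N X η)
    (hn : n₀ + n ≤ N) (hZ : Measurable[F n₀] Z) (hU : MeasurableSet U) {g : E → ℝ} {c L : ℝ}
    (hc : |c| ≤ L) {a : α → ENNReal} (ha : Measurable a) {A : α × E → ENNReal} (hA : Measurable A)
    (hg : ∀ z x, (z, x) ∈ U → ‖g x - c‖ₑ ≤ a z + A (z, x))
    (hρ : Measurable ρ) (hρ0 : ∀ z, 0 < ρ z) (hρB : ∀ z, ρ z ≤ B) :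
    ∫⁻ ω, ‖localAverage (Prod.mk (Z ω) ⁻¹' U) (batch X n₀ n ω)
        (fun i => g (batch X n₀ n ω i) + batch η n₀ n ω i) - c‖ₑ ∂P ≤
      ∫⁻ ω, (a (Z ω) + (∑ i, (Prod.mk (Z ω) ⁻¹' U).indicator (fun x => A (Z ω, x))
          (batch X n₀ n ω i)) / hitCount (Prod.mk (Z ω) ⁻¹' U) (batch X n₀ n ω) +
        ENNReal.ofReal (L + 1 + 2 * σ ^ 2) * (ENNReal.ofReal (ρ (Z ω))⁻¹ +
          ENNReal.ofReal (ρ (Z ω)) *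
            (1 + (hitCount (Prod.mk (Z ω) ⁻¹' U) (batch X n₀ n ω) : ENNReal))⁻¹)) ∂P := by
  have hL : 0 ≤ L := (abs_nonneg c).trans hc
  have hZ' : Measurable Z := hZ.mono (hs.le n₀ (by omega)) le_rfl
  have hpair : Measurable fun ω => (Z ω, batch X n₀ n ω) := hZ'.prodMk (hs.measurable_batch hn)
  have hbias := (measurable_sum_indicator_div_hitCount_section hU hA).comp hpair
  have hvar := (measurable_inv_one_add_hitCount_section hU).comp hpair
  simp only [Function.comp_def] at hbias hvar
  refine (lintegral_mono fun ω =>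
    enorm_localAverage_add_sub_le (U := Prod.mk (Z ω) ⁻¹' U) (A := fun x => A (Z ω, x))
      (fun x hx => hg _ x hx) hc (hρ0 (Z ω))).trans ?_
  rw [lintegral_add_left (by fun_prop)]
  refine (add_le_add_right (hs.lintegral_mul_sq_localAverage_noise_le hn hZ hU hρ
    (fun z => (hρ0 z).le) hρB) _).trans ?_
  rw [← lintegral_add_left (by fun_prop)]
  refine lintegral_mono fun ω => ?_
  rw [ENNReal.ofReal_add (p := L + 1) (by positivity) (by positivity), add_mul, add_assoc (a _ + _)]
  gcongr
  exact le_add_self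

theorem lintegral_enorm_localAverage_sub_le (hs : IsSampling P ν σ F N X η) (hn : n₀ + n ≤ N)
    (hZ : Measurable[F n₀] Z) (hU : MeasurableSet U) {g : E → ℝ} {c L : ℝ} (hc : |c| ≤ L)
    {a : α → ENNReal} (ha : Measurable a) {A : α × E → ENNReal} (hA : Measurable A)
    (hg : ∀ z x, (z, x) ∈ U → ‖g x - c‖ₑ ≤ a z + A (z, x))
    (hρ : Measurable ρ) (hρ0 : ∀ z, 0 < ρ z) (hρB : ∀ z, ρ z ≤ B) :
    ∫⁻ ω, ‖localAverage (Prod.mk (Z ω) ⁻¹' U) (batch X n₀ n ω)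
        (fun i => g (batch X n₀ n ω i) + batch η n₀ n ω i) - c‖ₑ ∂P ≤
      ∫⁻ ω, (a (Z ω) + (∫⁻ x in Prod.mk (Z ω) ⁻¹' U, A (Z ω, x) ∂ν) / ν (Prod.mk (Z ω) ⁻¹' U) +
        ENNReal.ofReal (L + 1 + 2 * σ ^ 2) * (ENNReal.ofReal (ρ (Z ω))⁻¹ +
          ENNReal.ofReal (ρ (Z ω)) * (n * ν (Prod.mk (Z ω) ⁻¹' U))⁻¹)) ∂P := by
  refine (hs.lintegral_enorm_localAverage_sub_le_lintegral_hitCount hn hZ hU hc ha hA hg hρ hρ0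
    hρB).trans ?_
  have hbias := measurable_sum_indicator_div_hitCount_section (n := n) hU hA
  have hvar := measurable_inv_one_add_hitCount_section (n := n) hU
  rw [hs.lintegral_batch hn hZ (Φ := fun p => a p.1 + (∑ i, (Prod.mk p.1 ⁻¹' U).indicator
    (fun x => A (p.1, x)) (p.2 i)) / hitCount (Prod.mk p.1 ⁻¹' U) p.2 +
      ENNReal.ofReal (L + 1 + 2 * σ ^ 2) * (ENNReal.ofReal (ρ p.1)⁻¹ + ENNReal.ofReal (ρ p.1) *
        (1 + (hitCount (Prod.mk p.1 ⁻¹' U) p.2 : ENNReal))⁻¹)) (by fun_prop)]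
  exact lintegral_mono fun ω => lintegral_pi_hitCount_bound_le
    (hU.preimage measurable_prodMk_left) (hA.comp measurable_prodMk_left) _ _ _ _

end IsSampling

end LocalRisk

section Windows

lemma lintegral_setLIntegral_section_mul_swap {X Y : Type*} [MeasurableSpace X]
    [MeasurableSpace Y] {m : Measure X} {ν : Measure Y} [SFinite m] [SFinite ν] {R : Set (X × Y)}
    (hR : MeasurableSet R) {w : Y → ENNReal} (hw : Measurable w) {φ : X → ENNReal}
    (hφ : Measurable φ) :
    ∫⁻ x, (∫⁻ y in Prod.mk x ⁻¹' R, w y ∂ν) * φ x ∂m =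
      ∫⁻ y, w y * ∫⁻ x in (fun x => (x, y)) ⁻¹' R, φ x ∂m ∂ν := by
  set B : X × Y → ENNReal := R.indicator fun p => w p.2 * φ p.1
  have hBm : Measurable B :=
    ((hw.comp measurable_snd).mul (hφ.comp measurable_fst)).indicator hR
  have hleft : ∀ x, (∫⁻ y in Prod.mk x ⁻¹' R, w y ∂ν) * φ x = ∫⁻ y, B (x, y) ∂ν := fun x => by
    rw [← lintegral_mul_const _ hw, ← lintegral_indicator (hR.preimage measurable_prodMk_left)]
    rfl
  have hright : ∀ y, w y * ∫⁻ x in (fun x => (x, y)) ⁻¹' R, φ x ∂m = ∫⁻ x, B (x, y) ∂m :=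
    fun y => by
    rw [← lintegral_const_mul _ hφ, ← lintegral_indicator (hR.preimage measurable_prodMk_right)]
    rfl
  simp_rw [hleft, hright]
  exact lintegral_lintegral_swap (f := fun x y => B (x, y)) hBm.aemeasurable

variable {E : Type*} [MeasurableSpace E] {ν : Measure E} {Z : E → ℝ} {h : ℝ}

lemma setLIntegral_inv_window_le_one (hZ : Measurable Z) {s : Set ℝ} (hs : MeasurableSet s)
    (hdiam : ∀ u ∈ s, ∀ v ∈ s, dist u v ≤ h) :
    ∫⁻ x in Z ⁻¹' s, (ν (Z ⁻¹' Metric.closedBall (Z x) h))⁻¹ ∂ν ≤ 1 := by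
  calc ∫⁻ x in Z ⁻¹' s, (ν (Z ⁻¹' Metric.closedBall (Z x) h))⁻¹ ∂ν
      ≤ ∫⁻ _ in Z ⁻¹' s, (ν (Z ⁻¹' s))⁻¹ ∂ν :=
        setLIntegral_mono' (hZ hs) fun x hx => ENNReal.inv_le_inv.2
          (measure_mono fun x' hx' => hdiam _ hx' _ hx)
    _ = (ν (Z ⁻¹' s))⁻¹ * ν (Z ⁻¹' s) := by rw [setLIntegral_const]
    _ ≤ 1 := ENNReal.inv_mul_le_one _

lemma setLIntegral_inv_window_closedBall_half_le_one (hZ : Measurable Z) (u : ℝ) :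
    ∫⁻ x in Z ⁻¹' Metric.closedBall u (h / 2), (ν (Z ⁻¹' Metric.closedBall (Z x) h))⁻¹ ∂ν ≤ 1 :=
  setLIntegral_inv_window_le_one hZ Metric.isClosed_closedBall.measurableSet fun a ha b hb => by
    rw [Metric.mem_closedBall] at ha hb
    linarith [dist_triangle_right a b u]

lemma setLIntegral_inv_window_closedBall_le_two (hZ : Measurable Z) (u : ℝ) :
    ∫⁻ x in Z ⁻¹' Metric.closedBall u h, (ν (Z ⁻¹' Metric.closedBall (Z x) h))⁻¹ ∂ν ≤ 2 := by
  have hsub : Z ⁻¹' Metric.closedBall u h ⊆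
      Z ⁻¹' Set.Icc (u - h) u ∪ Z ⁻¹' Set.Icc u (u + h) := fun x hx => by
    rw [Set.mem_preimage, Real.closedBall_eq_Icc] at hx
    exact (le_total (Z x) u).imp (fun hle => ⟨hx.1, hle⟩) fun hle => ⟨hle, hx.2⟩
  refine (lintegral_mono_set hsub).trans ((lintegral_union_le _ _ _).trans ?_)
  rw [← one_add_one_eq_two]
  refine add_le_add (setLIntegral_inv_window_le_one hZ measurableSet_Icc fun a ha b hb => ?_)
    (setLIntegral_inv_window_le_one hZ measurableSet_Icc fun a ha b hb => ?_)
  · exact (Real.dist_le_of_mem_Icc ha hb).trans_eq (by ring)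
  · exact (Real.dist_le_of_mem_Icc ha hb).trans_eq (by ring)

variable [SFinite ν]

lemma measurable_measure_window (hZ : Measurable Z) :
    Measurable fun x => ν (Z ⁻¹' Metric.closedBall (Z x) h) :=
  measurable_measure_prodMk_left (s := {p : E × E | dist (Z p.2) (Z p.1) ≤ h})
    (measurableSet_le (by fun_prop) measurable_const)

lemma lintegral_window_average_le (hZ : Measurable Z) {D : E → ENNReal} (hD : Measurable D) :
    ∫⁻ x, (∫⁻ x' in Z ⁻¹' Metric.closedBall (Z x) h, D x' ∂ν) /
        ν (Z ⁻¹' Metric.closedBall (Z x) h) ∂ν ≤ 2 * ∫⁻ x, D x ∂ν := by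
  have hR : MeasurableSet {p : E × E | dist (Z p.2) (Z p.1) ≤ h} :=
    measurableSet_le (by fun_prop) measurable_const
  simp_rw [div_eq_mul_inv]
  refine (lintegral_setLIntegral_section_mul_swap hR hD
    (measurable_measure_window hZ (h := h)).inv).trans_le ?_
  rw [mul_comm 2, ← lintegral_mul_const _ hD]
  refine lintegral_mono fun x' => mul_le_mul_right ?_ _
  refine le_trans (lintegral_mono_set fun x hx => ?_)
    (setLIntegral_inv_window_closedBall_le_two hZ (Z x'))
  exact Metric.mem_closedBall_comm.1 hx

lemma inv_one_add_sq_le_lintegral (hh : 0 < h) (hh1 : h ≤ 1) (z : ℝ) :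
    ENNReal.ofReal (1 + z ^ 2)⁻¹ ≤
      ENNReal.ofReal (2 / h) *
        ∫⁻ u in Metric.closedBall z (h / 2), ENNReal.ofReal (1 + u ^ 2)⁻¹ := by
  calc ENNReal.ofReal (1 + z ^ 2)⁻¹
      = ENNReal.ofReal (2 / h) * (ENNReal.ofReal (2 * (1 + z ^ 2))⁻¹ *
          volume (Metric.closedBall z (h / 2))) := by
        rw [Real.volume_closedBall, ← ENNReal.ofReal_mul (by positivity),
          ← ENNReal.ofReal_mul (by positivity)]
        congr 1
        field_simp
    _ ≤ _ := by
        rw [← setLIntegral_const]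
        refine mul_le_mul_right (setLIntegral_mono' Metric.isClosed_closedBall.measurableSet
          fun u hu => ENNReal.ofReal_le_ofReal (inv_anti₀ (by positivity) ?_)) _
        have hu' := abs_le.1 (Real.dist_eq u z ▸ Metric.mem_closedBall.1 hu)
        nlinarith [sq_nonneg (u - 2 * z), sq_nonneg (z - u)]

lemma lintegral_inv_one_add_sq :
    ∫⁻ u : ℝ, ENNReal.ofReal (1 + u ^ 2)⁻¹ = ENNReal.ofReal Real.pi := by
  rw [← integral_univ_inv_one_add_sq, ofReal_integral_eq_lintegral_ofReal
    integrable_inv_one_add_sq (ae_of_all _ fun u => by positivity)]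

lemma lintegral_inv_one_add_sq_mul_inv_window_le (hZ : Measurable Z) (hh : 0 < h) (hh1 : h ≤ 1)
    (b : ℝ) :
    ∫⁻ x, ENNReal.ofReal (1 + (Z x - b) ^ 2)⁻¹ * (ν (Z ⁻¹' Metric.closedBall (Z x) h))⁻¹ ∂ν ≤
      ENNReal.ofReal (2 * Real.pi / h) := by
  set φ : E → ENNReal := fun x => (ν (Z ⁻¹' Metric.closedBall (Z x) h))⁻¹
  have hφm : Measurable φ := (measurable_measure_window hZ).inv
  set R : Set (E × ℝ) := {p | dist p.2 (Z p.1 - b) ≤ h / 2}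
  have hR : MeasurableSet R := measurableSet_le (by fun_prop) measurable_const
  calc ∫⁻ x, ENNReal.ofReal (1 + (Z x - b) ^ 2)⁻¹ * φ x ∂ν
      ≤ ∫⁻ x, ENNReal.ofReal (2 / h) *
          ((∫⁻ u in Prod.mk x ⁻¹' R, ENNReal.ofReal (1 + u ^ 2)⁻¹) * φ x) ∂ν := by
        refine lintegral_mono fun x => ?_
        rw [← mul_assoc]
        exact mul_le_mul_left (inv_one_add_sq_le_lintegral hh hh1 (Z x - b)) _
    _ = ENNReal.ofReal (2 / h) * ∫⁻ u, ENNReal.ofReal (1 + u ^ 2)⁻¹ *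
          ∫⁻ x in (fun x => (x, u)) ⁻¹' R, φ x ∂ν := by
        rw [lintegral_const_mul' _ _ ENNReal.ofReal_ne_top,
          lintegral_setLIntegral_section_mul_swap hR (by fun_prop) hφm]
    _ ≤ ENNReal.ofReal (2 / h) * ∫⁻ u, ENNReal.ofReal (1 + u ^ 2)⁻¹ := by
        refine mul_le_mul_right (lintegral_mono fun u => mul_le_of_le_one_right' ?_) _
        refine le_trans (lintegral_mono_set fun x hx => ?_)
          (setLIntegral_inv_window_closedBall_half_le_one hZ (u + b))
        rw [Set.mem_preimage, Metric.mem_closedBall, dist_comm, ← dist_sub_right _ _ b,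
          add_sub_cancel_right]
        exact hx
    _ = _ := by
        rw [lintegral_inv_one_add_sq, ← ENNReal.ofReal_mul (by positivity), div_mul_eq_mul_div]

end Windows

section IntegratedRisk

variable {d : ℕ}

/-- The arms whose index in the direction `v` is within `h` of the index of `x`. -/
def indexWindow (h : ℝ) (x v : Vec d) : Set (Vec d) :=
  (fun x' => inner ℝ x' v) ⁻¹' Metric.closedBall (inner ℝ x v) h

/-- A bound for the expected error at `x` of averaging the rewards of `n` arms drawn from `ν` over
`indexWindow h x v`: the bias at `x` itself, the mean bias over the window and the stochastic error,
where `M` bounds the slope of the link, `C` collects the sizes of link and noise, and the two parts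
of the last term balance at the weight `h * (1 + ⟪x - μ, v⟫ ^ 2)`, which is `ν`-integrable in `x`
against the inverse mass of the window. -/
noncomputable def localRisk (ν : Measure (Vec d)) (μ θ : Vec d) (M C h : ℝ) (n : ℕ)
    (v x : Vec d) : ENNReal :=
  ENNReal.ofReal (M * (h + |inner ℝ (x - μ) (θ - v)|)) +
    (∫⁻ x' in indexWindow h x v, ENNReal.ofReal (M * |inner ℝ (x' - μ) (θ - v)|) ∂ν) /
      ν (indexWindow h x v) +
    ENNReal.ofReal C * (ENNReal.ofReal (h * (1 + inner ℝ (x - μ) v ^ 2)) +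
      ENNReal.ofReal (h * (1 + inner ℝ (x - μ) v ^ 2))⁻¹ * (n * ν (indexWindow h x v))⁻¹)

lemma measurableSet_indexWindow (h : ℝ) :
    MeasurableSet {q : (Vec d × Vec d) × Vec d | q.2 ∈ indexWindow h q.1.2 q.1.1} :=
  measurableSet_le (f := fun q : (Vec d × Vec d) × Vec d =>
    dist (inner ℝ q.2 q.1.1 : ℝ) (inner ℝ q.1.2 q.1.1)) (by fun_prop) measurable_const

lemma measurable_localRisk (ν : Measure (Vec d)) [SFinite ν] (μ θ : Vec d) (M C h : ℝ) (n : ℕ) :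
    Measurable fun p : Vec d × Vec d => localRisk ν μ θ M C h n p.1 p.2 := by
  have hmass : Measurable fun p : Vec d × Vec d => ν (indexWindow h p.2 p.1) :=
    measurable_measure_prodMk_left (measurableSet_indexWindow h)
  have hinv := (hmass.const_mul (n : ENNReal)).inv
  have hbias : Measurable fun p : Vec d × Vec d => ∫⁻ x' in indexWindow h p.2 p.1,
      ENNReal.ofReal (M * |inner ℝ (x' - μ) (θ - p.1)|) ∂ν := by
    have hind : Measurable ({q : (Vec d × Vec d) × Vec d |
        q.2 ∈ indexWindow h q.1.2 q.1.1}.indicator fun q =>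
          ENNReal.ofReal (M * |inner ℝ (q.2 - μ) (θ - q.1.1)|)) :=
      Measurable.indicator (by fun_prop) (measurableSet_indexWindow h)
    convert hind.lintegral_prod_right' (ν := ν) using 2 with p
    exact (lintegral_indicator
      ((measurableSet_indexWindow h).preimage measurable_prodMk_left) _).symm
  have hmean := hbias.div hmass
  simp only [Pi.div_def, Pi.inv_def] at hmean hinv
  unfold localRisk
  fun_prop

variable {μ θ v : Vec d} {S : Matrix (Fin d) (Fin d) ℝ} {M C h : ℝ} {n : ℕ}

lemma lintegral_inv_weight_mul_inv_window_le (ν : Measure (Vec d)) [SFinite ν] (hh : 0 < h)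
    (hh1 : h ≤ 1) (hn : 0 < n) :
    ∫⁻ x, ENNReal.ofReal (h * (1 + inner ℝ (x - μ) v ^ 2))⁻¹ *
        (n * ν (indexWindow h x v))⁻¹ ∂ν ≤ ENNReal.ofReal (2 * Real.pi / (n * h ^ 2)) := by
  have hn' : (n : ENNReal) ≠ 0 := by exact_mod_cast hn.ne'
  calc ∫⁻ x, ENNReal.ofReal (h * (1 + inner ℝ (x - μ) v ^ 2))⁻¹ *
        (n * ν (indexWindow h x v))⁻¹ ∂ν
      = ∫⁻ x, ENNReal.ofReal (n * h)⁻¹ * (ENNReal.ofReal (1 + (inner ℝ x v - inner ℝ μ v) ^ 2)⁻¹ *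
          (ν ((fun x' => inner ℝ x' v) ⁻¹' Metric.closedBall (inner ℝ x v) h))⁻¹) ∂ν := by
        refine lintegral_congr fun x => ?_
        rw [ENNReal.mul_inv (.inl hn') (.inl (ENNReal.natCast_ne_top n)), mul_inv, mul_inv,
          ENNReal.ofReal_mul (by positivity), ENNReal.ofReal_mul (by positivity), inner_sub_left,
          ENNReal.ofReal_inv_of_pos (Nat.cast_pos.2 hn), ENNReal.ofReal_natCast, indexWindow]
        ring
    _ ≤ ENNReal.ofReal (n * h)⁻¹ * ENNReal.ofReal (2 * Real.pi / h) := by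
        rw [lintegral_const_mul' _ _ ENNReal.ofReal_ne_top]
        exact mul_le_mul_right (lintegral_inv_one_add_sq_mul_inv_window_le
          (Z := fun x : Vec d => inner ℝ x v) (by fun_prop) hh hh1 _) _
    _ = _ := by
        rw [← ENNReal.ofReal_mul (by positivity)]
        congr 1
        field_simp

lemma lintegral_weight_le (hS : S.PosSemidef) (hh : 0 ≤ h) (hv : ‖sqrtMul S v‖ ≤ 1) :
    ∫⁻ x, ENNReal.ofReal (h * (1 + inner ℝ (x - μ) v ^ 2)) ∂(multivariateGaussian μ S) ≤
      ENNReal.ofReal (2 * h) := by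
  simp_rw [ENNReal.ofReal_mul hh, ENNReal.ofReal_add zero_le_one (sq_nonneg _),
    ENNReal.ofReal_one]
  rw [lintegral_const_mul' _ _ ENNReal.ofReal_ne_top, lintegral_add_left measurable_const,
    lintegral_inner_sub_sq_multivariateGaussian hS, lintegral_one, measure_univ,
    ← ENNReal.ofReal_one, ← ENNReal.ofReal_add zero_le_one (by positivity),
    ← ENNReal.ofReal_mul hh]
  refine ENNReal.ofReal_le_ofReal ?_
  nlinarith [pow_le_one₀ (n := 2) (norm_nonneg (sqrtMul S v)) hv]

lemma lintegral_const_mul_abs_inner_sub_le (hS : S.PosSemidef) (hM : 0 ≤ M) :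
    ∫⁻ x, ENNReal.ofReal (M * |inner ℝ (x - μ) v|) ∂(multivariateGaussian μ S) ≤
      ENNReal.ofReal (M * ‖sqrtMul S v‖) := by
  simp_rw [ENNReal.ofReal_mul hM]
  rw [lintegral_const_mul' _ _ ENNReal.ofReal_ne_top]
  exact mul_le_mul_right (lintegral_abs_inner_sub_multivariateGaussian_le hS μ v) _

theorem lintegral_localRisk_le (hS : S.PosSemidef) (hM : 0 ≤ M) (hC : 0 ≤ C) (hh : 0 < h)
    (hh1 : h ≤ 1) (hn : 0 < n) (hv : ‖sqrtMul S v‖ ≤ 1) :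
    ∫⁻ x, localRisk (multivariateGaussian μ S) μ θ M C h n v x ∂(multivariateGaussian μ S) ≤
      ENNReal.ofReal (M * h + C * (2 * h + 2 * Real.pi / (n * h ^ 2))) +
        ENNReal.ofReal (3 * M) * ENNReal.ofReal ‖sqrtMul S (θ - v)‖ := by
  have hbias : ∫⁻ x, ENNReal.ofReal (M * (h + |inner ℝ (x - μ) (θ - v)|))
      ∂(multivariateGaussian μ S) ≤
      ENNReal.ofReal (M * h) + ENNReal.ofReal (M * ‖sqrtMul S (θ - v)‖) := by
    simp_rw [mul_add, ENNReal.ofReal_add (mul_nonneg hM hh.le) (mul_nonneg hM (abs_nonneg _))]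
    rw [lintegral_add_left measurable_const, lintegral_const, measure_univ, mul_one]
    exact add_le_add_right (lintegral_const_mul_abs_inner_sub_le hS hM) _
  have hmean := (lintegral_window_average_le (ν := multivariateGaussian μ S) (h := h)
    (Z := fun x : Vec d => inner ℝ x v) (by fun_prop)
    (D := fun x => ENNReal.ofReal (M * |inner ℝ (x - μ) (θ - v)|)) (by fun_prop)).trans
    (mul_le_mul_right (lintegral_const_mul_abs_inner_sub_le hS hM) _)
  have hstoch := add_le_add (lintegral_weight_le (μ := μ) hS hh.le hv)
    (lintegral_inv_weight_mul_inv_window_le (μ := μ) (v := v) (multivariateGaussian μ S) hh hh1 hn)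
  have hmass : Measurable fun x => (n * multivariateGaussian μ S (indexWindow h x v))⁻¹ :=
    ((measurable_measure_window (Z := fun x : Vec d => inner ℝ x v) (by fun_prop)).const_mul _).inv
  unfold localRisk
  generalize multivariateGaussian μ S = ν at *
  rw [lintegral_add_right _ (by fun_prop), lintegral_add_left (by fun_prop),
    lintegral_const_mul' _ _ ENNReal.ofReal_ne_top, lintegral_add_left (by fun_prop)]
  refine (add_le_add (add_le_add hbias hmean) (mul_le_mul_right hstoch _)).trans_eq ?_
  rw [ENNReal.ofReal_add (by positivity) (by positivity), ENNReal.ofReal_mul hC,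
    ENNReal.ofReal_add (p := 2 * h) (by positivity) (by positivity),
    ENNReal.ofReal_mul (q := ‖_‖) hM, ENNReal.ofReal_mul (p := 3) (by norm_num),
    ENNReal.ofReal_ofNat]
  ring

end IntegratedRisk

section LinkError

variable {d n n₀ N : ℕ} {I : Problem d} {Lf Lf' m cmin cmax σ W h : ℝ} {v x : Vec d}

lemma measurable_localAverage_section {E α : Type*} [MeasurableSpace E] [MeasurableSpace α]
    {V : Set (α × E)} (hV : MeasurableSet V) :
    Measurable fun p : (α × (Fin n → E)) × (Fin n → ℝ) =>
      localAverage (Prod.mk p.1.1 ⁻¹' V) p.1.2 p.2 := by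
  simp_rw [localAverage_eq_sum_localWeight_mul]
  exact Finset.measurable_fun_sum _ fun i _ =>
    ((measurable_localWeight_section hV i).comp measurable_fst).mul
      ((measurable_pi_apply i).comp measurable_snd)

lemma measurable_localAverage_indexWindow (h : ℝ) :
    Measurable fun p : ((Vec d × (Fin n → Vec d)) × (Fin n → ℝ)) × Vec d =>
      localAverage (indexWindow h p.2 p.1.1.1) p.1.1.2 p.1.2 :=
  (measurable_localAverage_section (measurableSet_indexWindow h)).comp
    (f := fun p : ((Vec d × (Fin n → Vec d)) × (Fin n → ℝ)) × Vec d =>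
      (((p.1.1.1, p.2), p.1.1.2), p.1.2)) (by fun_prop)

/-- The error at the arm `x` of averaging the rewards of the arms `xs` with noise `ηs` over the
window `indexWindow h x v`. -/
noncomputable def localError (I : Problem d) (h : ℝ) (v : Vec d) (xs : Fin n → Vec d)
    (ηs : Fin n → ℝ) (x : Vec d) : ENNReal :=
  ‖localAverage (indexWindow h x v) xs (fun i => I.f (inner ℝ (xs i) I.θ) + ηs i) -
    I.f (inner ℝ x I.θ)‖ₑ

lemma measurable_indicator_lt_abs_inner (μ : Vec d) (W : ℝ) (c : ENNReal) :
    Measurable fun p : Vec d × Vec d =>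
      {x | W < |inner ℝ (x - μ) p.1|}.indicator (fun _ => c) p.2 :=
  measurable_const.indicator (s := {p : Vec d × Vec d | W < |inner ℝ (p.2 - μ) p.1|})
    (measurableSet_lt measurable_const (by fun_prop))

lemma kernelRegression_eq_localAverage {μ : Vec d} (hh : 0 < h) (xs : Fin n → Vec d)
    (ys : Fin n → ℝ) (hW : |inner ℝ (x - μ) v| ≤ W) :
    kernelRegression μ W h v xs ys (inner ℝ x v) = localAverage (indexWindow h x v) xs ys := by
  have hkernel : ∀ i, uniformKernel h (inner ℝ x v - inner ℝ (xs i) v) =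
      (indexWindow h x v).indicator (fun _ => 1 / h) (xs i) := fun i => by
    refine Set.indicator_eq_indicator ?_ rfl
    rw [indexWindow, Set.mem_preimage, Metric.mem_closedBall, dist_comm]
    exact Iff.rfl
  have hpull : ∀ i, ys i * (indexWindow h x v).indicator (fun _ => 1 / h) (xs i) =
      1 / h * (indexWindow h x v).indicator (fun _ => ys i) (xs i) := fun i => by
    by_cases hi : xs i ∈ indexWindow h x v
    · rw [Set.indicator_of_mem hi, Set.indicator_of_mem hi, mul_comm]
    · rw [Set.indicator_of_notMem hi, Set.indicator_of_notMem hi, mul_zero, mul_zero]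
  rw [kernelRegression, if_pos (by rwa [← inner_sub_left]), localAverage]
  simp_rw [hkernel, hpull, sum_indicator_const, ← Finset.mul_sum]
  rw [mul_comm (hitCount _ _ : ℝ), mul_div_mul_left _ _ (by positivity)]

namespace Problem.Admissible

lemma abs_link_sub_le (ha : I.Admissible Lf Lf' m cmin cmax) (u v : ℝ) :
    |I.f u - I.f v| ≤ Lf' * |u - v| :=
  Convex.norm_image_sub_le_of_norm_deriv_le (fun z _ => ha.smooth.differentiable one_ne_zero z)
    (fun z _ => ha.deriv_bdd z) convex_univ (Set.mem_univ v) (Set.mem_univ u)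

lemma enorm_link_sub_le_of_mem_indexWindow (ha : I.Admissible Lf Lf' m cmin cmax) (μ : Vec d)
    {x' : Vec d} (hx' : x' ∈ indexWindow h x v) :
    ‖I.f (inner ℝ x' I.θ) - I.f (inner ℝ x I.θ)‖ₑ ≤
      ENNReal.ofReal (Lf' * (h + |inner ℝ (x - μ) (I.θ - v)|)) +
        ENNReal.ofReal (Lf' * |inner ℝ (x' - μ) (I.θ - v)|) := by
  have hLf' : 0 ≤ Lf' := (abs_nonneg _).trans (ha.deriv_bdd 0)
  have hh : |(inner ℝ x' v - inner ℝ x v : ℝ)| ≤ h := Real.dist_eq _ _ ▸ hx'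
  have hdecomp : (inner ℝ x' I.θ - inner ℝ x I.θ : ℝ) = (inner ℝ x' v - inner ℝ x v) -
      inner ℝ (x - μ) (I.θ - v) + inner ℝ (x' - μ) (I.θ - v) := by
    simp only [inner_sub_left, inner_sub_right]
    ring
  rw [Real.enorm_eq_ofReal_abs, ← ENNReal.ofReal_add
    (mul_nonneg hLf' (add_nonneg ((abs_nonneg _).trans hh) (abs_nonneg _))) (by positivity),
    ← mul_add]
  refine ENNReal.ofReal_le_ofReal ((ha.abs_link_sub_le _ _).trans
    (mul_le_mul_of_nonneg_left ?_ hLf'))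
  rw [hdecomp]
  refine (abs_add_le _ _).trans (add_le_add_left ((abs_sub _ _).trans ?_) _)
  exact add_le_add_left hh _

lemma enorm_kernelRegression_sub_le (ha : I.Admissible Lf Lf' m cmin cmax) (hh : 0 < h)
    (μ : Vec d) (xs : Fin n → Vec d) (ηs : Fin n → ℝ) :
    ‖kernelRegression μ W h v xs (fun i => I.f (inner ℝ (xs i) I.θ) + ηs i) (inner ℝ x v) -
        I.f (inner ℝ x I.θ)‖ₑ ≤
      localError I h v xs ηs x +
        {x | W < |inner ℝ (x - μ) v|}.indicator (fun _ => ENNReal.ofReal Lf) x := by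
  rcases le_or_gt |inner ℝ (x - μ) v| W with hW | hW
  · rw [kernelRegression_eq_localAverage hh xs _ hW]
    exact le_self_add
  · rw [Set.indicator_of_mem (show x ∈ {x | W < |inner ℝ (x - μ) v|} from hW), kernelRegression,
      if_neg (by rwa [← inner_sub_left, not_le]), zero_sub, enorm_neg, Real.enorm_eq_ofReal_abs]
    exact (ENNReal.ofReal_le_ofReal (ha.f_bdd _)).trans le_add_self

lemma measurable_localError (ha : I.Admissible Lf Lf' m cmin cmax) (h : ℝ) :
    Measurable fun p : ((Vec d × (Fin n → Vec d)) × (Fin n → ℝ)) × Vec d =>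
      localError I h p.1.1.1 p.1.1.2 p.1.2 p.2 := by
  have hrewards : Measurable fun (p : ((Vec d × (Fin n → Vec d)) × (Fin n → ℝ)) × Vec d) i =>
      I.f (inner ℝ (p.1.1.2 i) I.θ) + p.1.2 i :=
    measurable_pi_lambda _ fun i => (ha.measurable_link.comp (by fun_prop)).add (by fun_prop)
  have haverage := (measurable_localAverage_indexWindow (d := d) (n := n) h).comp
    (f := fun p : ((Vec d × (Fin n → Vec d)) × (Fin n → ℝ)) × Vec d =>
      ((p.1.1, fun i => I.f (inner ℝ (p.1.1.2 i) I.θ) + p.1.2 i), p.2))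
    ((measurable_fst.fst.prodMk hrewards).prodMk measurable_snd)
  exact (haverage.sub (ha.measurable_link.comp (by fun_prop))).enorm

lemma lintegral_tail_le (ha : I.Admissible Lf Lf' m cmin cmax) (hv : ‖sqrtMul I.SX v‖ ≤ 1)
    (W : ℝ) :
    ∫⁻ x, {x | W < |inner ℝ (x - I.μX) v|}.indicator (fun _ => ENNReal.ofReal Lf) x ∂I.law ≤
      ENNReal.ofReal (Lf * (4 * Real.exp (-W))) := by
  have hmeas : MeasurableSet {x : Vec d | W < |inner ℝ (x - I.μX) v|} :=
    measurableSet_lt measurable_const (by fun_prop)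
  rw [lintegral_indicator_const hmeas, ENNReal.ofReal_mul ((abs_nonneg _).trans (ha.f_bdd 0))]
  exact mul_le_mul_right (multivariateGaussian_lt_abs_inner_sub_le ha.posDef.posSemidef _ hv W) _

end Problem.Admissible

instance : IsProbabilityMeasure I.law :=
  inferInstanceAs (IsProbabilityMeasure (multivariateGaussian I.μX I.SX))

variable {Ω : Type*} {mΩ : MeasurableSpace Ω} {P : Measure Ω} {F : ℕ → MeasurableSpace Ω}
  {X : ℕ → Ω → Vec d} {η : ℕ → Ω → ℝ} {V : Ω → Vec d}

namespace IsSampling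

lemma measurable_regressionData (hs : IsSampling P I.law σ F N X η) (hn : n₀ + n ≤ N)
    (hV : Measurable[F n₀] V) :
    Measurable[F (n₀ + n)] fun ω => ((V ω, batch X n₀ n ω), batch η n₀ n ω) := by
  have hη : Measurable[F (n₀ + n)] (batch η n₀ n) :=
    @measurable_pi_lambda _ _ _ (F (n₀ + n)) _ _ fun i => hs.measurable_noise_of_lt (by omega) hn
  exact ((hV.mono (hs.le_of_le (by omega) hn) le_rfl).prodMk
    (hs.measurable_batch_of_le le_rfl hn)).prodMk hη

variable [IsProbabilityMeasure P]

lemma lintegral_localError_le_lintegral_localRisk (hs : IsSampling P I.law σ F N X η)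
    (ha : I.Admissible Lf Lf' m cmin cmax) (hn : n₀ + n ≤ N) (hV : Measurable[F n₀] V)
    (hh : 0 < h) (x : Vec d) :
    ∫⁻ ω, localError I h (V ω) (batch X n₀ n ω) (batch η n₀ n ω) x ∂P ≤
      ∫⁻ ω, localRisk I.law I.μX I.θ Lf' (Lf + 1 + 2 * σ ^ 2) h n (V ω) x ∂P := by
  have hU : MeasurableSet {p : Vec d × Vec d | p.2 ∈ indexWindow h x p.1} :=
    (measurableSet_indexWindow h).preimage (f := fun p : Vec d × Vec d => ((p.1, x), p.2))
      (by fun_prop)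
  have hweight : ∀ v, h ≤ h * (1 + inner ℝ (x - I.μX) v ^ 2) := fun v =>
    le_mul_of_one_le_right hh.le (le_add_of_nonneg_right (sq_nonneg _))
  have hle := hs.lintegral_enorm_localAverage_sub_le hn hV hU
    (g := fun x' => I.f (inner ℝ x' I.θ)) (ha.f_bdd (inner ℝ x I.θ))
    (a := fun v => ENNReal.ofReal (Lf' * (h + |inner ℝ (x - I.μX) (I.θ - v)|))) (by fun_prop)
    (A := fun p => ENNReal.ofReal (Lf' * |inner ℝ (p.2 - I.μX) (I.θ - p.1)|)) (by fun_prop)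
    (fun v x' hx' => ha.enorm_link_sub_le_of_mem_indexWindow I.μX hx')
    (ρ := fun v => (h * (1 + inner ℝ (x - I.μX) v ^ 2))⁻¹) (by fun_prop)
    (fun v => inv_pos.2 (hh.trans_le (hweight v))) (fun v => inv_anti₀ hh (hweight v))
  simp_rw [inv_inv] at hle
  exact hle

lemma lintegral_lintegral_localError_le (hs : IsSampling P I.law σ F N X η)
    (ha : I.Admissible Lf Lf' m cmin cmax) (hn : n₀ + n ≤ N) (hn0 : 0 < n)
    (hV : Measurable[F n₀] V) (hV1 : ∀ ω, ‖sqrtMul I.SX (V ω)‖ ≤ 1) (hh : 0 < h) (hh1 : h ≤ 1) :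
    ∫⁻ ω, ∫⁻ x, localError I h (V ω) (batch X n₀ n ω) (batch η n₀ n ω) x ∂I.law ∂P ≤
      ENNReal.ofReal (Lf' * h + (Lf + 1 + 2 * σ ^ 2) * (2 * h + 2 * Real.pi / (n * h ^ 2))) +
        ENNReal.ofReal (3 * Lf') * ∫⁻ ω, ENNReal.ofReal ‖sqrtMul I.SX (I.θ - V ω)‖ ∂P := by
  have hLf : 0 ≤ Lf := (abs_nonneg _).trans (ha.f_bdd 0)
  have hLf' : 0 ≤ Lf' := (abs_nonneg _).trans (ha.deriv_bdd 0)
  have hV' : Measurable V := hV.mono (hs.le n₀ (by omega)) le_rfl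
  have hdata := (hs.measurable_regressionData hn hV).mono (hs.le _ hn) le_rfl
  have herror := (ha.measurable_localError h).comp
    ((hdata.comp measurable_fst).prodMk (measurable_snd (α := Ω)))
  have hrisk := (measurable_localRisk I.law I.μX I.θ Lf' (Lf + 1 + 2 * σ ^ 2) h n).comp
    ((hV'.comp measurable_snd).prodMk (measurable_fst (β := Ω)))
  calc
    _ = ∫⁻ x, ∫⁻ ω, localError I h (V ω) (batch X n₀ n ω) (batch η n₀ n ω) x ∂P ∂I.law :=
      lintegral_lintegral_swap herror.aemeasurable
    _ ≤ ∫⁻ x, ∫⁻ ω, localRisk I.law I.μX I.θ Lf' (Lf + 1 + 2 * σ ^ 2) h n (V ω) x ∂P ∂I.law :=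
      lintegral_mono fun x => hs.lintegral_localError_le_lintegral_localRisk ha hn hV hh x
    _ = ∫⁻ ω, ∫⁻ x, localRisk I.law I.μX I.θ Lf' (Lf + 1 + 2 * σ ^ 2) h n (V ω) x ∂I.law ∂P :=
      lintegral_lintegral_swap hrisk.aemeasurable
    _ ≤ ∫⁻ ω, (ENNReal.ofReal
          (Lf' * h + (Lf + 1 + 2 * σ ^ 2) * (2 * h + 2 * Real.pi / (n * h ^ 2))) +
        ENNReal.ofReal (3 * Lf') * ENNReal.ofReal ‖sqrtMul I.SX (I.θ - V ω)‖) ∂P :=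
      lintegral_mono fun ω => lintegral_localRisk_le ha.posDef.posSemidef hLf' (by positivity)
        hh hh1 hn0 (hV1 ω)
    _ = _ := by
      rw [lintegral_add_left measurable_const, lintegral_const, measure_univ, mul_one,
        lintegral_const_mul' _ _ ENNReal.ofReal_ne_top]

theorem lintegral_enorm_kernelRegression_sub_le (hs : IsSampling P I.law σ F N X η)
    (ha : I.Admissible Lf Lf' m cmin cmax) (hn : n₀ + n ≤ N) (hn0 : 0 < n)
    (hV : Measurable[F n₀] V) (hV1 : ∀ ω, ‖sqrtMul I.SX (V ω)‖ ≤ 1) (hh : 0 < h) (hh1 : h ≤ 1)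
    {Y : Ω → Vec d} (hY : Measurable Y) (hlaw : P.map Y = I.law)
    {G : MeasurableSpace Ω} (hG : G ≤ mΩ) (hFG : F (n₀ + n) ≤ G)
    (hind : Indep (MeasurableSpace.comap Y inferInstance) G P) :
    ∫⁻ ω, ‖kernelRegression I.μX W h (V ω) (batch X n₀ n ω)
        (fun i => I.f (inner ℝ (batch X n₀ n ω i) I.θ) + batch η n₀ n ω i)
          (inner ℝ (Y ω) (V ω)) - I.f (inner ℝ (Y ω) I.θ)‖ₑ ∂P ≤
      ENNReal.ofReal (Lf' * h + (Lf + 1 + 2 * σ ^ 2) * (2 * h + 2 * Real.pi / (n * h ^ 2))) +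
        ENNReal.ofReal (3 * Lf') * ∫⁻ ω, ENNReal.ofReal ‖sqrtMul I.SX (I.θ - V ω)‖ ∂P +
        ENNReal.ofReal (Lf * (4 * Real.exp (-W))) := by
  have hdata := (hs.measurable_regressionData hn hV).mono hFG le_rfl
  have htail := (measurable_indicator_lt_abs_inner I.μX W (ENNReal.ofReal Lf)).comp
    (f := fun p : ((Vec d × (Fin n → Vec d)) × (Fin n → ℝ)) × Vec d => (p.1.1.1, p.2))
    (by fun_prop)
  have hsection := fun ω => (ha.measurable_localError h).comp (measurable_prodMk_left
    (x := ((V ω, batch X n₀ n ω), batch η n₀ n ω)))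
  refine (lintegral_mono fun ω => ha.enorm_kernelRegression_sub_le hh I.μX _ _).trans ?_
  refine (lintegral_comp_of_indep hG hY hind hdata
    ((ha.measurable_localError h).add htail)).trans_le ?_
  rw [hlaw]
  refine (lintegral_mono fun ω => (lintegral_add_left (hsection ω) _).trans_le
    (add_le_add_right (ha.lintegral_tail_le (hV1 ω) W) _)).trans ?_
  rw [lintegral_add_right _ measurable_const, lintegral_const, measure_univ, mul_one]
  exact add_le_add_left (hs.lintegral_lintegral_localError_le ha hn hn0 hV hV1 hh hh1) _

end IsSampling

end LinkError

section Environment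

lemma condExp_eq_zero_of_le {Ω : Type*} {m₁ m₂ mΩ : MeasurableSpace Ω} {P : Measure Ω}
    [IsFiniteMeasure P] {f : Ω → ℝ} (hle : m₁ ≤ m₂) (hm₂ : m₂ ≤ mΩ) (hf : P[f | m₂] =ᵐ[P] 0) :
    P[f | m₁] =ᵐ[P] 0 :=
  (condExp_condExp_of_le hle hm₂).symm.trans ((condExp_congr_ae hf).trans (by rw [condExp_zero]))

lemma condExp_le_const_of_le {Ω : Type*} {m₁ m₂ mΩ : MeasurableSpace Ω} {P : Measure Ω}
    [IsFiniteMeasure P] {f : Ω → ℝ} {c : ℝ} (hle : m₁ ≤ m₂) (hm₂ : m₂ ≤ mΩ)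
    (hf : ∀ᵐ ω ∂P, (P[f | m₂]) ω ≤ c) : ∀ᵐ ω ∂P, (P[f | m₁]) ω ≤ c := by
  have hmono : P[P[f | m₂] | m₁] ≤ᵐ[P] P[fun _ => c | m₁] :=
    condExp_mono integrable_condExp (integrable_const c) hf
  rw [condExp_const (hle.trans hm₂)] at hmono
  exact (condExp_condExp_of_le hle hm₂).symm.le.trans hmono

lemma indepFun_prodMk_of_indepFun_prodMk {Ω α β γ : Type*} {mΩ : MeasurableSpace Ω}
    [MeasurableSpace α] [MeasurableSpace β] [MeasurableSpace γ] {P : Measure Ω}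
    [IsProbabilityMeasure P] {X : Ω → α} {Y : Ω → β} {Z : Ω → γ} (hX : Measurable X)
    (hY : Measurable Y) (hZ : Measurable Z) (hXY : IndepFun X Y P)
    (hZYX : IndepFun Z (fun ω => (Y ω, X ω)) P) : IndepFun X (fun ω => (Y ω, Z ω)) P := by
  have hYZ : IndepFun Y Z P := hZYX.symm.comp measurable_fst measurable_id
  rw [indepFun_iff_map_prod_eq_prod_map_map (by fun_prop) (by fun_prop)]
  refine Measure.ext_prod₃ fun {s t u} hs ht hu => ?_
  have hZ_inter := hZYX.measure_inter_preimage_eq_mul u (t ×ˢ s) hu (ht.prod hs)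
  have hYX_inter := hXY.symm.measure_inter_preimage_eq_mul t s ht hs
  have hYZ_inter := hYZ.measure_inter_preimage_eq_mul t u ht hu
  simp only [Set.mk_preimage_prod] at hZ_inter
  rw [Measure.map_apply (by fun_prop) (hs.prod (ht.prod hu)), Measure.prod_prod,
    Measure.map_apply hX hs, Measure.map_apply (by fun_prop) (ht.prod hu), Set.mk_preimage_prod,
    Set.mk_preimage_prod, hYZ_inter, ← Set.inter_assoc, Set.inter_comm (X ⁻¹' s),
    Set.inter_comm _ (Z ⁻¹' u), hZ_inter, hYX_inter]
  ring

variable {Ω : Type*} {d K : ℕ} {x : ℕ → Fin K → Ω → Vec d} {a : ℕ → Ω → Fin K} {η : ℕ → Ω → ℝ}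

/-- The σ-algebra generated by the history before round `t`. -/
abbrev past (x : ℕ → Fin K → Ω → Vec d) (a : ℕ → Ω → Fin K) (η : ℕ → Ω → ℝ) (t : ℕ) :
    MeasurableSpace Ω :=
  MeasurableSpace.comap (history x a η t) inferInstance

lemma measurable_history_apply_past {s t : ℕ} (hst : s < t) :
    Measurable[past x a η t] fun ω => (arms x s ω, a s ω, η s ω) :=
  (measurable_pi_apply (⟨s, hst⟩ : Fin t)).comp (comap_measurable (history x a η t))

lemma measurable_noise_past {s t : ℕ} (hst : s < t) : Measurable[past x a η t] (η s) :=
  (measurable_snd.comp measurable_snd).comp (measurable_history_apply_past hst)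

lemma past_mono {s t : ℕ} (hst : s ≤ t) : past x a η s ≤ past x a η t :=
  Measurable.comap_le (@measurable_pi_lambda _ _ _ (past x a η t) _ _ fun r : Fin s =>
    measurable_history_apply_past (r.2.trans_le hst))

lemma measurable_eval_fin : Measurable fun p : (Fin K → Vec d) × Fin K => p.1 p.2 :=
  measurable_from_prod_countable_left fun k => measurable_pi_apply k

lemma measurable_played_of {G : MeasurableSpace Ω} {t : ℕ} (harms : Measurable[G] (arms x t))
    (haction : Measurable[G] (a t)) : Measurable[G] (played x a t) :=
  measurable_eval_fin.comp (harms.prodMk haction)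

lemma measurable_played_past {s t : ℕ} (hst : s < t) : Measurable[past x a η t] (played x a s) :=
  measurable_played_of (measurable_fst.comp (measurable_history_apply_past hst))
    ((measurable_fst.comp measurable_snd).comp (measurable_history_apply_past hst))

lemma past_sup_played_le (t : ℕ) :
    past x a η t ⊔ MeasurableSpace.comap (played x a t) inferInstance ≤ preReward x a η t := by
  have hinfo : Measurable[preReward x a η t] fun ω => (history x a η t ω, arms x t ω, a t ω) :=
    comap_measurable (fun ω => (history x a η t ω, arms x t ω, a t ω))
  exact sup_le (Measurable.comap_le (measurable_fst.comp hinfo)) (Measurable.comap_le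
    (measurable_played_of ((measurable_fst.comp measurable_snd).comp hinfo)
      ((measurable_snd.comp measurable_snd).comp hinfo)))

variable {mΩ : MeasurableSpace Ω} {I : Problem d} {σ : ℝ} {t T : ℕ} {P : Measure Ω}

namespace IsEnvironment

lemma measurable_arms (he : IsEnvironment I σ T P x a η) (ht : t < T) : Measurable (arms x t) :=
  measurable_pi_lambda _ fun k => he.measurable_arm t ht k

lemma measurable_history (he : IsEnvironment I σ T P x a η) (ht : t ≤ T) :
    Measurable (history x a η t) :=
  measurable_pi_lambda _ fun s => have hs := s.2.trans_le ht
    (he.measurable_arms hs).prodMk ((he.measurable_action s hs).prodMk (he.measurable_noise s hs))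

lemma past_le (he : IsEnvironment I σ T P x a η) (ht : t ≤ T) : past x a η t ≤ mΩ :=
  (he.measurable_history ht).comap_le

lemma measurable_played (he : IsEnvironment I σ T P x a η) (ht : t < T) :
    Measurable (played x a t) :=
  measurable_played_of (he.measurable_arms ht) (he.measurable_action t ht)

lemma preReward_le (he : IsEnvironment I σ T P x a η) (ht : t < T) : preReward x a η t ≤ mΩ :=
  ((he.measurable_history ht.le).prodMk ((he.measurable_arms ht).prodMk
    (he.measurable_action t ht))).comap_le

lemma map_arm (he : IsEnvironment I σ T P x a η) (ht : t < T) (k : Fin K) :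
    P.map (x t k) = I.law := by
  rw [show x t k = (fun v : Fin K → Vec d => v k) ∘ arms x t from rfl,
    ← Measure.map_map (by fun_prop) (he.measurable_arms ht), he.arms_law t ht]
  exact (measurePreserving_eval (fun _ : Fin K => I.law) k).map_eq

lemma indep_arm (he : IsEnvironment I σ T P x a η) (ht : t < T) (k : Fin K) :
    Indep (MeasurableSpace.comap (x t k) inferInstance) (past x a η t) P :=
  (he.arms_indep t ht).comp (measurable_pi_apply k) measurable_id

lemma lintegral_indicator_eval (he : IsEnvironment I σ T P x a η) (ht : t < T) (k : Fin K)
    {A : Set (Vec d)} (hA : MeasurableSet A) :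
    ∫⁻ xs, A.indicator 1 (xs k) ∂(P.map (arms x t)) = I.law A := by
  rw [he.arms_law t ht, (measurePreserving_eval (fun _ : Fin K => I.law) k).lintegral_comp
    (measurable_one.indicator hA), lintegral_indicator_one hA]

variable [IsProbabilityMeasure P]

lemma measure_history_inter_played (he : IsEnvironment I σ T P x a η) (ht : t < T)
    (hblind : IndepFun (arms x t) (fun ω => (history x a η t ω, a t ω)) P)
    {A : Set (Vec d)} (hA : MeasurableSet A)
    {B : Set (Fin t → (Fin K → Vec d) × Fin K × ℝ)} (hB : MeasurableSet B) :
    P (history x a η t ⁻¹' B ∩ played x a t ⁻¹' A) = P (history x a η t ⁻¹' B) * I.law A := by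
  have hhist := he.measurable_history ht.le hB
  have hinfo := (he.measurable_history ht.le).prodMk (he.measurable_action t ht)
  have hA1 : Measurable (A.indicator (1 : Vec d → ENNReal)) := measurable_one.indicator hA
  have hB1 : Measurable (B.indicator fun _ => (1 : ENNReal)) := measurable_const.indicator hB
  calc P (history x a η t ⁻¹' B ∩ played x a t ⁻¹' A)
      = ∫⁻ ω, B.indicator 1 (history x a η t ω) * A.indicator 1 (arms x t ω (a t ω)) ∂P := by
        rw [← lintegral_indicator_one (hhist.inter (he.measurable_played ht hA)),
          Set.inter_indicator_one]
        rfl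
    _ = ∫⁻ ω, ∫⁻ xs, B.indicator 1 (history x a η t ω) * A.indicator 1 (xs (a t ω))
          ∂(P.map (arms x t)) ∂P :=
        lintegral_comp_of_indep hinfo.comap_le (he.measurable_arms ht) hblind (comap_measurable _)
          ((hB1.comp measurable_fst.fst).mul (hA1.comp (measurable_eval_fin.comp
            (measurable_snd.prodMk measurable_fst.snd))))
    _ = ∫⁻ ω, B.indicator 1 (history x a η t ω) * I.law A ∂P := lintegral_congr fun ω => by
        rw [lintegral_const_mul (f := fun xs : Fin K → Vec d => A.indicator 1 (xs (a t ω))) _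
          (hA1.comp (measurable_pi_apply _)), he.lintegral_indicator_eval ht _ hA]
    _ = P (history x a η t ⁻¹' B) * I.law A := by
        rw [lintegral_mul_const (f := fun ω => B.indicator 1 (history x a η t ω)) _
          (hB1.comp (he.measurable_history ht.le)),
          ← lintegral_indicator_one hhist]
        rfl

lemma map_played (he : IsEnvironment I σ T P x a η) (ht : t < T)
    (hblind : IndepFun (arms x t) (fun ω => (history x a η t ω, a t ω)) P) :
    P.map (played x a t) = I.law := by
  refine Measure.ext fun A hA => ?_
  rw [Measure.map_apply (he.measurable_played ht) hA]
  simpa using he.measure_history_inter_played ht hblind hA MeasurableSet.univ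

lemma indep_played (he : IsEnvironment I σ T P x a η) (ht : t < T)
    (hblind : IndepFun (arms x t) (fun ω => (history x a η t ω, a t ω)) P) :
    Indep (MeasurableSpace.comap (played x a t) inferInstance) (past x a η t) P := by
  refine (indepFun_iff_measure_inter_preimage_eq_mul.2 fun B A hB hA => ?_).symm
  rw [he.measure_history_inter_played ht hblind hA hB, ← he.map_played ht hblind,
    Measure.map_apply (he.measurable_played ht) hA]

theorem isSampling {N : ℕ} (he : IsEnvironment I σ T P x a η) (hN : N ≤ T)
    (hblind : ∀ t < N, IndepFun (arms x t) (fun ω => (history x a η t ω, a t ω)) P) :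
    IsSampling P I.law σ (past x a η) N (played x a) η where
  le _ hi := he.past_le (hi.trans hN)
  le_succ _ _ := past_mono (Nat.le_succ _)
  measurable_design_succ _ _ := measurable_played_past (Nat.lt_succ_self _)
  measurable_noise_succ _ _ := measurable_noise_past (Nat.lt_succ_self _)
  law i hi := he.map_played (hi.trans_le hN) (hblind i hi)
  indep i hi := he.indep_played (hi.trans_le hN) (hblind i hi)
  noise_memLp i hi := he.noise_memLp i (hi.trans_le hN)
  noise_mean i hi := condExp_eq_zero_of_le (past_sup_played_le i) (he.preReward_le (hi.trans_le hN))
    (he.noise_mean i (hi.trans_le hN))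
  noise_var i hi := condExp_le_const_of_le (past_sup_played_le i) (he.preReward_le (hi.trans_le hN))
    (he.noise_var i (hi.trans_le hN))

end IsEnvironment

end Environment

section Regret

lemma ciSup_sub_le_two_mul_sum_abs_sub {ι : Type*} [Fintype ι] {u v : ι → ℝ} {k₀ : ι}
    (hk₀ : ∀ k, v k ≤ v k₀) : (⨆ k, u k) - u k₀ ≤ 2 * ∑ k, |v k - u k| := by
  have : Nonempty ι := ⟨k₀⟩
  have hle : ∀ k, |v k - u k| ≤ ∑ k, |v k - u k| := fun k =>
    Finset.single_le_sum (fun i _ => abs_nonneg (v i - u i)) (Finset.mem_univ k)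
  refine sub_le_iff_le_add.2 (ciSup_le fun k => ?_)
  linarith [hk₀ k, (abs_le.1 (hle k)).1, (abs_le.1 (hle k₀)).2]

lemma measurable_uniformKernel (h : ℝ) : Measurable (uniformKernel h) :=
  measurable_const.indicator (measurableSet_le (by fun_prop) measurable_const)

lemma measurable_kernelRegression {d n : ℕ} (μ : Vec d) (W h : ℝ) :
    Measurable fun p : ((Vec d × (Fin n → Vec d)) × (Fin n → ℝ)) × ℝ =>
      kernelRegression μ W h p.1.1.1 p.1.1.2 p.1.2 p.2 := by
  have hkernel : ∀ i, Measurable fun p : ((Vec d × (Fin n → Vec d)) × (Fin n → ℝ)) × ℝ =>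
      uniformKernel h (p.2 - inner ℝ (p.1.1.2 i) p.1.1.1) := fun i =>
    (measurable_uniformKernel h).comp (by fun_prop)
  refine Measurable.ite (measurableSet_le (by fun_prop) measurable_const) ?_ measurable_const
  exact (Finset.measurable_fun_sum _ fun i _ => Measurable.mul (by fun_prop) (hkernel i)).div
    (Finset.measurable_fun_sum _ fun i _ => hkernel i)

variable {Ω : Type*} {d K : ℕ} {x : ℕ → Fin K → Ω → Vec d} {a : ℕ → Ω → Fin K} {η : ℕ → Ω → ℝ}
  {I : Problem d} {t T T₁ : ℕ} {σ τ W h Lf Lf' m cmin cmax : ℝ} {θhat : Ω → Vec d}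

/-- The regret of a single round. -/
noncomputable def roundRegret (I : Problem d) (x : ℕ → Fin K → Ω → Vec d) (a : ℕ → Ω → Fin K)
    (t : ℕ) (ω : Ω) : ℝ :=
  (⨆ k, I.f (inner ℝ (x t k ω) I.θ)) - I.f (inner ℝ (played x a t ω) I.θ)

/-- The error of the estimated reward of arm `k` in round `t`. -/
noncomputable def linkError (I : Problem d) (T₁ : ℕ) (W h : ℝ) (x : ℕ → Fin K → Ω → Vec d)
    (a : ℕ → Ω → Fin K) (η : ℕ → Ω → ℝ) (θhat : Ω → Vec d) (t : ℕ) (k : Fin K) (ω : Ω) :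
    ENNReal :=
  ‖linkEstimate I T₁ W h x a η θhat ω (inner ℝ (x t k ω) (normalizedEstimator I (θhat ω))) -
    I.f (inner ℝ (x t k ω) I.θ)‖ₑ

lemma roundRegret_nonneg (ω : Ω) : 0 ≤ roundRegret I x a t ω :=
  sub_nonneg.2 (le_ciSup (f := fun k => I.f (inner ℝ (x t k ω) I.θ))
    (Set.finite_range _).bddAbove (a t ω))

lemma roundRegret_le (ha : I.Admissible Lf Lf' m cmin cmax) (ω : Ω) :
    roundRegret I x a t ω ≤ 2 * Lf := by
  have : Nonempty (Fin K) := ⟨a t ω⟩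
  have hbest : ⨆ k, I.f (inner ℝ (x t k ω) I.θ) ≤ Lf :=
    ciSup_le fun k => (abs_le.1 (ha.f_bdd _)).2
  have hplayed := (abs_le.1 (ha.f_bdd (inner ℝ (played x a t ω) I.θ))).1
  unfold roundRegret
  linarith

variable {mΩ : MeasurableSpace Ω} {P : Measure Ω}

/-- The policies covered by the analysis: GSTOR without regularization, but with any exploration
rule that does not look at the arms on offer in place of uniform sampling. -/
structure IsBlindGSTOR (I : Problem d) (T T₁ : ℕ) (τ W h : ℝ) (P : Measure Ω)
    (x : ℕ → Fin K → Ω → Vec d) (a : ℕ → Ω → Fin K) (η : ℕ → Ω → ℝ) (θhat : Ω → Vec d) :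
    Prop where
  explore_blind : ∀ t < T, t < 2 * T₁ →
    IndepFun (arms x t) (fun ω => (history x a η t ω, a t ω)) P
  estimator : ∀ ω, IsMinOn
    (steinObjective (n := T₁) (score (gaussianDensity I.μX I.SX)) τ 0
      (fun i => played x a i ω) (fun i => reward I x a η i ω)) Set.univ (θhat ω)
  greedy : ∀ t < T, 2 * T₁ ≤ t → ∀ ω k,
    linkEstimate I T₁ W h x a η θhat ω (inner ℝ (x t k ω) (normalizedEstimator I (θhat ω))) ≤
      linkEstimate I T₁ W h x a η θhat ω
        (inner ℝ (played x a t ω) (normalizedEstimator I (θhat ω)))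

lemma IsGSTOR.isBlindGSTOR [IsProbabilityMeasure P] (hg : IsGSTOR I T T₁ 0 τ W h P x a η θhat)
    (he : IsEnvironment I σ T P x a η) : IsBlindGSTOR I T T₁ τ W h P x a η θhat where
  explore_blind t ht ht' := indepFun_prodMk_of_indepFun_prodMk (he.measurable_arms ht)
    (he.measurable_history ht.le) (he.measurable_action t ht) (he.arms_indep t ht)
    (hg.explore_indep t ht ht')
  estimator := hg.estimator
  greedy := hg.greedy

namespace IsBlindGSTOR

lemma estimator_eq (hg : IsBlindGSTOR I T T₁ τ W h P x a η θhat) :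
    θhat = steinEstimate I τ T₁ (played x a) η := by
  funext ω
  rw [eq_smul_sum_of_isMinOn_steinObjective (hg.estimator ω), steinEstimate, Finset.sum_range]
  rfl

lemma ofReal_roundRegret_le (hg : IsBlindGSTOR I T T₁ τ W h P x a η θhat) (htT : t < T)
    (ht : 2 * T₁ ≤ t) (ω : Ω) :
    ENNReal.ofReal (roundRegret I x a t ω) ≤
      2 * ∑ k, linkError I T₁ W h x a η θhat t k ω := by
  refine (ENNReal.ofReal_le_ofReal
    (ciSup_sub_le_two_mul_sum_abs_sub (hg.greedy t htT ht ω))).trans_eq ?_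
  rw [ENNReal.ofReal_mul zero_le_two, ENNReal.ofReal_ofNat,
    ENNReal.ofReal_sum_of_nonneg fun k _ => abs_nonneg _]
  simp_rw [linkError, Real.enorm_eq_ofReal_abs]

end IsBlindGSTOR

namespace IsEnvironment

lemma measurable_roundRegret (he : IsEnvironment I σ T P x a η)
    (ha : I.Admissible Lf Lf' m cmin cmax) (ht : t < T) : Measurable (roundRegret I x a t) :=
  (Measurable.iSup fun k =>
    ha.measurable_link.comp ((he.measurable_arm t ht k).inner_const)).sub
      (ha.measurable_link.comp ((he.measurable_played ht).inner_const))

lemma isSampling_of_isBlindGSTOR [IsProbabilityMeasure P] (he : IsEnvironment I σ T P x a η)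
    (hg : IsBlindGSTOR I T T₁ τ W h P x a η θhat) (hT₁ : T₁ + T₁ ≤ T) :
    IsSampling P I.law σ (past x a η) (T₁ + T₁) (played x a) η :=
  he.isSampling hT₁ fun t ht => hg.explore_blind t (by omega) (by omega)

variable [IsProbabilityMeasure P]

lemma measurable_linkError (he : IsEnvironment I σ T P x a η)
    (hg : IsBlindGSTOR I T T₁ τ W h P x a η θhat) (ha : I.Admissible Lf Lf' m cmin cmax)
    (htT : t < T) (ht : 2 * T₁ ≤ t) (k : Fin K) :
    Measurable (linkError I T₁ W h x a η θhat t k) := by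
  have hs := he.isSampling_of_isBlindGSTOR hg (by omega)
  have harm := he.measurable_arm t htT k
  have hest := hs.measurable_steinEstimate (τ := τ) ha (n := T₁) (by omega)
  rw [← hg.estimator_eq] at hest
  have hnormalized := (measurable_normalizedEstimator I).comp hest
  have hdata := (hs.measurable_regressionData le_rfl hnormalized).mono (hs.le _ le_rfl) le_rfl
  have hindex : Measurable fun ω => inner ℝ (x t k ω) (normalizedEstimator I (θhat ω)) :=
    harm.inner (hnormalized.mono (hs.le _ (by omega)) le_rfl)
  have hrewards : Measurable fun ω (i : Fin T₁) => reward I x a η (T₁ + i) ω :=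
    measurable_pi_lambda _ fun i => (ha.measurable_link.comp
      ((hs.measurable_design (by omega)).inner_const)).add (hs.measurable_noise (by omega))
  have hestimate := (measurable_kernelRegression I.μX W h).comp
    ((hdata.fst.prodMk hrewards).prodMk hindex)
  exact (hestimate.sub (ha.measurable_link.comp harm.inner_const)).enorm

lemma lintegral_linkError_le (he : IsEnvironment I σ T P x a η)
    (hg : IsBlindGSTOR I T T₁ τ W h P x a η θhat) (ha : I.Admissible Lf Lf' m cmin cmax)
    (hm : 0 < m) (hcmin : 0 < cmin) (hτ : 0 < τ) (hT₁ : 0 < T₁) (hh : 0 < h) (hh1 : h ≤ 1)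
    (htT : t < T) (ht : 2 * T₁ ≤ t) (k : Fin K) :
    ∫⁻ ω, linkError I T₁ W h x a η θhat t k ω ∂P ≤
      ENNReal.ofReal (Lf' * h + (Lf + 1 + 2 * σ ^ 2) * (2 * h + 2 * Real.pi / (T₁ * h ^ 2)) +
        3 * Lf' * (2 * √cmax / m * (d * √(2 * (2 * (Lf ^ 2 + σ ^ 2) * cmin⁻¹) / T₁ +
          2 * (2 * (Lf ^ 2 + σ ^ 2) * cmin⁻¹ / τ) ^ 2))) + Lf * (4 * Real.exp (-W))) := by
  have hLf : 0 ≤ Lf := (abs_nonneg _).trans (ha.f_bdd 0)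
  have hLf' : 0 ≤ Lf' := (abs_nonneg _).trans (ha.deriv_bdd 0)
  have hs := he.isSampling_of_isBlindGSTOR hg (by omega)
  have hest := hs.measurable_steinEstimate (τ := τ) ha (n := T₁) (by omega)
  rw [← hg.estimator_eq] at hest
  have hdirection := hs.lintegral_norm_sqrtMul_normalizedEstimator_error_le ha hm hcmin
    (n := T₁) (by omega) hT₁ hτ
  rw [← hg.estimator_eq] at hdirection
  refine (hs.lintegral_enorm_kernelRegression_sub_le (W := W) ha le_rfl hT₁
    ((measurable_normalizedEstimator I).comp hest)
    (fun ω => norm_sqrtMul_normalizedEstimator_le I (θhat ω)) hh hh1 (he.measurable_arm t htT k)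
    (he.map_arm htT k) (he.past_le htT.le) (past_mono (by omega)) (he.indep_arm htT k)).trans ?_
  refine (add_le_add_left (add_le_add_right (mul_le_mul_right hdirection _) _) _).trans_eq ?_
  rw [← ENNReal.ofReal_mul (by positivity), ← ENNReal.ofReal_add (by positivity) (by positivity),
    ← ENNReal.ofReal_add (by positivity) (by positivity)]

lemma integral_roundRegret_le (he : IsEnvironment I σ T P x a η)
    (hg : IsBlindGSTOR I T T₁ τ W h P x a η θhat) (ha : I.Admissible Lf Lf' m cmin cmax)
    (htT : t < T) (ht : 2 * T₁ ≤ t) {B : ℝ} (hB : 0 ≤ B)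
    (herror : ∀ k, ∫⁻ ω, linkError I T₁ W h x a η θhat t k ω ∂P ≤ ENNReal.ofReal B) :
    ∫ ω, roundRegret I x a t ω ∂P ≤ 2 * (K * B) := by
  rw [integral_eq_lintegral_of_nonneg_ae (ae_of_all _ roundRegret_nonneg)
    (he.measurable_roundRegret ha htT).aestronglyMeasurable]
  refine ENNReal.toReal_le_of_le_ofReal (by positivity) ?_
  calc ∫⁻ ω, ENNReal.ofReal (roundRegret I x a t ω) ∂P
      ≤ ∫⁻ ω, 2 * ∑ k, linkError I T₁ W h x a η θhat t k ω ∂P :=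
        lintegral_mono (hg.ofReal_roundRegret_le htT ht)
    _ = 2 * ∑ k, ∫⁻ ω, linkError I T₁ W h x a η θhat t k ω ∂P := by
        rw [lintegral_const_mul' _ _ ENNReal.ofNat_ne_top,
          lintegral_finsetSum _ fun k _ => he.measurable_linkError hg ha htT ht k]
    _ ≤ 2 * ∑ _k : Fin K, ENNReal.ofReal B := by
        gcongr with k
        exact herror k
    _ = ENNReal.ofReal (2 * (K * B)) := by
        rw [Finset.sum_const, Finset.card_univ, Fintype.card_fin, nsmul_eq_mul,
          ENNReal.ofReal_mul zero_le_two, ENNReal.ofReal_mul (by positivity),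
          ENNReal.ofReal_natCast, ENNReal.ofReal_ofNat]

lemma integrable_roundRegret (he : IsEnvironment I σ T P x a η)
    (ha : I.Admissible Lf Lf' m cmin cmax) (ht : t < T) : Integrable (roundRegret I x a t) P :=
  Integrable.of_bound (he.measurable_roundRegret ha ht).aestronglyMeasurable (2 * Lf)
    (ae_of_all _ fun ω => by
      rw [Real.norm_of_nonneg (roundRegret_nonneg ω)]
      exact roundRegret_le ha ω)

lemma integrable_regret (he : IsEnvironment I σ T P x a η)
    (ha : I.Admissible Lf Lf' m cmin cmax) : Integrable (regret I x a T) P :=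
  integrable_finsetSum _ fun _ ht => he.integrable_roundRegret ha (Finset.mem_range.1 ht)

lemma integral_regret_le (he : IsEnvironment I σ T P x a η)
    (ha : I.Admissible Lf Lf' m cmin cmax) {n : ℕ} {B : ℝ} (hB : 0 ≤ B)
    (hle : ∀ t < T, n ≤ t → ∫ ω, roundRegret I x a t ω ∂P ≤ B) :
    ∫ ω, regret I x a T ω ∂P ≤ n * (2 * Lf) + T * B := by
  have hLf : 0 ≤ Lf := (abs_nonneg _).trans (ha.f_bdd 0)
  have hround : ∀ t ∈ Finset.range T,
      ∫ ω, roundRegret I x a t ω ∂P ≤ (if t < n then 2 * Lf else 0) + B := fun t ht => by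
    have htT := Finset.mem_range.1 ht
    split_ifs with htn
    · refine le_add_of_le_of_nonneg ?_ hB
      simpa using integral_mono (he.integrable_roundRegret ha htT) (integrable_const _)
        (roundRegret_le ha)
    · rw [zero_add]
      exact hle t htT (not_lt.1 htn)
  have hcard : ((Finset.range T).filter (· < n)).card ≤ n := by
    refine (Finset.card_le_card fun t ht => ?_).trans_eq (Finset.card_range n)
    exact Finset.mem_range.2 (Finset.mem_filter.1 ht).2
  calc ∫ ω, regret I x a T ω ∂P = ∑ t ∈ Finset.range T, ∫ ω, roundRegret I x a t ω ∂P :=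
        integral_finsetSum _ fun t ht => he.integrable_roundRegret ha (Finset.mem_range.1 ht)
    _ ≤ ∑ t ∈ Finset.range T, ((if t < n then 2 * Lf else 0) + B) := Finset.sum_le_sum hround
    _ ≤ n * (2 * Lf) + T * B := by
        rw [Finset.sum_add_distrib, Finset.sum_const, Finset.card_range, nsmul_eq_mul,
          ← Finset.sum_filter, Finset.sum_const, nsmul_eq_mul]
        gcongr

end IsEnvironment

end Regret

section Rates

lemma le_rpow_mul_rpow_of_pow_le {k l : ℕ} {c u v : ℝ} (hk : k ≠ 0) (hc : 0 ≤ c) (hu : 0 ≤ u)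
    (hv : 0 ≤ v) (huv : u ^ k ≤ c * v ^ l) :
    u ≤ c ^ (1 / k : ℝ) * v ^ (l / k : ℝ) := by
  have hroot := Real.rpow_le_rpow (by positivity) huv (by positivity : (0 : ℝ) ≤ 1 / k)
  rw [Real.mul_rpow hc (by positivity), ← Real.rpow_natCast v, ← Real.rpow_mul hv, one_div,
    Real.pow_rpow_inv_natCast hu hk] at hroot
  rwa [div_eq_mul_inv (l : ℝ), one_div]

lemma one_add_log_two_mul_div_le {c δ₀ p d T δ : ℝ} (hc : 0 < c) (hδ₀ : 0 < δ₀) (hd : 1 ≤ d)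
    (hT : 1 ≤ T) (hδ : 0 < δ) (hdT : d ^ 15 ≤ c * T ^ 2) (hδT : δ₀ * T ^ (-p) ≤ δ) :
    1 + Real.log (2 * d / δ) ≤
      (4 + |p| + |Real.log c| + |Real.log δ₀|) * (1 + Real.log T) := by
  have hT0 : 0 < T := by linarith
  have hlogT : 0 ≤ Real.log T := Real.log_nonneg hT
  have hlogd : 15 * Real.log d ≤ Real.log c + 2 * Real.log T := by
    have hlog := Real.log_le_log (by positivity) hdT
    rw [Real.log_mul hc.ne' (by positivity), Real.log_pow, Real.log_pow] at hlog
    exact_mod_cast hlog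
  have hlogδ : Real.log δ₀ - p * Real.log T ≤ Real.log δ := by
    have hlog := Real.log_le_log (by positivity) hδT
    rw [Real.log_mul hδ₀.ne' (by positivity), Real.log_rpow hT0] at hlog
    linarith
  have hp : p * Real.log T ≤ |p| * Real.log T := by gcongr; exact le_abs_self p
  have hcT : 0 ≤ |Real.log c| * Real.log T := by positivity
  have hδ₀T : 0 ≤ |Real.log δ₀| * Real.log T := by positivity
  rw [Real.log_div (by positivity) hδ.ne', Real.log_mul two_ne_zero (by positivity)]
  linarith [Real.log_two_lt_d9, le_abs_self (Real.log c), neg_abs_le (Real.log δ₀), abs_nonneg p,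
    abs_nonneg (Real.log c)]

lemma one_add_log_le_mul_rpow {T ε : ℝ} (hT : 1 ≤ T) (hε : 0 < ε) :
    1 + Real.log T ≤ (1 + 1 / ε) * T ^ ε := by
  have hlog := Real.log_le_rpow_div (zero_le_one.trans hT) hε
  have hone := Real.one_le_rpow hT hε.le
  rw [add_mul, one_mul, one_div_mul_eq_div]
  linarith

/-- The factor by which `d (1 + log (2 d / δ))` may exceed `T ^ (1 / 4)`. -/
noncomputable def dimConst (c δ₀ p : ℝ) : ℝ :=
  c ^ (1 / 15 : ℝ) * (11 * (4 + |p| + |Real.log c| + |Real.log δ₀|))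

lemma dimConst_nonneg {c : ℝ} (hc : 0 < c) (δ₀ p : ℝ) : 0 ≤ dimConst c δ₀ p := by
  unfold dimConst
  positivity

lemma mul_one_add_log_two_mul_div_le {c δ₀ p d T δ : ℝ} (hc : 0 < c) (hδ₀ : 0 < δ₀) (hd : 1 ≤ d)
    (hT : 1 ≤ T) (hδ : 0 < δ) (hdT : d ^ 15 ≤ c * T ^ 2) (hδT : δ₀ * T ^ (-p) ≤ δ) :
    d * (1 + Real.log (2 * d / δ)) ≤ dimConst c δ₀ p * T ^ (1 / 4 : ℝ) := by
  have hdim : d ≤ c ^ (1 / 15 : ℝ) * T ^ (2 / 15 : ℝ) := by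
    exact_mod_cast le_rpow_mul_rpow_of_pow_le (by norm_num) hc.le (by linarith) (by linarith) hdT
  have hlog : 1 + Real.log T ≤ 11 * T ^ (1 / 10 : ℝ) :=
    (one_add_log_le_mul_rpow hT (by norm_num : (0 : ℝ) < 1 / 10)).trans_eq (by norm_num)
  have hlogT : 0 ≤ Real.log T := Real.log_nonneg hT
  calc d * (1 + Real.log (2 * d / δ))
      ≤ d * ((4 + |p| + |Real.log c| + |Real.log δ₀|) * (1 + Real.log T)) := by
        gcongr
        exact one_add_log_two_mul_div_le hc hδ₀ hd hT hδ hdT hδT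
    _ ≤ (c ^ (1 / 15 : ℝ) * T ^ (2 / 15 : ℝ)) *
          ((4 + |p| + |Real.log c| + |Real.log δ₀|) * (11 * T ^ (1 / 10 : ℝ))) := by
        gcongr
    _ = dimConst c δ₀ p * T ^ (2 / 15 + 1 / 10 : ℝ) := by
        rw [Real.rpow_add (by linarith), dimConst]
        ring
    _ ≤ dimConst c δ₀ p * T ^ (1 / 4 : ℝ) :=
        mul_le_mul_of_nonneg_left (Real.rpow_le_rpow_of_exponent_le hT (by norm_num))
          (dimConst_nonneg hc δ₀ p)

lemma mul_rpow_neg_third_pow_three {n : ℝ} (hn : 0 < n) : n * (n ^ (-(1 / 3) : ℝ)) ^ 3 = 1 := by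
  rw [← Real.rpow_natCast, ← Real.rpow_mul hn.le]
  norm_num
  rw [Real.rpow_neg_one, mul_inv_cancel₀ hn.ne']

lemma mul_sqrt_estimator_risk_le {C A d ℓ n h : ℝ} (hC : 0 ≤ C) (hA : 0 ≤ A) (hd : 0 ≤ d)
    (hℓ : 0 < ℓ) (hn : 0 < n) (hh : 0 < h) (hnh : n * h ^ 3 = 1) (hle : d * (1 + ℓ) ≤ A / h) :
    d * √(2 * C / n + 2 * (C / √(3 * n / ℓ)) ^ 2) ≤ √((2 * C + C ^ 2) * A) * (√d * h) := by
  have hrisk : 2 * C / n + 2 * (C / √(3 * n / ℓ)) ^ 2 ≤ (2 * C + C ^ 2) * ((1 + ℓ) / n) := by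
    have hℓn : 0 ≤ C * ℓ / n := by positivity
    have hC2 : 0 ≤ C ^ 2 / n := by positivity
    have hC2ℓ : 0 ≤ C ^ 2 * ℓ / n := by positivity
    rw [div_pow, Real.sq_sqrt (by positivity)]
    calc 2 * C / n + 2 * (C ^ 2 / (3 * n / ℓ)) = 2 * C / n + 2 / 3 * (C ^ 2 * ℓ / n) := by
          field_simp
      _ ≤ 2 * C / n + 2 * (C * ℓ / n) + C ^ 2 / n + C ^ 2 * ℓ / n := by linarith
      _ = (2 * C + C ^ 2) * ((1 + ℓ) / n) := by ring
  have hn' : n⁻¹ = h ^ 3 := inv_eq_of_mul_eq_one_right hnh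
  calc d * √(2 * C / n + 2 * (C / √(3 * n / ℓ)) ^ 2)
      ≤ d * √((2 * C + C ^ 2) * ((1 + ℓ) / n)) := by gcongr
    _ = √((2 * C + C ^ 2) * (d * (d * (1 + ℓ)) * h ^ 3)) := by
        rw [← Real.sqrt_sq hd, ← Real.sqrt_mul (by positivity), Real.sqrt_sq hd, div_eq_mul_inv,
          hn']
        ring_nf
    _ ≤ √((2 * C + C ^ 2) * (d * (A / h) * h ^ 3)) := by gcongr
    _ = √((2 * C + C ^ 2) * A * (d * h ^ 2)) := by
        congr 1
        field_simp
    _ = √((2 * C + C ^ 2) * A) * (√d * h) := by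
        rw [Real.sqrt_mul (by positivity), Real.sqrt_mul hd, Real.sqrt_sq hh.le]

lemma rpow_fourth_le_rpow_third {d T n : ℝ} (hd : 1 ≤ d) (hT : 0 ≤ T)
    (hn : d ^ (3 / 8 : ℝ) * T ^ (3 / 4 : ℝ) ≤ n) : T ^ (1 / 4 : ℝ) ≤ n ^ (1 / 3 : ℝ) := by
  have hT4 : T ^ (3 / 4 : ℝ) ≤ n :=
    (le_mul_of_one_le_left (by positivity) (Real.one_le_rpow hd (by norm_num))).trans hn
  calc T ^ (1 / 4 : ℝ) = (T ^ (3 / 4 : ℝ)) ^ (1 / 3 : ℝ) := by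
        rw [← Real.rpow_mul hT]
        norm_num
    _ ≤ n ^ (1 / 3 : ℝ) := Real.rpow_le_rpow (by positivity) hT4 (by norm_num)

lemma mul_sqrt_mul_rpow_neg_third_le {d T n : ℝ} (hd : 0 < d) (hT : 0 < T)
    (hn : d ^ (3 / 8 : ℝ) * T ^ (3 / 4 : ℝ) ≤ n) :
    T * (√d * n ^ (-(1 / 3) : ℝ)) ≤ d ^ (3 / 8 : ℝ) * T ^ (3 / 4 : ℝ) := by
  calc T * (√d * n ^ (-(1 / 3) : ℝ))
      ≤ T * (√d * (d ^ (3 / 8 : ℝ) * T ^ (3 / 4 : ℝ)) ^ (-(1 / 3) : ℝ)) := by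
        refine mul_le_mul_of_nonneg_left (mul_le_mul_of_nonneg_left ?_ (by positivity)) hT.le
        exact Real.rpow_le_rpow_of_nonpos (by positivity) hn (by norm_num)
    _ = d ^ (1 / 2 + 3 / 8 * -(1 / 3) : ℝ) * T ^ (1 + 3 / 4 * -(1 / 3) : ℝ) := by
        rw [Real.mul_rpow (by positivity) (by positivity), ← Real.rpow_mul hd.le,
          ← Real.rpow_mul hT.le, Real.rpow_add hd, Real.rpow_add hT, Real.rpow_one,
          Real.sqrt_eq_rpow]
        ring
    _ = d ^ (3 / 8 : ℝ) * T ^ (3 / 4 : ℝ) := by norm_num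

end Rates

section Tuning

/-- The constant in the bound for the error of an estimated reward; `A` bounds
`d (1 + log (2 d / δ)) h` for the bandwidth `h`. -/
noncomputable def exploitConst (Lf Lf' σ m cmin cmax A : ℝ) : ℝ :=
  Lf' + (Lf + 1 + 2 * σ ^ 2) * (2 + 2 * Real.pi) + 3 * Lf' * (2 * √cmax / m *
    √((2 * (2 * (Lf ^ 2 + σ ^ 2) * cmin⁻¹) + (2 * (Lf ^ 2 + σ ^ 2) * cmin⁻¹) ^ 2) * A)) + 4 * Lf

lemma exploitConst_nonneg {Lf Lf' σ m cmin cmax A : ℝ} (hLf : 0 ≤ Lf) (hLf' : 0 ≤ Lf')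
    (hm : 0 < m) : 0 ≤ exploitConst Lf Lf' σ m cmin cmax A := by
  unfold exploitConst
  positivity

lemma error_le_exploitConst_mul {Lf Lf' σ m cmin cmax A d ℓ n h : ℝ} (hLf : 0 ≤ Lf)
    (hLf' : 0 ≤ Lf') (hm : 0 < m) (hcmin : 0 < cmin) (hA : 0 ≤ A) (hd : 1 ≤ d) (hℓ : 0 < ℓ)
    (hn : 0 < n) (hh : 0 < h) (hh1 : h ≤ 1) (hnh : n * h ^ 3 = 1) (hle : d * (1 + ℓ) ≤ A / h) :
    Lf' * h + (Lf + 1 + 2 * σ ^ 2) * (2 * h + 2 * Real.pi / (n * h ^ 2)) +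
        3 * Lf' * (2 * √cmax / m * (d * √(2 * (2 * (Lf ^ 2 + σ ^ 2) * cmin⁻¹) / n +
          2 * (2 * (Lf ^ 2 + σ ^ 2) * cmin⁻¹ / √(3 * n / ℓ)) ^ 2))) +
        Lf * (4 * Real.exp (-(2 * Real.log n))) ≤
      exploitConst Lf Lf' σ m cmin cmax A * (√d * h) := by
  have hestimator := mul_sqrt_estimator_risk_le (C := 2 * (Lf ^ 2 + σ ^ 2) * cmin⁻¹)
    (by positivity) hA (zero_le_one.trans hd) hℓ hn hh hnh hle
  have hbandwidth : h ≤ √d * h := le_mul_of_one_le_left hh.le (Real.one_le_sqrt.2 hd)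
  have hwindow : 2 * Real.pi / (n * h ^ 2) = 2 * Real.pi * h := by
    rw [div_eq_iff (by positivity)]
    linear_combination -2 * Real.pi * hnh
  have htail : Real.exp (-(2 * Real.log n)) ≤ h := by
    rw [show -(2 * Real.log n) = 2 * Real.log n⁻¹ by rw [Real.log_inv]; ring,
      inv_eq_of_mul_eq_one_right hnh, two_mul, Real.exp_add, Real.exp_log (by positivity),
      ← pow_add]
    exact pow_le_of_le_one hh.le hh1 (by norm_num)
  calc _ ≤ Lf' * (√d * h) + (Lf + 1 + 2 * σ ^ 2) * ((2 + 2 * Real.pi) * (√d * h)) +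
        3 * Lf' * (2 * √cmax / m * (√((2 * (2 * (Lf ^ 2 + σ ^ 2) * cmin⁻¹) +
          (2 * (Lf ^ 2 + σ ^ 2) * cmin⁻¹) ^ 2) * A) * (√d * h))) + Lf * (4 * (√d * h)) := by
        rw [hwindow, ← add_mul]
        gcongr
        exact htail.trans hbandwidth
    _ = exploitConst Lf Lf' σ m cmin cmax A * (√d * h) := by
        rw [exploitConst]
        ring

variable {Ω : Type*} {d K T T₁ : ℕ} {x : ℕ → Fin K → Ω → Vec d} {a : ℕ → Ω → Fin K}
  {η : ℕ → Ω → ℝ} {θhat : Ω → Vec d} {mΩ : MeasurableSpace Ω} {P : Measure Ω} {I : Problem d}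
  {σ Lf Lf' m cmin cmax A δ : ℝ}

lemma Problem.Admissible.one_le_dim (ha : I.Admissible Lf Lf' m cmin cmax) : 1 ≤ d := by
  refine Nat.one_le_iff_ne_zero.2 ?_
  rintro rfl
  simpa [l1Norm] using ha.normalized

theorem IsEnvironment.integral_regret_le_of_tuning [IsProbabilityMeasure P]
    (he : IsEnvironment I σ T P x a η) (ha : I.Admissible Lf Lf' m cmin cmax) (hm : 0 < m)
    (hcmin : 0 < cmin) (hδ : 0 < δ) (hδ1 : δ < 1) (hT₁ : 0 < T₁) (hA : 0 ≤ A)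
    (hg : IsBlindGSTOR I T T₁ √(3 * T₁ / Real.log (2 * d / δ)) (2 * Real.log T₁)
      ((T₁ : ℝ) ^ (-(1 / 3) : ℝ)) P x a η θhat)
    (hle : d * (1 + Real.log (2 * d / δ)) ≤ A * (T₁ : ℝ) ^ (1 / 3 : ℝ)) :
    ∫ ω, regret I x a T ω ∂P ≤ 4 * Lf * T₁ +
      2 * (K * exploitConst Lf Lf' σ m cmin cmax A) * (T * (√d * (T₁ : ℝ) ^ (-(1 / 3) : ℝ))) := by
  have hLf : 0 ≤ Lf := (abs_nonneg _).trans (ha.f_bdd 0)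
  have hLf' : 0 ≤ Lf' := (abs_nonneg _).trans (ha.deriv_bdd 0)
  have hd : (1 : ℝ) ≤ d := by exact_mod_cast ha.one_le_dim
  have hn : (0 : ℝ) < T₁ := by exact_mod_cast hT₁
  have hℓ : 0 < Real.log (2 * d / δ) := Real.log_pos (by rw [lt_div_iff₀ hδ]; linarith)
  have hh : (T₁ : ℝ) ^ (-(1 / 3) : ℝ) ≤ 1 :=
    Real.rpow_le_one_of_one_le_of_nonpos (by exact_mod_cast hT₁) (by norm_num)
  have hle' : d * (1 + Real.log (2 * d / δ)) ≤ A / (T₁ : ℝ) ^ (-(1 / 3) : ℝ) := by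
    rwa [Real.rpow_neg hn.le, div_inv_eq_mul]
  have hconst := exploitConst_nonneg (σ := σ) (cmin := cmin) (cmax := cmax) (A := A) hLf hLf' hm
  have hexploit : ∀ t < T, 2 * T₁ ≤ t → ∫ ω, roundRegret I x a t ω ∂P ≤
      2 * (K * (exploitConst Lf Lf' σ m cmin cmax A * (√d * (T₁ : ℝ) ^ (-(1 / 3) : ℝ)))) :=
    fun t htT ht => he.integral_roundRegret_le hg ha htT ht (by positivity) fun k =>
      (he.lintegral_linkError_le hg ha hm hcmin (by positivity) hT₁ (by positivity) hh htT ht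
        k).trans (ENNReal.ofReal_le_ofReal (error_le_exploitConst_mul hLf hLf' hm hcmin hA hd hℓ hn
          (by positivity) hh (mul_rpow_neg_third_pow_three hn) hle'))
  refine (he.integral_regret_le ha (by positivity) hexploit).trans_eq ?_
  push_cast
  ring

end Tuning

end SingleIndexBandit

theorem theorem5_general (K : ℕ) (Lf Lf' σ m cmin cmax c δ₀ p : ℝ)
    (hm : 0 < m) (hcmin : 0 < cmin) (hδ₀ : 0 < δ₀) :
    ∃ C : ℝ, 0 < C ∧
      ∀ (d T T₁ : ℕ) (δ : ℝ) (I : SingleIndexBandit.Problem d)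
        (Ω : Type*) [MeasurableSpace Ω] (P : Measure Ω) [IsProbabilityMeasure P]
        (x : ℕ → Fin K → Ω → SingleIndexBandit.Vec d) (a : ℕ → Ω → Fin K) (η : ℕ → Ω → ℝ)
        (θhat : Ω → SingleIndexBandit.Vec d),
        I.Admissible Lf Lf' m cmin cmax →
        (d : ℝ) ^ 15 ≤ c * (T : ℝ) ^ 2 →
        0 < δ → δ < 1 → δ₀ * (T : ℝ) ^ (-p) ≤ δ →
        T₁ = ⌈(d : ℝ) ^ (3 / 8 : ℝ) * (T : ℝ) ^ (3 / 4 : ℝ)⌉₊ →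
        SingleIndexBandit.IsEnvironment I σ T P x a η →
        SingleIndexBandit.IsBlindGSTOR I T T₁
          (Real.sqrt (3 * T₁ / Real.log (2 * d / δ)))
          (2 * Real.log T₁) ((T₁ : ℝ) ^ (-(1 / 3) : ℝ)) P x a η θhat →
        Integrable (SingleIndexBandit.regret I x a T) P ∧
        ∫ ω, SingleIndexBandit.regret I x a T ω ∂P
          ≤ C * ((d : ℝ) ^ (3 / 8 : ℝ) * (T : ℝ) ^ (3 / 4 : ℝ)) := by
  open SingleIndexBandit in
  set A := dimConst c δ₀ p
  set B := exploitConst Lf Lf' σ m cmin cmax A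
  refine ⟨|8 * Lf + 2 * (K * B)| + 1, by positivity, ?_⟩
  intro d T T₁ δ I Ω _ P _ x a η θhat ha hdT hδ hδ1 hδT hT₁ he hg
  have hLf : 0 ≤ Lf := (abs_nonneg _).trans (ha.f_bdd 0)
  have hB : 0 ≤ B := exploitConst_nonneg hLf ((abs_nonneg _).trans (ha.deriv_bdd 0)) hm
  have hd : (1 : ℝ) ≤ d := by exact_mod_cast ha.one_le_dim
  have hcT : 0 < c * (T : ℝ) ^ 2 := (by positivity : (0 : ℝ) < (d : ℝ) ^ 15).trans_le hdT
  have hc : 0 < c := pos_of_mul_pos_left hcT (sq_nonneg _)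
  have hT : (1 : ℝ) ≤ T := by
    exact_mod_cast Nat.one_le_iff_ne_zero.2 fun h => by simp [h] at hcT
  set N : ℝ := (d : ℝ) ^ (3 / 8 : ℝ) * (T : ℝ) ^ (3 / 4 : ℝ)
  have hN1 : 1 ≤ N := one_le_mul_of_one_le_of_one_le (Real.one_le_rpow hd (by norm_num))
    (Real.one_le_rpow hT (by norm_num))
  have hNT : N ≤ T₁ := hT₁ ▸ Nat.le_ceil N
  have hTN : (T₁ : ℝ) ≤ 2 * N := by linarith [hT₁ ▸ Nat.ceil_lt_add_one (zero_le_one.trans hN1)]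
  have hdim : d * (1 + Real.log (2 * d / δ)) ≤ A * (T₁ : ℝ) ^ (1 / 3 : ℝ) :=
    (mul_one_add_log_two_mul_div_le hc hδ₀ hd hT hδ hdT hδT).trans (mul_le_mul_of_nonneg_left
      (rpow_fourth_le_rpow_third hd (by linarith) hNT) (dimConst_nonneg hc δ₀ p))
  have hT₁0 : 0 < T₁ := by exact_mod_cast (zero_lt_one.trans_le hN1).trans_le hNT
  refine ⟨he.integrable_regret ha, ?_⟩
  calc ∫ ω, regret I x a T ω ∂P
      ≤ 4 * Lf * T₁ + 2 * (K * B) * (T * (√d * (T₁ : ℝ) ^ (-(1 / 3) : ℝ))) :=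
        he.integral_regret_le_of_tuning ha hm hcmin hδ hδ1 hT₁0 (dimConst_nonneg hc δ₀ p) hg hdim
    _ ≤ 4 * Lf * (2 * N) + 2 * (K * B) * N := by
        gcongr
        exact mul_sqrt_mul_rpow_neg_third_le (by linarith) (by linarith) hNT
    _ = (8 * Lf + 2 * (K * B)) * N := by ring
    _ ≤ (|8 * Lf + 2 * (K * B)| + 1) * N :=
        mul_le_mul_of_nonneg_right (by linarith [le_abs_self (8 * Lf + 2 * (K * B))])
          (by linarith)

theorem theorem5 (K : ℕ) (Lf Lf' σ m cmin cmax c δ₀ p : ℝ)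
    (hm : 0 < m) (hcmin : 0 < cmin) (hδ₀ : 0 < δ₀) :
    ∃ C : ℝ, 0 < C ∧
      ∀ (d T T₁ : ℕ) (δ : ℝ) (I : SingleIndexBandit.Problem d)
        (Ω : Type*) [MeasurableSpace Ω] (P : Measure Ω) [IsProbabilityMeasure P]
        (x : ℕ → Fin K → Ω → SingleIndexBandit.Vec d) (a : ℕ → Ω → Fin K) (η : ℕ → Ω → ℝ)
        (θhat : Ω → SingleIndexBandit.Vec d),
        I.Admissible Lf Lf' m cmin cmax →
        (d : ℝ) ^ 15 ≤ c * (T : ℝ) ^ 2 →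
        0 < δ → δ < 1 → δ₀ * (T : ℝ) ^ (-p) ≤ δ →
        T₁ = ⌈(d : ℝ) ^ (3 / 8 : ℝ) * (T : ℝ) ^ (3 / 4 : ℝ)⌉₊ →
        SingleIndexBandit.IsEnvironment I σ T P x a η →
        SingleIndexBandit.IsGSTOR I T T₁ 0
          (Real.sqrt (3 * T₁ / Real.log (2 * d / δ)))
          (2 * Real.log T₁) ((T₁ : ℝ) ^ (-(1 / 3) : ℝ)) P x a η θhat →
        Integrable (SingleIndexBandit.regret I x a T) P ∧
        ∫ ω, SingleIndexBandit.regret I x a T ω ∂P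
          ≤ C * ((d : ℝ) ^ (3 / 8 : ℝ) * (T : ℝ) ^ (3 / 4 : ℝ)) := by
  obtain ⟨C, hC, hbound⟩ := theorem5_general K Lf Lf' σ m cmin cmax c δ₀ p hm hcmin hδ₀
  exact ⟨C, hC, fun d T T₁ δ I Ω _ P _ x a η θhat ha hdT hδ hδ1 hδT hT₁ he hg =>
    hbound d T T₁ δ I Ω P x a η θhat ha hdT hδ hδ1 hδT hT₁ he (hg.isBlindGSTOR he)⟩
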